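/- Setting. For $w\in\mathbb R^3$ let $w^\times$ be the matrix of the cross product with $w$. A flexible spacecraft with unit attitude quaternion $q=(q_v,q_4)\in\mathbb R^3\times\mathbb R$, angular velocity $\omega\in\mathbb R^3$ and modal coordinates $\eta\in\mathbb R^n$ is described by $$\dot q_v=\tfrac12(q_v^\times+q_4I_3)\omega,\quad \dot q_4=-\tfrac12 q_v^{T}\omega,\quad J\dot\omega+\omega^\times J\omega+\delta\ddot\eta=u+d,\quad \ddot\eta+C\dot\eta+K\eta=-\delta^{T}\dot\omega,$$ with $J\in\mathbb R^{3\times3}$ and $C,K\in\mathbb R^{n\times n}$ symmetric positive definite, $\delta\in\mathbb R^{3\times n}$, and $J-\delta\delta^{T}$ positive definite. The desired attitude $q_d=(q_{dv},q_{d4})$ is a constant unit quaternion, and $q_{ev}=q_{d4}q_v-q_{dv}^\times q_v-q_4q_{dv}$. Inertia. Let $L(x)$ be the $3\times 6$ matrix, linear in $x\in\mathbb R^3$, with $Jx=L(x)\,(J_{11},J_{22},J_{33},J_{23},J_{13},J_{12})^T$ for symmetric $J$. Suppose $(J_{11},J_{22},J_{33},J_{23},J_{13},J_{12})^T=\bar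 L_1\mu+\bar L_0$ with known $\bar L_0,\bar L_1$ and an unknown vector $\mu\in\mathbb R^{n_\mu}$, $n_\mu\ge 0$, and put $L_i(x)=L(x)\bar L_i$, $F_i(\omega)=-\omega^\times L_i(\omega)$, $i=0,1$. Disturbance. Let $d_i(t)=C_{i0}+\sum_{j=1}^{N_i}C_{ij}\sin(b_{ij}t+l_{ij})$, $i=1,2,3$, and let $\sigma\in\mathcal S\subset\mathbb R^{n_\sigma}$ be the vector of unknown frequencies, $\mathcal S$ being the set of its possible values. For some integers $r_i\ge1$ and numbers $a_{ij}(s)$, $s\in\mathcal S$, let $d_i^{(r_i)}=\sum_{j=1}^{r_i}a_{ij}(\sigma)\,d_i^{(j-1)}$, where for every $s\in\mathcal S$ the roots of $\lambda^{r_i}-\sum_{j=1}^{r_i} a_{ij}(s)\lambda^{j-1}$ are distinct with zero real parts. Let $\Phi_i(s)$ be the companion matrix with last row $(a_{i1}(s),\dots,a_{ir_i}(s))$, $\Psi_i=(1,0,\dots,0)$, $\varrho_i=\operatorname{col}(d_i,\dot d_i,\dots,d_i^{(r_i-1)})$, and let $(M_i,N_i)$ be a controllable pair, $M_i\in\mathbb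 R^{r_i\times r_i}$ Hurwitz, $N_i\in\mathbb R^{r_i}$. Let $T_i(s)$ be the (nonsingular) solution of $T_i(s)\Phi_i(s)-M_iT_i(s)=N_i\Psi_i$. Let $M,N,\Psi,T(s)$ be the block diagonal matrices formed from the three channels, $\varrho=\operatorname{col}(\varrho_1,\varrho_2,\varrho_3)$ and $r=r_1+r_2+r_3$. Parameterization. Suppose that, for all $s\in\mathcal S$, $\Psi T(s)^{-1}=E_0+\sum_{j=1}^{\ell}E^j\Omega_j(s)$ with constant matrices $E_0,E^j\in\mathbb R^{3\times r}$ and real functions $\Omega_j$ on $\mathcal S$, without redundancy: for each $i\in\{1,2,3\}$, the constant function $1$ and those $\Omega_j$ for which the $i$-th row of $E^j$ is nonzero are linearly independent functions on $\mathcal S$. Put $E=[E^1,\dots,E^\ell]$ and $E\circ X=[E^1X,\dots,E^\ell X]$ for a matrix or vector $X$ with $r$ rows, $\Omega^\sigma=\operatorname{col}(\Omega_1(\sigma),\dots,\Omega_\ell(\sigma))$, $R(\sigma,\mu)=\operatorname{col}(\mu,\ \Omega^\sigma\otimes\mu,\ \Omega^\sigma)$, and $$\rho(\omega,\zeta,v)=\big[\,F_1(\omega)+E_0(NL_1(\omega)+\zeta)\quad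 E\circ(\zeta+NL_1(\omega))\quad E\circ(NL_0(\omega)-v)\,\big].$$ Control law. For gains $k_1,k_2,k>0$ let $$\begin{aligned}u&=-k_1q_{ev}-k_2\omega-\rho(\omega,\zeta,v)\hat R-E_0NL_0(\omega)+\delta C\delta^{T}\omega+E_0v-F_0(\omega),\\ \dot v&=Mv+Nu+NF_0(\omega)-MNL_0(\omega),\quad \dot{\hat R}=k\,\rho(\omega,\zeta,v)^{T}\omega,\quad \dot\zeta=M\zeta+MNL_1(\omega)-NF_1(\omega),\end{aligned}$$ with $v(t)\in\mathbb R^r$, $\zeta(t)\in\mathbb R^{r\times n_\mu}$. Persistent excitation. A signal $f:[0,\infty)\to\mathbb R^m$ is persistently exciting (PE) if there are $t_0,T_0,\vartheta>0$ with $\frac1{T_0}\int_t^{t+T_0}|c^{T}f(s)|\,ds\ge\vartheta$ for all $t\ge t_0$ and all unit vectors $c\in\mathbb R^m$. The matrix signal $y:[0,\infty)\to\mathbb R^{3\times m}$ is said to be PE if there is $b\in\mathbb R^3$ such that the signal $y(t)^{T}b$ is PE. Theorem. There is a number $k_2^*>0$, depending only on $\delta,C,K$, the pairs $(M_i,N_i)$,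 and the functions $a_{ij}$, $T_i$ and $\sigma$, such that the following holds for all gains $k_1>0$, $k_2\ge k_2^*$, $k>0$, all data as above and every solution of the closed-loop system on $[0,\infty)$ with $q(0)$ a unit quaternion. Let $A_0\in\mathbb R^{r\times n_\mu}$ be arbitrary, $A(t)=e^{Mt}A_0$, $B(t)=E_0A(t)$, and $$y(t)=\big[\,B(t)\quad E\circ A(t)\quad E\circ\big(T(\sigma)\varrho(t)-A(t)\mu\big)\,\big].$$ Then $\lim_{t\to\infty}y(t)\big(\hat R(t)-R(\sigma,\mu)\big)=0$. If moreover $y(t)$ is PE, then $\lim_{t\to\infty}\big(\hat R(t)-R(\sigma,\mu)\big)=0$. -/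

import Mathlib

open Filter Topology Matrix MeasureTheory

noncomputable section

/-! Matrix notions -/

/-- The matrix `w^×` of the cross product with `w ∈ ℝ³`. -/
def crossMat (w : Fin 3 → ℝ) : Matrix (Fin 3) (Fin 3) ℝ :=
  !![0, -w 2, w 1; w 2, 0, -w 0; -w 1, w 0, 0]

/-- Every (complex) eigenvalue has negative real part. -/
def IsHurwitz {m : Type*} [Fintype m] [DecidableEq m] (A : Matrix m m ℝ) : Prop :=
  ∀ z : ℂ, (A.map (algebraMap ℝ ℂ)).charpoly.IsRoot z → z.re < 0

/-- Kalman's condition: `N, M N, …, M^(m-1) N` span `ℝ^m`. -/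
def IsControllable {m : ℕ} (M : Matrix (Fin m) (Fin m) ℝ) (N : Fin m → ℝ) : Prop :=
  Submodule.span ℝ (Set.range fun k : Fin m => (M ^ (k : ℕ)) *ᵥ N) = ⊤

/-! Persistent excitation -/

/-- A vector signal `f : [0, ∞) → ℝ^ι` is persistently exciting. -/
def IsPE {ι : Type*} [Fintype ι] (f : ℝ → ι → ℝ) : Prop :=
  ∃ t₀ T₀ ϑ : ℝ, 0 < t₀ ∧ 0 < T₀ ∧ 0 < ϑ ∧
    ∀ c : ι → ℝ, c ⬝ᵥ c = 1 → ∀ t : ℝ, t₀ ≤ t →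
      ϑ ≤ (1 / T₀) * ∫ s in t..(t + T₀), |c ⬝ᵥ f s|

/-- A matrix signal is persistently exciting if its product with some constant vector is. -/
def IsPEMatrix {ι κ : Type*} [Fintype ι] [Fintype κ] (f : ℝ → Matrix ι κ ℝ) : Prop :=
  ∃ b : κ → ℝ, IsPE fun t => f t *ᵥ b

/-! The disturbance and the system generating it -/

/-- Three-channel multi-tone disturbance: `amp₀ i` is the step magnitude, and `amp i j`, `freq i j`,
`phase i j` are the amplitude, frequency and phase of the `j`-th tone of channel `i`. -/
def disturbance {Nd : Fin 3 → ℕ} (amp₀ : Fin 3 → ℝ) (amp freq phase : ∀ i, Fin (Nd i) → ℝ)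
    (t : ℝ) : Fin 3 → ℝ :=
  fun i => amp₀ i + ∑ j, amp i j * Real.sin (freq i j * t + phase i j)

/-- `P(λ) = λ^m - a₁ - a₂ λ - ⋯ - a_m λ^(m-1)`. -/
def exoPoly {m : ℕ} (a : Fin m → ℝ) : Polynomial ℝ :=
  Polynomial.X ^ m - ∑ k : Fin m, Polynomial.C (a k) * Polynomial.X ^ (k : ℕ)

/-- All complex roots of `P` are distinct and have zero real part. -/
def HasSimpleImaginaryRoots (P : Polynomial ℝ) : Prop :=
  (P.map (algebraMap ℝ ℂ)).roots.Nodup ∧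
    ∀ z : ℂ, (P.map (algebraMap ℝ ℂ)).IsRoot z → z.re = 0

/-- The companion matrix with last row `a`. -/
def exoPhi {m : ℕ} (a : Fin m → ℝ) : Matrix (Fin m) (Fin m) ℝ :=
  Matrix.of fun j k =>
    if (j : ℕ) + 1 = m then a k else if (k : ℕ) = (j : ℕ) + 1 then 1 else 0

/-- The row `[1, 0, …, 0]`. -/
def exoPsi {m : ℕ} : Fin m → ℝ := fun k => if (k : ℕ) = 0 then 1 else 0

/-- Index set of the stacked vectors `col(x₁, x₂, x₃)` with `xᵢ ∈ ℝ^(rᵢ)`. -/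
abbrev Blk (r : Fin 3 → ℕ) : Type := (i : Fin 3) × Fin (r i)

/-- `col(ϱ₁, ϱ₂, ϱ₃)`, where `ϱᵢ` consists of `dᵢ` and its first `rᵢ - 1` derivatives. -/
def exoState {r : Fin 3 → ℕ} (d : ℝ → Fin 3 → ℝ) (t : ℝ) : Blk r → ℝ :=
  fun p => iteratedDeriv (p.2 : ℕ) (fun s => d s p.1) t

/-- `block diag(N₁, N₂, N₃)` for columns `Nᵢ ∈ ℝ^(rᵢ)`. -/
def blockCol {r : Fin 3 → ℕ} (N : ∀ i, Fin (r i) → ℝ) : Matrix (Blk r) (Fin 3) ℝ :=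
  Matrix.of fun p j => if p.1 = j then N p.1 p.2 else 0

/-- `Ψ = block diag(Ψ₁, Ψ₂, Ψ₃)`. -/
def blockPsi {r : Fin 3 → ℕ} : Matrix (Fin 3) (Blk r) ℝ :=
  Matrix.of fun j p => if p.1 = j then exoPsi p.2 else 0

/-! Linear parameterizations -/

/-- The matrix `L(x)` with `J x = L(x) (J₁₁, J₂₂, J₃₃, J₂₃, J₁₃, J₁₂)`. -/
def inertiaL (x : Fin 3 → ℝ) : Matrix (Fin 3) (Fin 6) ℝ :=
  !![x 0, 0, 0, 0, x 2, x 1;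
     0, x 1, 0, x 2, 0, x 0;
     0, 0, x 2, x 1, x 0, 0]

/-- `(J₁₁, J₂₂, J₃₃, J₂₃, J₁₃, J₁₂)`. -/
def inertiaVec (J : Matrix (Fin 3) (Fin 3) ℝ) : Fin 6 → ℝ :=
  ![J 0 0, J 1 1, J 2 2, J 1 2, J 0 2, J 0 1]

/-- `E ∘ X = [E¹ X, …, E^ℓ X]` for `E = [E¹, …, E^ℓ]` and a matrix `X`. -/
def blockMul {p q m : Type*} [Fintype q] {ℓ : ℕ} (E : Fin ℓ → Matrix p q ℝ) (X : Matrix q m ℝ) :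
    Matrix p (Fin ℓ × m) ℝ :=
  Matrix.of fun i ja => (E ja.1 * X) i ja.2

/-- `E ∘ x = [E¹ x, …, E^ℓ x]` for `E = [E¹, …, E^ℓ]` and a vector `x`. -/
def blockMulVec {p q : Type*} [Fintype q] {ℓ : ℕ} (E : Fin ℓ → Matrix p q ℝ) (x : q → ℝ) :
    Matrix p (Fin ℓ) ℝ :=
  Matrix.of fun i j => (E j *ᵥ x) i

/-- Index set of the adaptive parameter `col(μ, Ω ⊗ μ, Ω)`. -/
abbrev ParIdx (nμ ℓ : ℕ) : Type := Fin nμ ⊕ ((Fin ℓ × Fin nμ) ⊕ Fin ℓ)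

/-- `R = col(μ, Ω ⊗ μ, Ω)`. -/
def trueParam {nμ ℓ : ℕ} (μ : Fin nμ → ℝ) (Ω : Fin ℓ → ℝ) : ParIdx nμ ℓ → ℝ :=
  Sum.elim μ (Sum.elim (fun ja => Ω ja.1 * μ ja.2) Ω)

/-- The known matrices used by the controller: the internal model pairs `(Mᵢ, Nᵢ)`, the matrices of
the affine parameterization of the inertia, and the matrices `E₀`, `E¹, …, E^ℓ`. -/
structure DesignData (r : Fin 3 → ℕ) (nμ ℓ : ℕ) where
  M : ∀ i, Matrix (Fin (r i)) (Fin (r i)) ℝ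
  N : ∀ i, Fin (r i) → ℝ
  Lbar₀ : Fin 6 → ℝ
  Lbar₁ : Matrix (Fin 6) (Fin nμ) ℝ
  E₀ : Matrix (Fin 3) (Blk r) ℝ
  E : Fin ℓ → Matrix (Fin 3) (Blk r) ℝ

namespace DesignData

variable {r : Fin 3 → ℕ} {nμ ℓ : ℕ} (D : DesignData r nμ ℓ)

/-- `M = block diag(M₁, M₂, M₃)`. -/
def bM : Matrix (Blk r) (Blk r) ℝ := Matrix.blockDiagonal' D.M

/-- `N = block diag(N₁, N₂, N₃)`. -/
def bN : Matrix (Blk r) (Fin 3) ℝ := blockCol D.N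

def L₀ (x : Fin 3 → ℝ) : Fin 3 → ℝ := inertiaL x *ᵥ D.Lbar₀

def L₁ (x : Fin 3 → ℝ) : Matrix (Fin 3) (Fin nμ) ℝ := inertiaL x * D.Lbar₁

def F₀ (w : Fin 3 → ℝ) : Fin 3 → ℝ := -(crossMat w *ᵥ D.L₀ w)

def F₁ (w : Fin 3 → ℝ) : Matrix (Fin 3) (Fin nμ) ℝ := -(crossMat w * D.L₁ w)

/-- The regressor `ρ(ω, ζ, v) = [ρ₁ ρ₂ ρ₃]`. -/
def rho (w : Fin 3 → ℝ) (ζ : Matrix (Blk r) (Fin nμ) ℝ) (v : Blk r → ℝ) :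
    Matrix (Fin 3) (ParIdx nμ ℓ) ℝ :=
  Matrix.fromCols (D.F₁ w + D.E₀ * (D.bN * D.L₁ w + ζ))
    (Matrix.fromCols (blockMul D.E (ζ + D.bN * D.L₁ w))
      (blockMulVec D.E (D.bN *ᵥ D.L₀ w - v)))

/-- `A(t) = exp(M t) A₀`. -/
def sigA (A₀ : Matrix (Blk r) (Fin nμ) ℝ) (t : ℝ) : Matrix (Blk r) (Fin nμ) ℝ :=
  NormedSpace.exp (t • D.bM) * A₀

/-- `y(t) = [E₀ A(t)   E ∘ A(t)   E ∘ (T ϱ(t) - A(t) μ)]`. -/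
def sigY (A₀ : Matrix (Blk r) (Fin nμ) ℝ) (μ : Fin nμ → ℝ) (T : Matrix (Blk r) (Blk r) ℝ)
    (ϱ : ℝ → Blk r → ℝ) (t : ℝ) : Matrix (Fin 3) (ParIdx nμ ℓ) ℝ :=
  Matrix.fromCols (D.E₀ * D.sigA A₀ t)
    (Matrix.fromCols (blockMul D.E (D.sigA A₀ t))
      (blockMulVec D.E (T *ᵥ ϱ t - D.sigA A₀ t *ᵥ μ)))

end DesignData

/-- The matrices `E₀, E¹, …, E^ℓ` and the functions `Ω₁, …, Ω_ℓ` parameterize without redundancy on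
the parameter set `S`: for each `i`, the constant function `1` and those `Ω_j` for which the `i`-th
row of `E^j` is nonzero are linearly independent functions on `S`. -/
def NonRedundant {P q : Type*} {ℓ : ℕ} (S : Set P) (E : Fin ℓ → Matrix (Fin 3) q ℝ)
    (Ω : P → Fin ℓ → ℝ) : Prop :=
  ∀ (i : Fin 3) (c₀ : ℝ) (c : Fin ℓ → ℝ),
    (∀ j, (∀ p, E j i p = 0) → c j = 0) →
    (∀ s ∈ S, c₀ + ∑ j, c j * Ω s j = 0) → c₀ = 0 ∧ ∀ j, c j = 0

/-! The closed-loop system -/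

/-- The vector part of the quaternion error between `(qv, q4)` and the desired `(qdv, qd4)`. -/
def quatErrVec (qdv : Fin 3 → ℝ) (qd4 : ℝ) (qv : Fin 3 → ℝ) (q4 : ℝ) : Fin 3 → ℝ :=
  qd4 • qv - crossMat qdv *ᵥ qv - q4 • qdv

/-- The signals of the closed-loop system; `ηd` stands for the derivative of `η`. -/
structure Signals (n : ℕ) (r : Fin 3 → ℕ) (nμ ℓ : ℕ) where
  qv : ℝ → Fin 3 → ℝ
  q4 : ℝ → ℝ
  ω : ℝ → Fin 3 → ℝ
  η : ℝ → Fin n → ℝ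
  ηd : ℝ → Fin n → ℝ
  v : ℝ → Blk r → ℝ
  Rhat : ℝ → ParIdx nμ ℓ → ℝ
  ζ : ℝ → Matrix (Blk r) (Fin nμ) ℝ

/-- The control torque
`u = -k₁ q_ev - k₂ ω - ρ R̂ - E₀ N L₀(ω) + δ C δᵀ ω + E₀ v - F₀(ω)`. -/
def torque {n : ℕ} {r : Fin 3 → ℕ} {nμ ℓ : ℕ} (D : DesignData r nμ ℓ)
    (δ : Matrix (Fin 3) (Fin n) ℝ) (C : Matrix (Fin n) (Fin n) ℝ) (k₁ k₂ : ℝ)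
    (qev ω : Fin 3 → ℝ) (v : Blk r → ℝ) (Rhat : ParIdx nμ ℓ → ℝ)
    (ζ : Matrix (Blk r) (Fin nμ) ℝ) : Fin 3 → ℝ :=
  -(k₁ • qev) - k₂ • ω - D.rho ω ζ v *ᵥ Rhat - D.E₀ *ᵥ (D.bN *ᵥ D.L₀ ω)
    + (δ * C * δᵀ) *ᵥ ω + D.E₀ *ᵥ v - D.F₀ ω

/-- `x` is a solution on `[0, ∞)` of the flexible spacecraft system with inertia `J`, coupling `δ`,
damping `C`, stiffness `K` and disturbance `d`, in closed loop with the adaptive control law with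
gains `k₁`, `k₂`, `k` and desired attitude `(qdv, qd4)`, started at a unit quaternion. -/
structure IsClosedLoopSolution {n : ℕ} {r : Fin 3 → ℕ} {nμ ℓ : ℕ} (D : DesignData r nμ ℓ)
    (J : Matrix (Fin 3) (Fin 3) ℝ) (δ : Matrix (Fin 3) (Fin n) ℝ)
    (C K : Matrix (Fin n) (Fin n) ℝ) (d : ℝ → Fin 3 → ℝ) (qdv : Fin 3 → ℝ) (qd4 : ℝ)
    (k₁ k₂ k : ℝ) (x : Signals n r nμ ℓ) : Prop where
  /-- `q(0)` is a unit quaternion. -/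
  unit_init : x.qv 0 ⬝ᵥ x.qv 0 + x.q4 0 ^ 2 = 1
  /-- Attitude kinematics. -/
  qv_deriv : ∀ t, 0 ≤ t → HasDerivWithinAt x.qv
    ((1 / 2 : ℝ) • ((crossMat (x.qv t) + x.q4 t • (1 : Matrix (Fin 3) (Fin 3) ℝ)) *ᵥ x.ω t))
    (Set.Ici 0) t
  q4_deriv : ∀ t, 0 ≤ t → HasDerivWithinAt x.q4
    ((1 / 2 : ℝ) * (-(x.qv t ⬝ᵥ x.ω t))) (Set.Ici 0) t
  /-- Rigid body and modal dynamics, with `ω' = ω_t` and `η'' = η_tt`. -/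
  η_deriv : ∀ t, 0 ≤ t → HasDerivWithinAt x.η (x.ηd t) (Set.Ici 0) t
  dynamics : ∀ t, 0 ≤ t → ∃ (ω_t : Fin 3 → ℝ) (η_tt : Fin n → ℝ),
    HasDerivWithinAt x.ω ω_t (Set.Ici 0) t ∧
    HasDerivWithinAt x.ηd η_tt (Set.Ici 0) t ∧
    J *ᵥ ω_t + crossMat (x.ω t) *ᵥ (J *ᵥ x.ω t) + δ *ᵥ η_tt =
      torque D δ C k₁ k₂ (quatErrVec qdv qd4 (x.qv t) (x.q4 t)) (x.ω t) (x.v t) (x.Rhat t) (x.ζ t)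
        + d t ∧
    η_tt + C *ᵥ x.ηd t + K *ᵥ x.η t = -(δᵀ *ᵥ ω_t)
  /-- Internal model. -/
  v_deriv : ∀ t, 0 ≤ t → HasDerivWithinAt x.v
    (D.bM *ᵥ x.v t
      + D.bN *ᵥ torque D δ C k₁ k₂ (quatErrVec qdv qd4 (x.qv t) (x.q4 t)) (x.ω t) (x.v t)
          (x.Rhat t) (x.ζ t)
      + D.bN *ᵥ D.F₀ (x.ω t) - D.bM *ᵥ (D.bN *ᵥ D.L₀ (x.ω t))) (Set.Ici 0) t
  /-- Adaptation law. -/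
  Rhat_deriv : ∀ t, 0 ≤ t → HasDerivWithinAt x.Rhat
    (k • ((D.rho (x.ω t) (x.ζ t) (x.v t))ᵀ *ᵥ x.ω t)) (Set.Ici 0) t
  /-- Dynamic compensator (entrywise). -/
  ζ_deriv : ∀ t, 0 ≤ t → ∀ (p : Blk r) (a : Fin nμ), HasDerivWithinAt (fun s => x.ζ s p a)
    ((D.bM * x.ζ t + (D.bM * D.bN * D.L₁ (x.ω t) - D.bN * D.F₁ (x.ω t))) p a) (Set.Ici 0) t

end

/-! Quadratic forms -/

section QuadraticForms

variable {m n : Type*} [Fintype m] [Fintype n]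

/-! Put θ = T(σ)ϱ, Γ = ΨT(σ)⁻¹ and e = R̂ - R(σ,μ). The Sylvester equation gives θ' = Mθ + Nd and Γθ
= d. In z = v + θ - N(Jω + δη') - ζμ the torque and the disturbance cancel, which leaves the stable
system z' = M(z + Nδη') (`model_error_dynamics`), and the body equation becomes linear in e
(`body_error_dynamics`). The sum of the kinetic energy, the attitude potential 2k₁(1 - ⟨q_d,q⟩),
|e|²/(2k), a quadratic form in z and a weighted modal energy decreases once k₂ is large, at a rate
controlling ω, z, η and η' + δᵀω (`exists_gain_bound`, `IsClosedLoopSolution.exists_energy`). All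
signals are then bounded, and Barbalat-type arguments give ω, η, η', z, ζ → 0. Hence v + θ → 0, ρ -
y → 0 for every A₀, and, since ω' → 0 as well, k₁q_ev + ρe → 0.

It remains to show q_ev → 0, and this is where non-redundancy enters. Up to vanishing terms, k₁q_ev
equals minus a combination of the signals E^jθ with coefficients from e, and both q_ev and e vary
ever more slowly. If each E^jθ has a bounded antiderivative, averaging over long windows forces q_ev
→ 0 (`tendsto_zero_of_add_deriv`). Now E^jθ = (E^jM⁻¹θ)' - E^jM⁻¹Nd. If r_l is even, 0 is not a root
of the l-th polynomial and d_l has a bounded antiderivative. If r_l is odd, 0 is a root for every s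
∈ S, so ΨT(s)⁻¹ maps the l-th column of M⁻¹N to a vector independent of s; independence of 1 and the
Ω_j then makes E^j kill that column.

So ye → 0. Under persistent excitation, slow variation of e turns this into e → 0
(`IsPE.tendsto_zero`). -/

theorem mulVec_dotProduct_self_le (A : Matrix m n ℝ) :
    ∃ c : ℝ, 0 ≤ c ∧ ∀ y, (A *ᵥ y) ⬝ᵥ (A *ᵥ y) ≤ c * (y ⬝ᵥ y) := by
  refine ⟨∑ i, ∑ j, A i j ^ 2, by positivity, fun y => ?_⟩
  rw [Finset.sum_mul]
  refine Finset.sum_le_sum fun i _ => ?_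
  have h := Finset.sum_mul_sq_le_sq_mul_sq Finset.univ (A i) y
  simp only [dotProduct, mulVec, ← sq] at h ⊢
  exact h

theorem dotProduct_self_nonneg' (x : m → ℝ) : 0 ≤ x ⬝ᵥ x :=
  Finset.sum_nonneg fun i _ => mul_self_nonneg (x i)

theorem sq_le_dotProduct_self (x : m → ℝ) (i : m) : x i ^ 2 ≤ x ⬝ᵥ x := by
  rw [sq]
  exact Finset.single_le_sum (f := fun i => x i * x i) (fun i _ => mul_self_nonneg (x i))
    (Finset.mem_univ i)

theorem abs_dotProduct_le (x y : m → ℝ) {ε : ℝ} (hε : 0 < ε) :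
    |x ⬝ᵥ y| ≤ ε * (x ⬝ᵥ x) + 1 / (4 * ε) * (y ⬝ᵥ y) := by
  simp only [dotProduct, Finset.mul_sum, ← Finset.sum_add_distrib]
  refine (Finset.abs_sum_le_sum_abs _ _).trans (Finset.sum_le_sum fun i _ => ?_)
  have key : ε * (x i * x i) + 1 / (4 * ε) * (y i * y i) - |x i * y i|
      = (1 / ε) * (ε * |x i| - |y i| / 2) ^ 2 := by
    rw [abs_mul, ← abs_mul_abs_self (x i), ← abs_mul_abs_self (y i)]
    field_simp
    ring
  have : 0 ≤ (1 / ε) * (ε * |x i| - |y i| / 2) ^ 2 := by positivity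
  linarith

/-- Young's inequality for a bilinear form. -/
theorem exists_abs_dotProduct_mulVec_le (A : Matrix m n ℝ) {ε : ℝ} (hε : 0 < ε) :
    ∃ c : ℝ, 0 ≤ c ∧ ∀ x y, |x ⬝ᵥ A *ᵥ y| ≤ ε * (x ⬝ᵥ x) + c * (y ⬝ᵥ y) := by
  obtain ⟨c, hc, h⟩ := mulVec_dotProduct_self_le A
  refine ⟨1 / (4 * ε) * c, by positivity, fun x y => ?_⟩
  refine (abs_dotProduct_le x (A *ᵥ y) hε).trans ?_
  have := mul_le_mul_of_nonneg_left (h y) (show 0 ≤ 1 / (4 * ε) by positivity)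
  linarith

theorem dotProduct_mulVec_symm {P : Matrix m m ℝ} (hP : Pᵀ = P) (x y : m → ℝ) :
    x ⬝ᵥ P *ᵥ y = y ⬝ᵥ P *ᵥ x := by
  rw [dotProduct_mulVec, ← mulVec_transpose, hP, dotProduct_comm]

theorem Matrix.PosDef.transpose_eq {m : Type*} {P : Matrix m m ℝ} (hP : P.PosDef) : Pᵀ = P := by
  have := hP.isHermitian
  rwa [Matrix.IsHermitian, conjTranspose_eq_transpose_of_trivial] at this

/-- The constant is the minimum of the form on the compact unit sphere, extended to all vectors by
homogeneity. An empty sphere leaves only the zero vector. -/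
theorem Matrix.PosDef.exists_lower_bound {P : Matrix m m ℝ} (hP : P.PosDef) :
    ∃ p : ℝ, 0 < p ∧ ∀ x, p * (x ⬝ᵥ x) ≤ x ⬝ᵥ P *ᵥ x := by
  have hcont : Continuous fun x : m → ℝ => x ⬝ᵥ P *ᵥ x := by fun_prop
  have hcpt : IsCompact {x : m → ℝ | x ⬝ᵥ x = 1} := by
    refine (isCompact_closedBall (0 : m → ℝ) 1).of_isClosed_subset
      (isClosed_eq (by fun_prop) continuous_const) fun x (hx : x ⬝ᵥ x = 1) => ?_
    rw [mem_closedBall_zero_iff, pi_norm_le_iff_of_nonneg zero_le_one]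
    intro i
    have := sq_le_dotProduct_self x i
    rw [Real.norm_eq_abs]
    exact abs_le_one_iff_mul_self_le_one.2 (by nlinarith)
  rcases Set.eq_empty_or_nonempty {x : m → ℝ | x ⬝ᵥ x = 1} with he | hne
  · refine ⟨1, one_pos, fun x => ?_⟩
    by_cases hx : x = 0
    · simp [hx]
    exfalso
    have hpos : 0 < x ⬝ᵥ x := (dotProduct_self_nonneg' x).lt_of_ne' (by
      simpa [dotProduct_self_eq_zero] using hx)
    have : (Real.sqrt (x ⬝ᵥ x))⁻¹ • x ∈ {x : m → ℝ | x ⬝ᵥ x = 1} := by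
      simp only [Set.mem_ofPred_eq, smul_dotProduct, dotProduct_smul, smul_eq_mul]
      have := Real.mul_self_sqrt hpos.le
      have h2 : Real.sqrt (x ⬝ᵥ x) ≠ 0 := (Real.sqrt_pos.2 hpos).ne'
      field_simp
      nlinarith
    rw [he] at this
    exact this
  · obtain ⟨x₀, hx₀, hmin⟩ := hcpt.exists_isMinOn hne hcont.continuousOn
    have hx₀' : x₀ ≠ 0 := by
      rintro rfl
      simp at hx₀
    refine ⟨x₀ ⬝ᵥ P *ᵥ x₀, by simpa using hP.dotProduct_mulVec_pos hx₀', fun x => ?_⟩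
    by_cases hx : x = 0
    · simp [hx]
    have hpos : 0 < x ⬝ᵥ x := (dotProduct_self_nonneg' x).lt_of_ne' (by
      simpa [dotProduct_self_eq_zero] using hx)
    set s := Real.sqrt (x ⬝ᵥ x) with hs
    have hss : s * s = x ⬝ᵥ x := Real.mul_self_sqrt hpos.le
    have h2 : 0 < s := Real.sqrt_pos.2 hpos
    have hmem : s⁻¹ • x ∈ {x : m → ℝ | x ⬝ᵥ x = 1} := by
      simp only [Set.mem_ofPred_eq, smul_dotProduct, dotProduct_smul, smul_eq_mul, ← hss]
      field_simp
    have := hmin hmem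
    simp only [Set.mem_ofPred_eq, mulVec_smul, smul_dotProduct, dotProduct_smul,
      smul_eq_mul] at this
    rw [← hss]
    calc x₀ ⬝ᵥ P *ᵥ x₀ * (s * s) ≤ s⁻¹ * (s⁻¹ * (x ⬝ᵥ P *ᵥ x)) * (s * s) := by gcongr
      _ = x ⬝ᵥ P *ᵥ x := by field_simp

end QuadraticForms

/-! Lyapunov matrices of Hurwitz matrices -/

section Lyapunov

/-- `P` is symmetric positive definite and `Mᵀ P + P M ≤ -1`. -/
structure IsLyapunov {m : Type*} [Fintype m] (M P : Matrix m m ℝ) : Prop where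
  symm : Pᵀ = P
  lower : ∃ p : ℝ, 0 < p ∧ ∀ x, p * (x ⬝ᵥ x) ≤ x ⬝ᵥ P *ᵥ x
  decay : ∀ x, 2 * (x ⬝ᵥ P *ᵥ (M *ᵥ x)) ≤ -(x ⬝ᵥ x)

/-- By Gelfand's formula the k-th root of ‖b^k‖ is eventually below some q < 1, so the powers are
dominated by q^k. -/
theorem tendsto_pow_of_spectralRadius_lt_one {A : Type*} [NormedRing A] [NormedAlgebra ℂ A]
    [CompleteSpace A] {b : A} (hb : spectralRadius ℂ b < 1) :
    Tendsto (fun k => b ^ k) atTop (𝓝 0) := by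
  obtain ⟨q, hq1, hq2⟩ := ENNReal.lt_iff_exists_nnreal_btwn.1 hb
  have hq : q < 1 := by exact_mod_cast hq2
  have h := (spectrum.pow_nnnorm_pow_one_div_tendsto_nhds_spectralRadius b).eventually_lt_const hq1
  rw [tendsto_zero_iff_norm_tendsto_zero]
  refine squeeze_zero' (Eventually.of_forall fun k => norm_nonneg _) ?_
    (tendsto_pow_atTop_nhds_zero_of_lt_one q.2 hq)
  filter_upwards [h, eventually_gt_atTop 0] with k hk hk0
  have h2 := (ENNReal.rpow_lt_rpow hk (show (0 : ℝ) < k by exact_mod_cast hk0)).le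
  rw [← ENNReal.rpow_mul, one_div_mul_cancel (by positivity), ENNReal.rpow_one,
    ENNReal.rpow_natCast, ← ENNReal.coe_pow] at h2
  exact_mod_cast ENNReal.coe_le_coe.1 h2

variable {m : Type*} [Fintype m] [DecidableEq m]

/-- A short Euler step of x' = Mx is a discrete contraction: |1 + hz|² = 1 + 2h Re z + h²|z|² is
below 1 for small h > 0, and there are only finitely many eigenvalues z. -/
theorem IsHurwitz.exists_tendsto_pow_zero {M : Matrix m m ℝ} (hM : IsHurwitz M) :
    ∃ h : ℝ, 0 < h ∧ Tendsto (fun k => (1 + h • M) ^ k) atTop (𝓝 0) := by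
  let := Matrix.linftyOpNormedRing (n := m) (α := ℂ)
  let := Matrix.linftyOpNormedAlgebra (n := m) (R := ℂ) (α := ℂ)
  rcases isEmpty_or_nonempty m with he | hne
  · exact ⟨1, one_pos, tendsto_const_nhds.congr fun k => Subsingleton.elim _ _⟩
  set Mc := M.map (algebraMap ℝ ℂ) with hMc
  have hfin : (spectrum ℂ Mc).Finite := Matrix.finite_spectrum Mc
  have hev : ∀ᶠ h : ℝ in 𝓝[>] 0, ∀ z ∈ spectrum ℂ Mc, ‖1 + (h : ℂ) * z‖ < 1 := by
    rw [Filter.eventually_all_finite hfin]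
    intro z hz
    have hre : z.re < 0 := hM z (Matrix.mem_spectrum_iff_isRoot_charpoly.1 hz)
    have hlim : Tendsto (fun h : ℝ => h * Complex.normSq z) (𝓝[>] 0) (𝓝 0) := by
      have : Tendsto (fun h : ℝ => h * Complex.normSq z) (𝓝 0) (𝓝 (0 * Complex.normSq z)) :=
        (continuous_id.mul continuous_const).tendsto 0
      rw [zero_mul] at this
      exact this.mono_left nhdsWithin_le_nhds
    filter_upwards [hlim.eventually_lt_const (show 0 < -2 * z.re by linarith),
      self_mem_nhdsWithin] with h h1 h0
    have h0 : 0 < h := h0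
    have : ‖1 + (h : ℂ) * z‖ ^ 2 < 1 := by
      rw [← Complex.normSq_eq_norm_sq, Complex.normSq_apply]
      rw [Complex.normSq_apply] at h1
      simp only [Complex.add_re, Complex.one_re, Complex.mul_re, Complex.ofReal_re,
        Complex.ofReal_im, zero_mul, sub_zero, Complex.add_im, Complex.one_im, Complex.mul_im,
        zero_add, add_zero]
      nlinarith
    nlinarith [norm_nonneg (1 + (h : ℂ) * z)]
  obtain ⟨h, hh, h0⟩ := (hev.and self_mem_nhdsWithin).exists
  refine ⟨h, h0, ?_⟩
  have hspec : spectralRadius ℂ (1 + (h : ℂ) • Mc) < 1 := by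
    have haev : (Polynomial.aeval Mc) (1 + Polynomial.C (h : ℂ) * Polynomial.X)
        = 1 + (h : ℂ) • Mc := by
      simp [Algebra.smul_def]
    have := spectrum.spectralRadius_lt_of_forall_lt (1 + (h : ℂ) • Mc) (r := 1) (by
      intro z hz
      rw [← haev, spectrum.map_polynomial_aeval] at hz
      obtain ⟨w, hw, rfl⟩ := hz
      have := hh w hw
      simpa [← NNReal.coe_lt_coe] using this)
    simpa using this
  have hlim := tendsto_pow_of_spectralRadius_lt_one hspec
  have hmap : ∀ k : ℕ, (1 + (h : ℂ) • Mc) ^ k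
      = (((1 + h • M) ^ k : Matrix m m ℝ)).map (algebraMap ℝ ℂ) := by
    intro k
    have : (1 + (h : ℂ) • Mc) = (algebraMap ℝ ℂ).mapMatrix (1 + h • M) := by
      ext i j
      simp [hMc, Matrix.one_apply, apply_ite]
    rw [this, ← map_pow]
    rfl
  have hre : ∀ k : ℕ, (1 + h • M) ^ k = ((1 + (h : ℂ) • Mc) ^ k).map Complex.re := by
    intro k
    rw [hmap]
    ext i j
    simp
  have hc : Continuous fun X : Matrix m m ℂ => X.map Complex.re :=
    continuous_id.matrix_map Complex.continuous_re
  have := (hc.tendsto 0).comp hlim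
  rw [Matrix.map_zero _ Complex.zero_re] at this
  exact this.congr fun k => (hre k).symm

/-- For B = 1 + hM the finite sum Q of (B^j)ᵀB^j, j < k, is a discrete Lyapunov matrix: the
increment of its form under B telescopes to |B^k x|² - |x|² ≤ -|x|²/2. Expanding B = 1 + hM and
dropping the nonnegative h² term bounds 2h xᵀQMx by that increment, so P = 2hQ has decay exactly 1.
-/
theorem IsHurwitz.exists_isLyapunov {M : Matrix m m ℝ} (hM : IsHurwitz M) :
    ∃ P, IsLyapunov M P := by
  obtain ⟨h, hh, hlim⟩ := hM.exists_tendsto_pow_zero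
  set B := 1 + h • M with hB
  have hsum : Tendsto (fun k => ∑ i, ∑ j, (B ^ k) i j ^ 2) atTop (𝓝 0) := by
    have hc : Continuous fun X : Matrix m m ℝ => ∑ i, ∑ j, X i j ^ 2 := by fun_prop
    have := (hc.tendsto 0).comp hlim
    simpa [Function.comp_def] using this
  obtain ⟨k, hk, hk1⟩ := ((hsum.eventually_lt_const (show (0 : ℝ) < 1 / 2 by norm_num)).and
    (eventually_gt_atTop 0)).exists
  have hcontr : ∀ x, (B ^ k *ᵥ x) ⬝ᵥ (B ^ k *ᵥ x) ≤ 1 / 2 * (x ⬝ᵥ x) := by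
    intro x
    refine le_trans ?_ (mul_le_mul_of_nonneg_right hk.le (dotProduct_self_nonneg' x))
    rw [Finset.sum_mul]
    refine Finset.sum_le_sum fun i _ => ?_
    have h := Finset.sum_mul_sq_le_sq_mul_sq Finset.univ ((B ^ k) i) x
    simp only [dotProduct, mulVec, ← sq] at h ⊢
    exact h
  set Q := ∑ j ∈ Finset.range k, (B ^ j)ᵀ * B ^ j with hQ
  have hform : ∀ x y, x ⬝ᵥ Q *ᵥ y = ∑ j ∈ Finset.range k, (B ^ j *ᵥ x) ⬝ᵥ (B ^ j *ᵥ y) := by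
    intro x y
    rw [hQ, sum_mulVec, dotProduct_sum]
    refine Finset.sum_congr rfl fun j _ => ?_
    rw [← mulVec_mulVec, dotProduct_mulVec, vecMul_transpose]
  refine ⟨(2 * h) • Q, ?_, ⟨2 * h, by positivity, fun x => ?_⟩, fun x => ?_⟩
  · simp [hQ, transpose_sum, transpose_mul]
  · rw [smul_mulVec, dotProduct_smul, smul_eq_mul, hform]
    refine mul_le_mul_of_nonneg_left ?_ (by positivity)
    -- The term j = 0 of the sum is |x|² itself; it is present because k > 0.
    have := Finset.single_le_sum (f := fun j => (B ^ j *ᵥ x) ⬝ᵥ (B ^ j *ᵥ x))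
      (fun j _ => dotProduct_self_nonneg' _) (Finset.mem_range.2 hk1)
    simpa using this
  · rw [smul_mulVec, dotProduct_smul, smul_eq_mul, hform]
    have hstep : ∀ j, 2 * h * ((B ^ j *ᵥ x) ⬝ᵥ (B ^ j *ᵥ (M *ᵥ x)))
        ≤ (B ^ (j + 1) *ᵥ x) ⬝ᵥ (B ^ (j + 1) *ᵥ x) - (B ^ j *ᵥ x) ⬝ᵥ (B ^ j *ᵥ x) := by
      intro j
      have : B ^ (j + 1) *ᵥ x = B ^ j *ᵥ x + h • (B ^ j *ᵥ (M *ᵥ x)) := by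
        rw [pow_succ, hB, ← hB, ← mulVec_mulVec]
        conv_lhs => rw [hB]
        rw [add_mulVec, one_mulVec, smul_mulVec, mulVec_add, mulVec_smul]
      rw [this]
      simp only [add_dotProduct, dotProduct_add, smul_dotProduct, dotProduct_smul, smul_eq_mul]
      rw [dotProduct_comm (B ^ j *ᵥ (M *ᵥ x)) (B ^ j *ᵥ x)]
      have := dotProduct_self_nonneg' (B ^ j *ᵥ (M *ᵥ x))
      nlinarith [mul_nonneg (mul_nonneg hh.le hh.le) this]
    have htel := Finset.sum_le_sum fun j (_ : j ∈ Finset.range k) => hstep j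
    rw [← Finset.mul_sum, Finset.sum_range_sub
      (fun j => (B ^ j *ᵥ x) ⬝ᵥ (B ^ j *ᵥ x))] at htel
    simp only [pow_zero, one_mulVec] at htel
    linarith [hcontr x]

theorem blockDiagonal'_mulVec_apply {o : Type*} [Fintype o] [DecidableEq o] {k l : o → Type*}
    [∀ i, Fintype (l i)] (A : ∀ i, Matrix (k i) (l i) ℝ) (x : ((i : o) × l i) → ℝ)
    (i : o) (j : k i) :
    (blockDiagonal' A *ᵥ x) ⟨i, j⟩ = (A i *ᵥ fun p => x ⟨i, p⟩) j := by
  simp only [mulVec, dotProduct, Fintype.sum_sigma]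
  rw [Finset.sum_eq_single i]
  · simp [blockDiagonal'_apply_eq]
  · intro b _ hb
    exact Finset.sum_eq_zero fun p _ => by rw [blockDiagonal'_apply_ne _ _ _ hb.symm, zero_mul]
  · simp

theorem IsLyapunov.blockDiagonal' {o : Type*} [Fintype o] [DecidableEq o] {k : o → Type*}
    [∀ i, Fintype (k i)] {M P : ∀ i, Matrix (k i) (k i) ℝ} (h : ∀ i, IsLyapunov (M i) (P i)) :
    IsLyapunov (blockDiagonal' M) (blockDiagonal' P) := by
  have hdot : ∀ x y : ((i : o) × k i) → ℝ,
      x ⬝ᵥ y = ∑ i, (fun p => x ⟨i, p⟩) ⬝ᵥ (fun p => y ⟨i, p⟩) := by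
    intro x y
    simp [dotProduct, Fintype.sum_sigma]
  choose p hp hpl using fun i => (h i).lower
  refine ⟨?_, ?_, fun x => ?_⟩
  · rw [blockDiagonal'_transpose]
    simp only [(h _).symm]
  · obtain ⟨c, hc, hcl⟩ : ∃ c : ℝ, 0 < c ∧ ∀ i, c ≤ p i := by
      rcases isEmpty_or_nonempty o with he | hne
      · exact ⟨1, one_pos, fun i => he.elim i⟩
      · obtain ⟨i₀, hi₀⟩ := Finite.exists_min p
        exact ⟨p i₀, hp i₀, hi₀⟩
    refine ⟨c, hc, fun x => ?_⟩
    rw [hdot, hdot, Finset.mul_sum]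
    refine Finset.sum_le_sum fun i _ => ?_
    simp only [blockDiagonal'_mulVec_apply]
    exact (mul_le_mul_of_nonneg_right (hcl i) (dotProduct_self_nonneg' _)).trans (hpl i _)
  · rw [hdot, hdot, Finset.mul_sum, ← Finset.sum_neg_distrib]
    refine Finset.sum_le_sum fun i _ => ?_
    simp only [blockDiagonal'_mulVec_apply]
    exact (h i).decay _

theorem IsLyapunov.det_ne_zero {M P : Matrix m m ℝ} (h : IsLyapunov M P) : M.det ≠ 0 := by
  intro h0
  obtain ⟨x, hx, hx0⟩ := exists_mulVec_eq_zero_iff.2 h0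
  have := h.decay x
  rw [hx0] at this
  have h1 := dotProduct_self_nonneg' x
  have : x ⬝ᵥ x = 0 := by
    simp at this
    linarith
  exact hx (dotProduct_self_eq_zero.1 this)

end Lyapunov

/-! Real polynomials with simple imaginary roots -/

section ExoPoly

theorem Polynomial.exists_isRoot_of_odd_natDegree {P : Polynomial ℝ} (hP : P.Monic)
    (hodd : Odd P.natDegree) : ∃ x : ℝ, P.IsRoot x := by
  have hdeg : 0 < P.degree := Polynomial.natDegree_pos_iff_degree_pos.1 hodd.pos
  have h1 : Tendsto (fun x => P.eval x) atTop atTop :=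
    P.tendsto_atTop_of_leadingCoeff_nonneg hdeg (by rw [hP.leadingCoeff]; exact zero_le_one)
  have hlc : (P.comp (-Polynomial.X)).leadingCoeff = -1 := by
    rw [Polynomial.leadingCoeff_comp (by simp), hP.leadingCoeff]
    simp [hodd.neg_one_pow]
  have hnd : (P.comp (-Polynomial.X)).natDegree = P.natDegree := by
    simp [Polynomial.natDegree_comp]
  have h2 : Tendsto (fun x => (P.comp (-Polynomial.X)).eval x) atTop atBot := by
    refine Polynomial.tendsto_atBot_of_leadingCoeff_nonpos _ ?_ (by rw [hlc]; norm_num)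
    exact Polynomial.natDegree_pos_iff_degree_pos.1 (by rw [hnd]; exact hodd.pos)
  obtain ⟨b, hb⟩ := (h1.eventually_ge_atTop 0).exists
  obtain ⟨c, hc⟩ := (h2.eventually_le_atBot 0).exists
  have hc' : P.eval (-c) ≤ 0 := by simpa using hc
  obtain ⟨x, hx⟩ := mem_range_of_exists_le_of_exists_ge P.continuous ⟨_, hc'⟩ ⟨_, hb⟩
  exact ⟨x, hx⟩

variable {m : ℕ} (a : Fin m → ℝ)

theorem degree_exoPoly_sum_lt :
    (∑ k : Fin m, Polynomial.C (a k) * Polynomial.X ^ (k : ℕ)).degree < (m : WithBot ℕ) := by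
  refine (Polynomial.degree_sum_le _ _).trans_lt ?_
  refine (Finset.sup_lt_iff (WithBot.bot_lt_coe m)).2 fun k _ => ?_
  exact (Polynomial.degree_C_mul_X_pow_le _ _).trans_lt (WithBot.coe_lt_coe.2 k.2)

theorem exoPoly_monic : (exoPoly a).Monic :=
  Polynomial.monic_X_pow_sub (degree_exoPoly_sum_lt a)

theorem exoPoly_natDegree : (exoPoly a).natDegree = m := by
  rw [exoPoly]
  refine Polynomial.natDegree_eq_of_degree_eq_some ?_
  rw [Polynomial.degree_sub_eq_left_of_degree_lt] <;> rw [Polynomial.degree_X_pow]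
  exact degree_exoPoly_sum_lt a

theorem exoPoly_coeff_zero (hm : 0 < m) : (exoPoly a).coeff 0 = -a ⟨0, hm⟩ := by
  rw [Polynomial.coeff_zero_eq_eval_zero, exoPoly, Polynomial.eval_sub, Polynomial.eval_finsetSum,
    Finset.sum_eq_single ⟨0, hm⟩]
  · simp [hm.ne']
  · intro b _ hb
    have : (b : ℕ) ≠ 0 := fun h => hb (Fin.ext h)
    simp [this]
  · simp

/-- A monic factor of odd degree has a real root, and the imaginary axis contains only one real
number. -/
theorem HasSimpleImaginaryRoots.eval_zero_of_odd {P : Polynomial ℝ}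
    (hP : HasSimpleImaginaryRoots P) {Q : Polynomial ℝ} (hQ : Q.Monic) (hQP : Q ∣ P)
    (hodd : Odd Q.natDegree) : Q.coeff 0 = 0 := by
  obtain ⟨x, hx⟩ := Polynomial.exists_isRoot_of_odd_natDegree hQ hodd
  have h1 : (P.map (algebraMap ℝ ℂ)).IsRoot (x : ℂ) := (hx.dvd hQP).map
  have h2 : x = 0 := by simpa using hP.2 _ h1
  subst h2
  rw [Polynomial.coeff_zero_eq_eval_zero]
  exact hx

variable {a}

/-- Together with the even case, this shows that the parity of the degree alone decides whether 0 is
a root. Since `r i` does not depend on the frequencies, the answer is the same for every s ∈ S. -/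
theorem HasSimpleImaginaryRoots.coeff_eq_zero_of_odd (h : HasSimpleImaginaryRoots (exoPoly a))
    (hm : Odd m) : a ⟨0, hm.pos⟩ = 0 := by
  have := h.eval_zero_of_odd (exoPoly_monic a) dvd_rfl (by rwa [exoPoly_natDegree])
  rw [exoPoly_coeff_zero a hm.pos] at this
  linarith

/-- If 0 were a root, the cofactor of X would have odd degree and hence vanish at 0 too, giving a
double root. -/
theorem HasSimpleImaginaryRoots.coeff_ne_zero_of_even (h : HasSimpleImaginaryRoots (exoPoly a))
    (hm : Even m) (hm0 : 0 < m) : a ⟨0, hm0⟩ ≠ 0 := by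
  intro h0
  obtain ⟨Q, hQ⟩ := Polynomial.X_dvd_iff.2 (by rw [exoPoly_coeff_zero a hm0, h0, neg_zero])
  have hmon : Q.Monic := Polynomial.monic_X.of_mul_monic_left (hQ ▸ exoPoly_monic a)
  have hdeg : Q.natDegree + 1 = m := by
    have := exoPoly_natDegree a
    rw [hQ, Polynomial.natDegree_X_mul hmon.ne_zero] at this
    exact this
  have hodd : Odd Q.natDegree := by
    rw [← hdeg] at hm
    exact Nat.not_even_iff_odd.1 fun h => (Nat.even_add_one.1 hm) h
  obtain ⟨R, hR⟩ := Polynomial.X_dvd_iff.2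
    (h.eval_zero_of_odd hmon (hQ ▸ dvd_mul_left Q Polynomial.X) hodd)
  have hR0 : R ≠ 0 := by
    rintro rfl
    exact hmon.ne_zero (by simpa using hR)
  have hroots := h.1
  have hRm : R.map (algebraMap ℝ ℂ) ≠ 0 :=
    (Polynomial.map_ne_zero_iff (algebraMap ℝ ℂ).injective).2 hR0
  rw [hQ, hR, Polynomial.map_mul, Polynomial.map_mul, Polynomial.map_X, Polynomial.roots_mul
    (mul_ne_zero Polynomial.X_ne_zero (mul_ne_zero Polynomial.X_ne_zero hRm)),
    Polynomial.roots_mul (mul_ne_zero Polynomial.X_ne_zero hRm), Polynomial.roots_X] at hroots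
  simp at hroots

end ExoPoly

/-! The Sylvester equation -/

section Sylvester

/-- Cayley–Hamilton: every power of M is a combination of the first m powers. -/
theorem dotProduct_pow_mulVec_eq_zero {m : ℕ} {M : Matrix (Fin m) (Fin m) ℝ} {w t : Fin m → ℝ}
    (h : ∀ i < m, w ⬝ᵥ (M ^ i) *ᵥ t = 0) (i : ℕ) : w ⬝ᵥ (M ^ i) *ᵥ t = 0 := by
  rcases Nat.eq_zero_or_pos m with rfl | hm
  · simp [dotProduct]
  rw [Matrix.pow_eq_aeval_mod_charpoly, Polynomial.aeval_eq_sum_range' (n := m)]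
  · rw [sum_mulVec, dotProduct_sum]
    refine Finset.sum_eq_zero fun j hj => ?_
    rw [smul_mulVec, dotProduct_smul, h j (Finset.mem_range.1 hj), smul_zero]
  · have hne : M.charpoly ≠ 1 := by
      intro h1
      have := M.charpoly_natDegree_eq_dim
      rw [h1, Polynomial.natDegree_one, Fintype.card_fin] at this
      omega
    have := Polynomial.natDegree_modByMonic_lt (Polynomial.X ^ i) M.charpoly_monic hne
    rwa [M.charpoly_natDegree_eq_dim, Fintype.card_fin] at this

theorem exoPhi_mulVec_single_zero {m : ℕ} (a : Fin (m + 1) → ℝ) :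
    exoPhi a *ᵥ Pi.single 0 1 = a 0 • Pi.single (Fin.last m) (1 : ℝ) := by
  ext j
  rw [mulVec_single_one]
  rcases Fin.eq_castSucc_or_eq_last j with ⟨j, rfl⟩ | rfl
  · have := j.2.ne
    simp [exoPhi, this, (Fin.castSucc_lt_last j).ne]
  · simp [exoPhi]

theorem exoPhi_mulVec_single_succ {m : ℕ} (a : Fin (m + 1) → ℝ) (k : Fin m) :
    exoPhi a *ᵥ Pi.single k.succ 1
      = Pi.single k.castSucc 1 + a k.succ • Pi.single (Fin.last m) (1 : ℝ) := by
  ext j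
  rw [mulVec_single_one]
  rcases Fin.eq_castSucc_or_eq_last j with ⟨j, rfl⟩ | rfl
  · have := j.2.ne
    simp [exoPhi, this, (Fin.castSucc_lt_last j).ne, Pi.single_apply, Fin.ext_iff,
      eq_comm (a := (j : ℕ)) (b := k)]
  · simp [exoPhi, (Fin.castSucc_lt_last k).ne']

/-- Suppose a row w annihilates T. Read on the columns t_k of T, the equation says M t_{k+1} = t_k +
a_{k+1} t_last and N = a_0 t_last - M t_0. So w annihilates all M^i t_last, then by descent all M^i
t_k, then all M^i N, and controllability gives w = 0. -/
theorem det_ne_zero_of_sylvester {m : ℕ} {M T : Matrix (Fin m) (Fin m) ℝ} {N a : Fin m → ℝ}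
    (hMN : IsControllable M N) (hT : T * exoPhi a - M * T = vecMulVec N exoPsi) : T.det ≠ 0 := by
  intro hdet
  obtain ⟨w, hw, hwT⟩ := exists_vecMul_eq_zero_iff.2 hdet
  apply hw
  rcases m with - | m
  · exact Subsingleton.elim _ _
  have hmul : ∀ e, M *ᵥ (T *ᵥ e) = T *ᵥ (exoPhi a *ᵥ e) - (exoPsi ⬝ᵥ e) • N := by
    intro e
    have := congrArg (· *ᵥ e) hT
    simp only [sub_mulVec, ← mulVec_mulVec, vecMulVec_mulVec] at this
    rw [← op_smul_eq_smul, ← this]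
    abel
  set t : Fin (m + 1) → Fin (m + 1) → ℝ := fun k => T *ᵥ Pi.single k 1 with ht
  have h0 : N = a 0 • t (Fin.last m) - M *ᵥ t 0 := by
    rw [ht]
    simp only [hmul, exoPhi_mulVec_single_zero, mulVec_smul]
    simp [exoPsi]
  have hsucc : ∀ k : Fin m, M *ᵥ t k.succ = t k.castSucc + a k.succ • t (Fin.last m) := by
    intro k
    rw [ht]
    simp only [hmul, exoPhi_mulVec_single_succ, mulVec_smul, mulVec_add]
    simp [exoPsi]
  have hwt : ∀ k, w ⬝ᵥ t k = 0 := fun k => by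
    rw [ht, dotProduct_mulVec, hwT, zero_dotProduct]
  clear_value t
  -- Each application of M lowers the column index by one, modulo the last column, so column k
  -- survives k applications. For the last column this covers the m + 1 powers that Cayley–Hamilton
  -- needs.
  have hlow : ∀ i : ℕ, ∀ k : Fin (m + 1), i ≤ k → w ⬝ᵥ (M ^ i) *ᵥ t k = 0 := by
    intro i
    induction i with
    | zero => intro k _; simpa using hwt k
    | succ i ih =>
      intro k hk
      obtain ⟨k, rfl⟩ := Fin.exists_succ_eq.2 (show k ≠ 0 by rintro rfl; simp at hk)
      rw [pow_succ, ← mulVec_mulVec, hsucc, mulVec_add, mulVec_smul, dotProduct_add,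
        dotProduct_smul, ih _ (by simpa using hk), ih _ (by
          have := k.2
          simp only [Fin.val_succ, Fin.val_last] at hk ⊢
          omega)]
      simp
  have hlast : ∀ i, w ⬝ᵥ (M ^ i) *ᵥ t (Fin.last m) = 0 :=
    dotProduct_pow_mulVec_eq_zero fun i hi => hlow i _ (by simpa using Nat.lt_succ_iff.1 hi)
  have hall : ∀ k : Fin (m + 1), ∀ i, w ⬝ᵥ (M ^ i) *ᵥ t k = 0 := by
    intro k
    induction k using Fin.reverseInduction with
    | last => exact hlast
    | cast k ih =>
      intro i
      have h1 : t k.castSucc = M *ᵥ t k.succ - a k.succ • t (Fin.last m) := by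
        rw [hsucc]; abel
      rw [h1, mulVec_sub, mulVec_smul, mulVec_mulVec, ← pow_succ, dotProduct_sub, dotProduct_smul,
        ih, hlast]
      simp
  have hN : ∀ i, w ⬝ᵥ (M ^ i) *ᵥ N = 0 := by
    intro i
    rw [h0, mulVec_sub, mulVec_smul, mulVec_mulVec, ← pow_succ, dotProduct_sub, dotProduct_smul,
      hall, hall]
    simp
  have hww : ∀ x ∈ Submodule.span ℝ (Set.range fun k : Fin (m + 1) => (M ^ (k : ℕ)) *ᵥ N),
      w ⬝ᵥ x = 0 := by
    intro x hx
    induction hx using Submodule.span_induction with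
    | mem x hx => obtain ⟨k, rfl⟩ := hx; exact hN k
    | zero => simp
    | add x y _ _ hx hy => rw [dotProduct_add, hx, hy, add_zero]
    | smul c x _ hx => rw [dotProduct_smul, hx, smul_zero]
  have := hww w (by rw [show Submodule.span ℝ _ = ⊤ from hMN]; trivial)
  exact dotProduct_self_eq_zero.1 this

end Sylvester

/-! Differential inequalities on `[0, ∞)` -/

section HalfLine

theorem hasDerivWithinAt_Icc {f f' : ℝ → ℝ}
    (hf : ∀ t, 0 ≤ t → HasDerivWithinAt f (f' t) (Set.Ici 0) t) {a b : ℝ} (ha : 0 ≤ a) :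
    ∀ s ∈ Set.Icc a b, HasDerivWithinAt f (f' s) (Set.Icc a b) s := fun s hs =>
  (hf s (ha.trans hs.1)).mono fun _ hx => ha.trans hx.1

/-- Mean value estimate against a line of slope c. With c = 0 it bounds the drift of f over a
window; with c a frozen value of the derivative it compares an increment with that value. -/
theorem abs_sub_sub_le {f f' : ℝ → ℝ}
    (hf : ∀ t, 0 ≤ t → HasDerivWithinAt f (f' t) (Set.Ici 0) t) {t h c C : ℝ} (ht : 0 ≤ t)
    (hh : 0 ≤ h) (hC : ∀ s ∈ Set.Icc t (t + h), |f' s - c| ≤ C) :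
    |f (t + h) - f t - c * h| ≤ C * h := by
  have hd : ∀ s ∈ Set.Icc t (t + h),
      HasDerivWithinAt (fun s => f s - c * s) (f' s - c) (Set.Icc t (t + h)) s := by
    intro s hs
    simpa using (hasDerivWithinAt_Icc hf ht s hs).fun_sub
      ((hasDerivWithinAt_id s _).const_mul c)
  have := Convex.norm_image_sub_le_of_norm_hasDerivWithin_le hd hC (convex_Icc t (t + h))
    (Set.left_mem_Icc.2 (by linarith)) (Set.right_mem_Icc.2 (by linarith))
  rw [add_sub_cancel_left, Real.norm_eq_abs, Real.norm_eq_abs, abs_of_nonneg hh] at this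
  convert this using 2
  ring

theorem sub_le_mul_of_deriv_le {f f' : ℝ → ℝ}
    (hf : ∀ t, 0 ≤ t → HasDerivWithinAt f (f' t) (Set.Ici 0) t) {t h C : ℝ} (ht : 0 ≤ t)
    (hh : 0 ≤ h) (hC : ∀ s ∈ Set.Icc t (t + h), f' s ≤ C) :
    f (t + h) - f t ≤ C * h := by
  have := image_le_of_deriv_right_le_deriv_boundary (f := f) (f' := f') (a := t) (b := t + h)
    (fun s hs => (hasDerivWithinAt_Icc hf ht s hs).continuousWithinAt)
    (fun s hs => (hf s (ht.trans hs.1)).mono fun _ hx => (ht.trans hs.1).trans hx)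
    (B := fun s => f t + C * (s - t)) (B' := fun _ => C) (by simp) (by fun_prop)
    (fun s _ => by
      simpa using (((hasDerivWithinAt_id s (Set.Ici s)).sub_const t).const_mul C).const_add (f t))
    (fun s hs => hC s (Set.Ico_subset_Icc_self hs))
    (Set.right_mem_Icc.2 (by linarith : t ≤ t + h))
  simp only [add_sub_cancel_left] at this
  linarith

theorem antitoneOn_of_deriv_le {f f' : ℝ → ℝ}
    (hf : ∀ t, 0 ≤ t → HasDerivWithinAt f (f' t) (Set.Ici 0) t)
    (hf' : ∀ t, 0 ≤ t → f' t ≤ 0) : AntitoneOn f (Set.Ici 0) := by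
  intro s hs t _ hst
  have := sub_le_mul_of_deriv_le hf (h := t - s) (C := 0) hs (by linarith)
    (fun x hx => hf' x (le_trans hs hx.1))
  rw [add_sub_cancel] at this
  linarith

/-- The algebra of functions which are bounded on `[0, ∞)`. -/
def boundedFns : Subalgebra ℝ (ℝ → ℝ) where
  carrier := {f | ∃ B, ∀ t, 0 ≤ t → |f t| ≤ B}
  mul_mem' := by
    rintro f g ⟨B, hB⟩ ⟨C, hC⟩
    exact ⟨B * C, fun t ht => by
      rw [Pi.mul_apply, abs_mul]
      exact mul_le_mul (hB t ht) (hC t ht) (abs_nonneg _) ((abs_nonneg _).trans (hB t ht))⟩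
  add_mem' := by
    rintro f g ⟨B, hB⟩ ⟨C, hC⟩
    exact ⟨B + C, fun t ht => (abs_add_le _ _).trans (add_le_add (hB t ht) (hC t ht))⟩
  algebraMap_mem' c := ⟨|c|, fun _ _ => le_rfl⟩

/-- The algebra of functions on `[0, ∞)` which are bounded and have a bounded derivative. -/
def boundedC1Fns : Subalgebra ℝ (ℝ → ℝ) where
  carrier := {f | f ∈ boundedFns ∧ ∃ f' ∈ boundedFns,
    ∀ t, 0 ≤ t → HasDerivWithinAt f (f' t) (Set.Ici 0) t}
  mul_mem' := by
    rintro f g ⟨hf, f', hf', hff⟩ ⟨hg, g', hg', hgg⟩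
    exact ⟨mul_mem hf hg, f' * g + f * g', add_mem (mul_mem hf' hg) (mul_mem hf hg'),
      fun t ht => (hff t ht).mul (hgg t ht)⟩
  add_mem' := by
    rintro f g ⟨hf, f', hf', hff⟩ ⟨hg, g', hg', hgg⟩
    exact ⟨add_mem hf hg, f' + g', add_mem hf' hg', fun t ht => (hff t ht).add (hgg t ht)⟩
  algebraMap_mem' c := ⟨algebraMap_mem _ c, 0, zero_mem _, fun t _ => hasDerivWithinAt_const _ _ _⟩

/-- A nonnegative function dominated by the decay rate of a Lyapunov function tends to zero if its
derivative is bounded. -/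
theorem tendsto_zero_of_deriv_le_neg {V V' g : ℝ → ℝ}
    (hV : ∀ t, 0 ≤ t → HasDerivWithinAt V (V' t) (Set.Ici 0) t) (hV0 : ∀ t, 0 ≤ t → 0 ≤ V t)
    (hVg : ∀ t, 0 ≤ t → V' t ≤ -g t) (hg0 : ∀ t, 0 ≤ t → 0 ≤ g t) (hg : g ∈ boundedC1Fns) :
    Tendsto g atTop (𝓝 0) := by
  obtain ⟨-, g', ⟨L, hL⟩, hg'⟩ := hg
  have hL0 : 0 ≤ L := (abs_nonneg _).trans (hL 0 le_rfl)
  have hanti := antitoneOn_of_deriv_le hV fun t ht => (hVg t ht).trans (by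
    have := hg0 t ht; linarith)
  obtain ⟨l, hl⟩ : ∃ l, Tendsto V atTop (𝓝 l) := by
    -- V is controlled on the half-line only; freezing it at V 0 for negative times makes it
    -- antitone on ℝ.
    have hW : Antitone fun t => V (max t 0) := fun s t hst =>
      hanti (Set.mem_Ici.2 (le_max_right _ _)) (Set.mem_Ici.2 (le_max_right _ _))
        (max_le_max_right 0 hst)
    refine ⟨_, (tendsto_atTop_ciInf hW ⟨0, ?_⟩).congr' ?_⟩
    · rintro _ ⟨t, rfl⟩
      exact hV0 _ (le_max_right _ _)
    · filter_upwards [eventually_ge_atTop 0] with t ht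
      rw [max_eq_left ht]
  rw [Metric.tendsto_atTop']
  intro ε hε
  -- As |g'| ≤ L, a value g t ≥ ε keeps g above ε/2 for time h, costing V at least (ε/2)h;
  -- convergence of V excludes this for large t. L + 1 avoids division by zero.
  set h := ε / (2 * (L + 1)) with hh
  have hh0 : 0 < h := by positivity
  have hdiff : Tendsto (fun t => V t - V (t + h)) atTop (𝓝 0) := by
    simpa using hl.sub (hl.comp (tendsto_atTop_add_const_right atTop h tendsto_id))
  have hev := (hdiff.eventually_lt_const (show 0 < ε / 2 * h by positivity)).and
    (eventually_ge_atTop 0)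
  obtain ⟨t₀, ht₀⟩ := eventually_atTop.1 hev
  refine ⟨t₀, fun t ht => ?_⟩
  obtain ⟨h1, ht0⟩ := ht₀ t ht.le
  rw [Real.dist_eq, sub_zero, abs_of_nonneg (hg0 t ht0)]
  by_contra! hge
  have hlow : ∀ s ∈ Set.Icc t (t + h), V' s ≤ -(ε / 2) := by
    intro s hs
    have hs0 : 0 ≤ s := ht0.trans hs.1
    have h2 := abs_sub_sub_le hg' (c := 0) (C := L) (h := s - t) ht0 (by linarith [hs.1])
      (fun x hx => by simpa using hL x (ht0.trans hx.1))
    rw [add_sub_cancel, zero_mul, sub_zero] at h2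
    have h3 : L * (s - t) ≤ (L + 1) * h :=
      mul_le_mul (by linarith) (by linarith [hs.2]) (by linarith [hs.1]) (by linarith)
    have h4 : (L + 1) * h = ε / 2 := by rw [hh]; field_simp
    have h5 := (abs_le.1 h2).1
    linarith [hVg s hs0]
  have := sub_le_mul_of_deriv_le hV ht0 hh0.le hlow
  linarith

/-- Barbalat's lemma: over a short window h the increment of f is f'(t)h up to Lh², while increments
of a convergent function vanish. -/
theorem deriv_tendsto_zero {f f' : ℝ → ℝ}
    (hf : ∀ t, 0 ≤ t → HasDerivWithinAt f (f' t) (Set.Ici 0) t) (hf0 : Tendsto f atTop (𝓝 0))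
    (hf' : f' ∈ boundedC1Fns) : Tendsto f' atTop (𝓝 0) := by
  obtain ⟨-, f'', ⟨L, hL⟩, hf''⟩ := hf'
  have hL0 : 0 ≤ L := (abs_nonneg _).trans (hL 0 le_rfl)
  rw [Metric.tendsto_atTop']
  intro ε hε
  set h := ε / (4 * (L + 1)) with hh
  have hh0 : 0 < h := by positivity
  have hdiff : Tendsto (fun t => f (t + h) - f t) atTop (𝓝 0) := by
    simpa using (hf0.comp (tendsto_atTop_add_const_right atTop h tendsto_id)).sub hf0
  obtain ⟨t₀, ht₀⟩ := eventually_atTop.1 (((Metric.tendsto_nhds.1 hdiff) (ε / 2 * h)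
    (by positivity)).and (eventually_ge_atTop 0))
  refine ⟨t₀, fun t ht => ?_⟩
  obtain ⟨h1, ht0⟩ := ht₀ t ht.le
  rw [Real.dist_eq, sub_zero] at h1 ⊢
  have h2 := abs_sub_sub_le hf (c := f' t) (C := L * h) ht0 hh0.le (fun s hs => by
    have h3 := abs_sub_sub_le hf'' (c := 0) (C := L) (h := s - t) ht0 (by linarith [hs.1])
      (fun x hx => by simpa using hL x (ht0.trans hx.1))
    rw [add_sub_cancel, zero_mul, sub_zero] at h3
    exact h3.trans (mul_le_mul_of_nonneg_left (by linarith [hs.2]) hL0))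
  have h4 : |f' t * h| < (ε / 2 + L * h) * h := by
    have : f' t * h = (f (t + h) - f t) - (f (t + h) - f t - f' t * h) := by ring
    rw [this]
    refine (abs_sub _ _).trans_lt ?_
    linarith
  rw [abs_mul, abs_of_pos hh0] at h4
  have h5 := lt_of_mul_lt_mul_right h4 hh0.le
  have h6 : L * h ≤ ε / 4 := by
    have : (L + 1) * h = ε / 4 := by rw [hh]; field_simp
    linarith
  linarith

/-- A function whose derivative tends to zero is asymptotically constant on windows of fixed
length. -/
theorem eventually_abs_sub_le {f f' : ℝ → ℝ}
    (hf : ∀ t, 0 ≤ t → HasDerivWithinAt f (f' t) (Set.Ici 0) t) (hf' : Tendsto f' atTop (𝓝 0))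
    (τ : ℝ) {ε : ℝ} (hε : 0 < ε) :
    ∀ᶠ t in atTop, ∀ s ∈ Set.Icc t (t + τ), |f s - f t| ≤ ε := by
  have hpos : 0 < ε / (|τ| + 1) := by positivity
  obtain ⟨t₀, ht₀⟩ := eventually_atTop.1 ((Metric.tendsto_nhds.1 hf') _ hpos)
  filter_upwards [eventually_ge_atTop t₀, eventually_ge_atTop 0] with t h1 h2 s hs
  have h3 := abs_sub_sub_le hf (c := 0) (C := ε / (|τ| + 1)) (h := s - t) h2 (by linarith [hs.1])
    (fun x hx => by simpa [Real.dist_eq] using (ht₀ x (h1.trans hx.1)).le)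
  rw [add_sub_cancel, zero_mul, sub_zero] at h3
  refine h3.trans ?_
  have h4 : s - t ≤ |τ| + 1 := by linarith [hs.2, le_abs_self τ]
  calc ε / (|τ| + 1) * (s - t) ≤ ε / (|τ| + 1) * (|τ| + 1) :=
        mul_le_mul_of_nonneg_left h4 hpos.le
    _ = ε := by field_simp

/-- If `p` varies slowly and differs from the derivative of a bounded function by a function
tending to zero, then `p` tends to zero. -/
theorem tendsto_zero_of_add_deriv {p p' Z Z' : ℝ → ℝ}
    (hp : ∀ t, 0 ≤ t → HasDerivWithinAt p (p' t) (Set.Ici 0) t) (hp' : Tendsto p' atTop (𝓝 0))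
    (hZ : ∀ t, 0 ≤ t → HasDerivWithinAt Z (Z' t) (Set.Ici 0) t) (hZb : Z ∈ boundedFns)
    (h : Tendsto (fun t => p t + Z' t) atTop (𝓝 0)) : Tendsto p atTop (𝓝 0) := by
  obtain ⟨B, hB⟩ := hZb
  have hB0 : 0 ≤ B := (abs_nonneg _).trans (hB 0 le_rfl)
  rw [Metric.tendsto_nhds]
  intro ε hε
  -- The window is long enough that the total variation 2B available to Z, spread over τ,
  -- contributes less than ε/4.
  set τ := (8 * B + 1) / ε with hτ
  have hτ0 : 0 < τ := by positivity
  have h8 : (0 : ℝ) < ε / 8 := by positivity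
  obtain ⟨t₀, ht₀⟩ := eventually_atTop.1 ((Metric.tendsto_nhds.1 h) _ h8)
  filter_upwards [eventually_abs_sub_le hp hp' τ h8, eventually_ge_atTop t₀,
    eventually_ge_atTop 0] with t h1 h2 ht0
  rw [Real.dist_eq, sub_zero]
  -- On the window Z' is close to the constant -p t: ε/8 for the vanishing sum p + Z' and ε/8 for
  -- the drift of p.
  have h3 := abs_sub_sub_le hZ (c := -p t) (C := ε / 4) ht0 hτ0.le (fun s hs => by
    have h4 : |p s + Z' s| < ε / 8 := by simpa [Real.dist_eq] using ht₀ s (h2.trans hs.1)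
    have h5 := h1 s hs
    have : Z' s - -p t = (p s + Z' s) - (p s - p t) := by ring
    rw [this]
    refine (abs_sub _ _).trans ?_
    linarith)
  have h6 : |p t| * τ ≤ ε / 4 * τ + 2 * B := by
    rw [← abs_of_pos hτ0, ← abs_mul, abs_of_pos hτ0]
    have : p t * τ = (Z (t + τ) - Z t - -p t * τ) - (Z (t + τ) - Z t) := by ring
    rw [this]
    refine (abs_sub _ _).trans (add_le_add h3 ((abs_sub _ _).trans ?_))
    linarith [hB t ht0, hB (t + τ) (by linarith)]
  have h7 : 2 * B < ε / 4 * τ := by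
    rw [hτ]
    field_simp
    linarith
  have h9 : |p t| * τ < ε / 2 * τ := by linarith
  linarith [lt_of_mul_lt_mul_right h9 hτ0.le]

/-- Along a bounded persistently exciting signal `f`, a slowly varying `x` with `x ⬝ᵥ f → 0` tends
to zero. -/
theorem IsPE.tendsto_zero {ι : Type*} [Fintype ι] {f x x' : ℝ → ι → ℝ} (hf : IsPE f)
    (hfb : ∀ i, (fun t => f t i) ∈ boundedFns)
    (hx : ∀ i t, 0 ≤ t → HasDerivWithinAt (fun t => x t i) (x' t i) (Set.Ici 0) t)
    (hx' : ∀ i, Tendsto (fun t => x' t i) atTop (𝓝 0))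
    (hxf : Tendsto (fun t => x t ⬝ᵥ f t) atTop (𝓝 0)) : Tendsto x atTop (𝓝 0) := by
  obtain ⟨t₀, T₀, ϑ, -, hT₀, hϑ, hPE⟩ := hf
  choose B hB using hfb
  have hB0 : ∀ i, 0 ≤ B i := fun i => (abs_nonneg _).trans (hB i 0 le_rfl)
  have hs : Tendsto (fun t => Real.sqrt (x t ⬝ᵥ x t)) atTop (𝓝 0) := by
    rw [Metric.tendsto_nhds]
    intro ε hε
    -- Tolerance for the drift of x over one excitation window: against a signal bounded by B it
    -- costs at most ϑε/4.
    set κ := ϑ * ε / (4 * (∑ i, B i + 1)) with hκ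
    have hsum : 0 ≤ ∑ i, B i := Finset.sum_nonneg fun i _ => hB0 i
    have hκ0 : 0 < κ := by positivity
    obtain ⟨t₁, ht₁⟩ := eventually_atTop.1 ((Metric.tendsto_nhds.1 hxf) (ϑ * ε / 4)
      (by positivity))
    filter_upwards [eventually_all.2 fun i => eventually_abs_sub_le (hx i) (hx' i) T₀ hκ0,
      eventually_ge_atTop t₁, eventually_ge_atTop 0, eventually_ge_atTop t₀] with t h1 h2 ht0 h3
    rw [Real.dist_eq, sub_zero, abs_of_nonneg (Real.sqrt_nonneg _)]
    rcases (Real.sqrt_nonneg (x t ⬝ᵥ x t)).eq_or_lt with h0 | hpos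
    · rw [← h0]; exact hε
    set s := Real.sqrt (x t ⬝ᵥ x t) with hs
    have hss : s * s = x t ⬝ᵥ x t := Real.mul_self_sqrt (dotProduct_self_nonneg' _)
    have hbound : ∀ r ∈ Set.Icc t (t + T₀), |x t ⬝ᵥ f r| ≤ ϑ * ε / 2 := by
      intro r hr
      have h4 : |x r ⬝ᵥ f r| < ϑ * ε / 4 := by
        simpa [Real.dist_eq] using ht₁ r (h2.trans hr.1)
      have h5 : abs ((x r - x t) ⬝ᵥ f r) ≤ κ * ∑ i, B i := by
        rw [Finset.mul_sum]
        refine (Finset.abs_sum_le_sum_abs _ _).trans (Finset.sum_le_sum fun i _ => ?_)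
        rw [abs_mul]
        exact mul_le_mul (h1 i r hr) (hB i r (ht0.trans hr.1)) (abs_nonneg _) hκ0.le
      have h6 : κ * ∑ i, B i ≤ ϑ * ε / 4 := by
        have : κ * (∑ i, B i + 1) = ϑ * ε / 4 := by rw [hκ]; field_simp
        linarith
      have : x t ⬝ᵥ f r = x r ⬝ᵥ f r - (x r - x t) ⬝ᵥ f r := by rw [sub_dotProduct]; ring
      rw [this]
      refine (abs_sub _ _).trans ?_
      linarith
    -- Excitation is tested in the frozen direction x(t)/|x(t)|; the average there is at most
    -- ϑε/(2|x(t)|), so |x(t)| < ε.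
    have h7 := hPE (s⁻¹ • x t) (by
      rw [smul_dotProduct, dotProduct_smul, ← hss, smul_eq_mul, smul_eq_mul]
      field_simp) t h3
    have h8 : abs (∫ r in t..(t + T₀), |(s⁻¹ • x t) ⬝ᵥ f r|) ≤
        s⁻¹ * (ϑ * ε / 2) * |t + T₀ - t| := by
      rw [← Real.norm_eq_abs]
      refine intervalIntegral.norm_integral_le_of_norm_le_const fun r hr => ?_
      rw [Set.uIoc_of_le (by linarith)] at hr
      rw [Real.norm_eq_abs, abs_abs, smul_dotProduct, smul_eq_mul, abs_mul,
        abs_of_pos (inv_pos.2 hpos)]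
      exact mul_le_mul_of_nonneg_left (hbound r (Set.Ioc_subset_Icc_self hr))
        (inv_pos.2 hpos).le
    rw [add_sub_cancel_left, abs_of_pos hT₀] at h8
    have h9 : ϑ ≤ 1 / T₀ * (s⁻¹ * (ϑ * ε / 2) * T₀) :=
      h7.trans (mul_le_mul_of_nonneg_left ((le_abs_self _).trans h8) (by positivity))
    have h10 : 1 / T₀ * (s⁻¹ * (ϑ * ε / 2) * T₀) = ϑ * ε / 2 / s := by field_simp
    rw [h10, le_div_iff₀ hpos] at h9
    have h11 : ϑ * s < ϑ * ε := by
      have : 0 < ϑ * ε := by positivity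
      linarith
    exact lt_of_mul_lt_mul_left h11 hϑ.le
  rw [tendsto_pi_nhds]
  intro i
  refine squeeze_zero_norm (fun t => ?_) hs
  rw [Real.norm_eq_abs, ← Real.sqrt_sq_eq_abs]
  exact Real.sqrt_le_sqrt (sq_le_dotProduct_self _ i)

end HalfLine

/-! Vector and matrix signals with entries in an algebra of functions -/

section Entries

variable {p q m : Type*} {A : Subalgebra ℝ (ℝ → ℝ)}

/-- All closed-loop expressions are polynomial in the signals, so closure of a subalgebra settles
boundedness and boundedness of derivatives by the same lemmas, with A = `boundedFns` or
`boundedC1Fns`. -/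
def VecIn (A : Subalgebra ℝ (ℝ → ℝ)) (f : ℝ → p → ℝ) : Prop := ∀ i, (fun t => f t i) ∈ A

def MatIn (A : Subalgebra ℝ (ℝ → ℝ)) (f : ℝ → Matrix p q ℝ) : Prop :=
  ∀ i j, (fun t => f t i j) ∈ A

theorem const_mem (A : Subalgebra ℝ (ℝ → ℝ)) (c : ℝ) : (fun _ : ℝ => c) ∈ A :=
  A.algebraMap_mem c

theorem sum_mem_fun [Fintype p] {f : p → ℝ → ℝ} (h : ∀ i, f i ∈ A) :
    (fun t => ∑ i, f i t) ∈ A := by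
  have := sum_mem (S := A) (t := Finset.univ) fun i _ => h i
  convert this
  simp

theorem VecIn.const (c : p → ℝ) : VecIn A fun _ => c := fun i => const_mem A (c i)

theorem VecIn.add {f g : ℝ → p → ℝ} (hf : VecIn A f) (hg : VecIn A g) :
    VecIn A fun t => f t + g t := fun i => add_mem (hf i) (hg i)

theorem VecIn.sub {f g : ℝ → p → ℝ} (hf : VecIn A f) (hg : VecIn A g) :
    VecIn A fun t => f t - g t := fun i => sub_mem (hf i) (hg i)

theorem VecIn.neg {f : ℝ → p → ℝ} (hf : VecIn A f) : VecIn A fun t => -f t :=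
  fun i => neg_mem (hf i)

theorem VecIn.smul {c : ℝ → ℝ} {f : ℝ → p → ℝ} (hc : c ∈ A) (hf : VecIn A f) :
    VecIn A fun t => c t • f t := fun i => mul_mem hc (hf i)

theorem VecIn.const_smul (c : ℝ) {f : ℝ → p → ℝ} (hf : VecIn A f) :
    VecIn A fun t => c • f t := VecIn.smul (const_mem A c) hf

theorem VecIn.dotProduct [Fintype p] {f g : ℝ → p → ℝ} (hf : VecIn A f) (hg : VecIn A g) :
    (fun t => f t ⬝ᵥ g t) ∈ A := sum_mem_fun fun i => mul_mem (hf i) (hg i)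

theorem MatIn.const (c : Matrix p q ℝ) : MatIn A fun _ => c := fun i j => const_mem A (c i j)

theorem MatIn.add {f g : ℝ → Matrix p q ℝ} (hf : MatIn A f) (hg : MatIn A g) :
    MatIn A fun t => f t + g t := fun i j => add_mem (hf i j) (hg i j)

theorem MatIn.sub {f g : ℝ → Matrix p q ℝ} (hf : MatIn A f) (hg : MatIn A g) :
    MatIn A fun t => f t - g t := fun i j => sub_mem (hf i j) (hg i j)

theorem MatIn.neg {f : ℝ → Matrix p q ℝ} (hf : MatIn A f) : MatIn A fun t => -f t :=
  fun i j => neg_mem (hf i j)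

theorem MatIn.smul {c : ℝ → ℝ} {f : ℝ → Matrix p q ℝ} (hc : c ∈ A) (hf : MatIn A f) :
    MatIn A fun t => c t • f t := fun i j => mul_mem hc (hf i j)

theorem MatIn.transpose {f : ℝ → Matrix p q ℝ} (hf : MatIn A f) : MatIn A fun t => (f t)ᵀ :=
  fun i j => hf j i

theorem MatIn.mulVec [Fintype q] {f : ℝ → Matrix p q ℝ} {g : ℝ → q → ℝ} (hf : MatIn A f)
    (hg : VecIn A g) : VecIn A fun t => f t *ᵥ g t := fun i =>
  sum_mem_fun fun j => mul_mem (hf i j) (hg j)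

theorem VecIn.mulVec [Fintype q] (B : Matrix p q ℝ) {g : ℝ → q → ℝ} (hg : VecIn A g) :
    VecIn A fun t => B *ᵥ g t := (MatIn.const B).mulVec hg

theorem MatIn.mul [Fintype q] {f : ℝ → Matrix p q ℝ} {g : ℝ → Matrix q m ℝ} (hf : MatIn A f)
    (hg : MatIn A g) : MatIn A fun t => f t * g t := fun i j => by
  simp only [Matrix.mul_apply]
  exact sum_mem_fun fun k => mul_mem (hf i k) (hg k j)

theorem MatIn.fromCols {f : ℝ → Matrix p q ℝ} {g : ℝ → Matrix p m ℝ} (hf : MatIn A f)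
    (hg : MatIn A g) : MatIn A fun t => Matrix.fromCols (f t) (g t) := by
  rintro i (j | j)
  · exact hf i j
  · exact hg i j

theorem MatIn.blockMul [Fintype q] {ℓ : ℕ} (E : Fin ℓ → Matrix p q ℝ) {f : ℝ → Matrix q m ℝ}
    (hf : MatIn A f) : MatIn A fun t => _root_.blockMul E (f t) := fun i ja =>
  ((MatIn.const (E ja.1)).mul hf) i ja.2

theorem VecIn.blockMulVec [Fintype q] {ℓ : ℕ} (E : Fin ℓ → Matrix p q ℝ) {f : ℝ → q → ℝ}
    (hf : VecIn A f) : MatIn A fun t => _root_.blockMulVec E (f t) := fun i j =>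
  (hf.mulVec (E j)) i

theorem VecIn.crossMat {w : ℝ → Fin 3 → ℝ} (hw : VecIn A w) :
    MatIn A fun t => _root_.crossMat (w t) := by
  have h := const_mem A 0
  have hn : ∀ i, (fun t => -w t i) ∈ A := fun i => neg_mem (hw i)
  intro i j
  fin_cases i <;> fin_cases j <;> simp [_root_.crossMat, h, hn, hw _]

theorem VecIn.inertiaL {w : ℝ → Fin 3 → ℝ} (hw : VecIn A w) :
    MatIn A fun t => _root_.inertiaL (w t) := by
  have h := const_mem A 0
  intro i j
  fin_cases i <;> fin_cases j <;> simp [_root_.inertiaL, h, hw _]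

variable {r : Fin 3 → ℕ} {nμ ℓ : ℕ} (D : DesignData r nμ ℓ)

theorem VecIn.L₀ {w : ℝ → Fin 3 → ℝ} (hw : VecIn A w) : VecIn A fun t => D.L₀ (w t) :=
  hw.inertiaL.mulVec (VecIn.const _)

theorem VecIn.L₁ {w : ℝ → Fin 3 → ℝ} (hw : VecIn A w) : MatIn A fun t => D.L₁ (w t) :=
  hw.inertiaL.mul (MatIn.const _)

theorem VecIn.F₀ {w : ℝ → Fin 3 → ℝ} (hw : VecIn A w) : VecIn A fun t => D.F₀ (w t) :=
  (hw.crossMat.mulVec (hw.L₀ D)).neg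

theorem VecIn.F₁ {w : ℝ → Fin 3 → ℝ} (hw : VecIn A w) : MatIn A fun t => D.F₁ (w t) :=
  (hw.crossMat.mul (hw.L₁ D)).neg

theorem VecIn.rho {w : ℝ → Fin 3 → ℝ} {ζ : ℝ → Matrix (Blk r) (Fin nμ) ℝ} {v : ℝ → Blk r → ℝ}
    (hw : VecIn A w) (hζ : MatIn A ζ) (hv : VecIn A v) :
    MatIn A fun t => D.rho (w t) (ζ t) (v t) :=
  ((hw.F₁ D).add ((MatIn.const _).mul (((MatIn.const _).mul (hw.L₁ D)).add hζ))).fromCols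
    (((hζ.add ((MatIn.const _).mul (hw.L₁ D))).blockMul D.E).fromCols
      ((((hw.L₀ D).mulVec _).sub hv).blockMulVec D.E))

theorem VecIn.quatErrVec {qv : ℝ → Fin 3 → ℝ} {q4 : ℝ → ℝ} (hqv : VecIn A qv) (hq4 : q4 ∈ A)
    (qdv : Fin 3 → ℝ) (qd4 : ℝ) : VecIn A fun t => _root_.quatErrVec qdv qd4 (qv t) (q4 t) :=
  ((hqv.const_smul _).sub (hqv.mulVec _)).sub (VecIn.smul hq4 (VecIn.const _))

theorem VecIn.torque {n : ℕ} (δ : Matrix (Fin 3) (Fin n) ℝ) (C : Matrix (Fin n) (Fin n) ℝ)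
    (k₁ k₂ : ℝ) {qe ω : ℝ → Fin 3 → ℝ} {v : ℝ → Blk r → ℝ} {R : ℝ → ParIdx nμ ℓ → ℝ}
    {ζ : ℝ → Matrix (Blk r) (Fin nμ) ℝ} (hqe : VecIn A qe) (hω : VecIn A ω) (hv : VecIn A v)
    (hR : VecIn A R) (hζ : MatIn A ζ) :
    VecIn A fun t => _root_.torque D δ C k₁ k₂ (qe t) (ω t) (v t) (R t) (ζ t) :=
  ((((((hqe.const_smul k₁).neg.sub (hω.const_smul k₂)).sub ((hω.rho D hζ hv).mulVec hR)).sub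
    (((hω.L₀ D).mulVec _).mulVec _)).add (hω.mulVec _)).add (hv.mulVec _)).sub (hω.F₀ D)

end Entries

/-! Derivatives of vector signals -/

section Deriv

variable {p q : Type*} [Fintype q] {s : Set ℝ} {t : ℝ}

theorem HasDerivWithinAt.mulVec_const {f : ℝ → q → ℝ} {f' : q → ℝ} (A : Matrix p q ℝ)
    (hf : HasDerivWithinAt f f' s t) :
    HasDerivWithinAt (fun t => A *ᵥ f t) (A *ᵥ f') s t := by
  rw [hasDerivWithinAt_pi] at hf ⊢
  intro i
  exact HasDerivWithinAt.fun_sum fun j _ => (hf j).const_mul (A i j)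

theorem HasDerivWithinAt.matrix_mulVec {f : ℝ → Matrix p q ℝ} {f' : Matrix p q ℝ} (c : q → ℝ)
    (hf : ∀ i j, HasDerivWithinAt (fun t => f t i j) (f' i j) s t) :
    HasDerivWithinAt (fun t => f t *ᵥ c) (f' *ᵥ c) s t := by
  rw [hasDerivWithinAt_pi]
  intro i
  exact HasDerivWithinAt.fun_sum fun j _ => (hf i j).mul_const (c j)

theorem VecIn.boundedC1 {f f' : ℝ → p → ℝ} (hf : VecIn boundedFns f) (hf' : VecIn boundedFns f')
    (h : ∀ t, 0 ≤ t → HasDerivWithinAt f (f' t) (Set.Ici 0) t) : VecIn boundedC1Fns f :=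
  fun i => ⟨hf i, _, hf' i, fun t ht => hasDerivWithinAt_pi.1 (h t ht) i⟩

theorem VecIn.bounded {f : ℝ → p → ℝ} (hf : VecIn boundedC1Fns f) : VecIn boundedFns f :=
  fun i => (hf i).1

variable [Fintype p]

theorem HasDerivWithinAt.dotProduct {f g : ℝ → p → ℝ} {f' g' : p → ℝ}
    (hf : HasDerivWithinAt f f' s t) (hg : HasDerivWithinAt g g' s t) :
    HasDerivWithinAt (fun t => f t ⬝ᵥ g t) (f' ⬝ᵥ g t + f t ⬝ᵥ g') s t := by
  rw [hasDerivWithinAt_pi] at hf hg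
  simp only [_root_.dotProduct, ← Finset.sum_add_distrib]
  exact HasDerivWithinAt.fun_sum fun i _ => (hf i).mul (hg i)

theorem HasDerivWithinAt.quadratic {f : ℝ → p → ℝ} {f' : p → ℝ} {P : Matrix p p ℝ} (hP : Pᵀ = P)
    (hf : HasDerivWithinAt f f' s t) :
    HasDerivWithinAt (fun t => f t ⬝ᵥ P *ᵥ f t) (2 * (f t ⬝ᵥ P *ᵥ f')) s t := by
  convert hf.dotProduct (hf.mulVec_const P) using 1
  rw [dotProduct_mulVec_symm hP]
  ring

theorem VecIn.of_dotProduct_self_le {f : ℝ → p → ℝ} {B : ℝ} (h : ∀ t, 0 ≤ t → f t ⬝ᵥ f t ≤ B) :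
    VecIn boundedFns f := fun i =>
  ⟨Real.sqrt B, fun t ht => Real.abs_le_sqrt ((sq_le_dotProduct_self (f t) i).trans (h t ht))⟩

theorem tendsto_zero_of_dotProduct_self {f : ℝ → p → ℝ}
    (h : Tendsto (fun t => f t ⬝ᵥ f t) atTop (𝓝 0)) : Tendsto f atTop (𝓝 0) := by
  rw [tendsto_pi_nhds]
  intro i
  have h2 : Tendsto (fun t => Real.sqrt (f t ⬝ᵥ f t)) atTop (𝓝 0) := by
    simpa [Function.comp_def] using (Real.continuous_sqrt.tendsto 0).comp h
  refine squeeze_zero_norm (fun t => ?_) h2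
  rw [Real.norm_eq_abs]
  exact Real.abs_le_sqrt (sq_le_dotProduct_self (f t) i)

/-- A stable linear system driven by a bounded input which is square-dominated by the decay rate of
a Lyapunov function. -/
theorem IsLyapunov.tendsto_zero_of_input {M P : Matrix p p ℝ} (hP : IsLyapunov M P)
    {x b : ℝ → p → ℝ} {V V' g : ℝ → ℝ} {C : ℝ}
    (hx : ∀ t, 0 ≤ t → HasDerivWithinAt x (M *ᵥ x t + b t) (Set.Ici 0) t)
    (hV : ∀ t, 0 ≤ t → HasDerivWithinAt V (V' t) (Set.Ici 0) t) (hV0 : ∀ t, 0 ≤ t → 0 ≤ V t)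
    (hVg : ∀ t, 0 ≤ t → V' t ≤ -g t) (hC : 0 ≤ C) (hb : ∀ t, 0 ≤ t → b t ⬝ᵥ b t ≤ C * g t)
    (hbb : VecIn boundedFns b) : VecIn boundedC1Fns x ∧ Tendsto x atTop (𝓝 0) := by
  obtain ⟨c, hc, hPb⟩ := exists_abs_dotProduct_mulVec_le P (show (0 : ℝ) < 1 / 4 by norm_num)
  obtain ⟨p₀, hp₀, hlow⟩ := hP.lower
  -- Young's inequality gives 2xᵀPb ≤ |x|²/2 + 2c|b|². The multiple of V is chosen so that its decay
  -- pays for 2c|b|² ≤ 2cCg, leaving half of the decay of the quadratic form.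
  set W := fun t => 2 * c * C * V t + x t ⬝ᵥ P *ᵥ x t with hW
  set W' := fun t => 2 * c * C * V' t + 2 * (x t ⬝ᵥ P *ᵥ (M *ᵥ x t + b t)) with hW'
  have hWd : ∀ t, 0 ≤ t → HasDerivWithinAt W (W' t) (Set.Ici 0) t := fun t ht =>
    ((hV t ht).const_mul _).add ((hx t ht).quadratic hP.symm)
  have hW0 : ∀ t, 0 ≤ t → p₀ * (x t ⬝ᵥ x t) ≤ W t := fun t ht => by
    have := mul_nonneg (mul_nonneg (mul_nonneg zero_le_two hc) hC) (hV0 t ht)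
    linarith [hlow (x t)]
  have hWle : ∀ t, 0 ≤ t → W' t ≤ -(1 / 2 * (x t ⬝ᵥ x t)) := fun t ht => by
    have h1 := hP.decay (x t)
    have h2 := (abs_le.1 (hPb (x t) (b t))).2
    have h3 := mul_le_mul_of_nonneg_left (hb t ht) hc
    have h4 := mul_le_mul_of_nonneg_left (hVg t ht) (mul_nonneg hc hC)
    simp only [hW', mulVec_add, dotProduct_add]
    linarith
  have hxb : VecIn boundedFns x := by
    refine VecIn.of_dotProduct_self_le (B := W 0 / p₀) fun t ht => ?_
    rw [le_div_iff₀ hp₀, mul_comm]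
    refine (hW0 t ht).trans (antitoneOn_of_deriv_le hWd (fun s hs => (hWle s hs).trans ?_)
      (Set.mem_Ici.2 le_rfl) ht ht)
    linarith [dotProduct_self_nonneg' (x s)]
  have hxC : VecIn boundedC1Fns x := hxb.boundedC1 ((hxb.mulVec M).add hbb) hx
  refine ⟨hxC, tendsto_zero_of_dotProduct_self ?_⟩
  have := tendsto_zero_of_deriv_le_neg hWd
    (fun t ht => (mul_nonneg hp₀.le (dotProduct_self_nonneg' _)).trans (hW0 t ht)) hWle
    (fun t _ => by have := dotProduct_self_nonneg' (x t); positivity)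
    (mul_mem (const_mem _ (1 / 2)) (hxC.dotProduct hxC))
  simpa using this.const_mul 2

end Deriv

/-! The disturbance -/

section Disturbance

/-- Differentiation shifts each phase by π/2 and rescales each amplitude, so all derivatives remain
in this class of bounded smooth functions. -/
theorem exists_iteratedDeriv_tones {n : ℕ} (amp₀ : ℝ) (amp freq phase : Fin n → ℝ) (k : ℕ) :
    ∃ (amp₀' : ℝ) (amp' phase' : Fin n → ℝ),
      iteratedDeriv k (fun t => amp₀ + ∑ j, amp j * Real.sin (freq j * t + phase j)) =
        fun t => amp₀' + ∑ j, amp' j * Real.sin (freq j * t + phase' j) := by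
  induction k with
  | zero => exact ⟨amp₀, amp, phase, iteratedDeriv_zero⟩
  | succ k ih =>
    obtain ⟨a₀, a, l, h⟩ := ih
    refine ⟨0, fun j => a j * freq j, fun j => l j + Real.pi / 2, ?_⟩
    rw [iteratedDeriv_succ, h]
    ext t
    rw [zero_add]
    refine HasDerivAt.deriv (HasDerivAt.const_add _ (HasDerivAt.fun_sum fun j _ => ?_))
    rw [← add_assoc, Real.sin_add_pi_div_two, mul_assoc]
    refine HasDerivAt.const_mul _ ?_
    rw [mul_comm]
    exact (((hasDerivAt_id t).const_mul (freq j)).add_const (l j)).sin.congr_deriv (by simp)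

variable {Nd : Fin 3 → ℕ} (amp₀ : Fin 3 → ℝ) (amp freq phase : ∀ i, Fin (Nd i) → ℝ) (i : Fin 3)
  (k : ℕ)

theorem bounded_iteratedDeriv_disturbance :
    iteratedDeriv k (fun t => disturbance amp₀ amp freq phase t i) ∈ boundedFns := by
  obtain ⟨a₀, a, l, h⟩ := exists_iteratedDeriv_tones (amp₀ i) (amp i) (freq i) (phase i) k
  simp only [disturbance]
  rw [h]
  exact add_mem (const_mem _ _) (sum_mem_fun fun j => mul_mem (const_mem _ _)
    ⟨1, fun t _ => Real.abs_sin_le_one _⟩)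

theorem hasDerivAt_iteratedDeriv_disturbance (t : ℝ) :
    HasDerivAt (iteratedDeriv k fun t => disturbance amp₀ amp freq phase t i)
      (iteratedDeriv (k + 1) (fun t => disturbance amp₀ amp freq phase t i) t) t := by
  obtain ⟨a₀, a, l, h⟩ := exists_iteratedDeriv_tones (amp₀ i) (amp i) (freq i) (phase i) k
  rw [iteratedDeriv_succ]
  refine DifferentiableAt.hasDerivAt ?_
  simp only [disturbance]
  rw [h]
  fun_prop

end Disturbance

/-! The internal model -/

section InternalModel

variable {r : Fin 3 → ℕ}

theorem blockPsi_mulVec_exoState (hr : ∀ i, 0 < r i) (d : ℝ → Fin 3 → ℝ) (t : ℝ) :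
    blockPsi *ᵥ (exoState d t : Blk r → ℝ) = d t := by
  ext i
  simp only [mulVec, dotProduct, blockPsi, Matrix.of_apply, Fintype.sum_sigma]
  rw [Finset.sum_eq_single i, Finset.sum_eq_single ⟨0, hr i⟩]
  · simp [exoPsi, exoState]
  · intro b _ hb
    have : (b : ℕ) ≠ 0 := fun h => hb (Fin.ext h)
    simp [exoPsi, this]
  · simp
  · intro b _ hb
    simp [hb]
  · simp

theorem blockCol_mul_blockPsi (N : ∀ i, Fin (r i) → ℝ) :
    blockCol N * blockPsi = blockDiagonal' fun i => vecMulVec (N i) (exoPsi : Fin (r i) → ℝ) := by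
  ext ⟨i, j⟩ ⟨i', j'⟩
  rw [Matrix.mul_apply, blockDiagonal'_apply]
  simp only [blockCol, blockPsi, Matrix.of_apply, ite_mul, zero_mul]
  rw [Finset.sum_ite_eq Finset.univ i]
  by_cases h : i = i'
  · subst h
    simp [vecMulVec_apply]
  · simp [h, Ne.symm h]

theorem block_sylvester {M T : ∀ i, Matrix (Fin (r i)) (Fin (r i)) ℝ}
    {N a : ∀ i, Fin (r i) → ℝ}
    (hT : ∀ i, T i * exoPhi (a i) - M i * T i = vecMulVec (N i) exoPsi) :
    blockDiagonal' T * blockDiagonal' (fun i => exoPhi (a i))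
      = blockDiagonal' M * blockDiagonal' T + blockCol N * blockPsi := by
  rw [blockCol_mul_blockPsi, ← blockDiagonal'_mul, ← blockDiagonal'_mul, ← blockDiagonal'_add]
  congr 1
  ext1 i
  rw [Pi.add_apply, ← hT i]
  abel

theorem isUnit_det_blockDiagonal' {T : ∀ i, Matrix (Fin (r i)) (Fin (r i)) ℝ}
    (h : ∀ i, (T i).det ≠ 0) : IsUnit (blockDiagonal' T).det := by
  rw [← Matrix.isUnit_iff_isUnit_det]
  refine isUnit_iff_exists_inv.2 ⟨blockDiagonal' fun i => (T i)⁻¹, ?_⟩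
  rw [← blockDiagonal'_mul, ← blockDiagonal'_one]
  congr 1
  ext1 i
  exact Matrix.mul_nonsing_inv _ (isUnit_iff_ne_zero.2 (h i))

theorem hasDerivAt_exoState {a : ∀ i, Fin (r i) → ℝ} {Nd : Fin 3 → ℕ} {amp₀ : Fin 3 → ℝ}
    {amp freq phase : ∀ i, Fin (Nd i) → ℝ} {d : ℝ → Fin 3 → ℝ}
    (hd : d = disturbance amp₀ amp freq phase)
    (hda : ∀ i t, iteratedDeriv (r i) (fun s => d s i) t =
      ∑ m : Fin (r i), a i m * iteratedDeriv (m : ℕ) (fun s => d s i) t) (t : ℝ) :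
    HasDerivAt (exoState d : ℝ → Blk r → ℝ)
      (blockDiagonal' (fun i => exoPhi (a i)) *ᵥ exoState d t) t := by
  rw [hasDerivAt_pi]
  rintro ⟨i, j⟩
  have h := hasDerivAt_iteratedDeriv_disturbance amp₀ amp freq phase i j t
  rw [← hd] at h
  refine h.congr_deriv ?_
  rw [blockDiagonal'_mulVec_apply]
  simp only [mulVec, dotProduct, exoPhi, Matrix.of_apply, exoState]
  by_cases hj : (j : ℕ) + 1 = r i
  · simp only [if_pos hj]
    rw [hj, hda]
  · simp only [if_neg hj]
    have hlt : (j : ℕ) + 1 < r i := lt_of_le_of_ne j.2 hj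
    rw [Finset.sum_eq_single ⟨(j : ℕ) + 1, hlt⟩]
    · simp
    · intro b _ hb
      have : (b : ℕ) ≠ j + 1 := fun h => hb (Fin.ext h)
      simp [this]
    · simp

theorem exoState_boundedC1 {Nd : Fin 3 → ℕ} {amp₀ : Fin 3 → ℝ}
    {amp freq phase : ∀ i, Fin (Nd i) → ℝ} {d : ℝ → Fin 3 → ℝ}
    (hd : d = disturbance amp₀ amp freq phase) :
    VecIn boundedC1Fns (exoState d : ℝ → Blk r → ℝ) := by
  subst hd
  exact fun p => ⟨bounded_iteratedDeriv_disturbance amp₀ amp freq phase p.1 p.2, _,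
    bounded_iteratedDeriv_disturbance amp₀ amp freq phase p.1 (p.2 + 1), fun t _ =>
      (hasDerivAt_iteratedDeriv_disturbance amp₀ amp freq phase p.1 p.2 t).hasDerivWithinAt⟩

/-- A channel whose generating polynomial has no zero root has a bounded antiderivative. -/
theorem exists_bounded_antideriv_of_coeff_ne_zero {m : ℕ} {a : Fin m → ℝ} (hm : 0 < m)
    (ha : a ⟨0, hm⟩ ≠ 0) {f : ℝ → ℝ} (hb : ∀ k, iteratedDeriv k f ∈ boundedFns)
    (hf : ∀ k t, HasDerivAt (iteratedDeriv k f) (iteratedDeriv (k + 1) f t) t)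
    (hfa : ∀ t, iteratedDeriv m f t = ∑ k : Fin m, a k * iteratedDeriv (k : ℕ) f t) :
    ∃ H ∈ boundedFns, ∀ t, HasDerivAt H (f t) t := by
  obtain ⟨n, rfl⟩ : ∃ n, m = n + 1 := ⟨m - 1, by omega⟩
  -- Solved for a₀f, the differential equation exhibits a₀f as the derivative of this combination of
  -- lower-order derivatives.
  refine ⟨fun t => (a 0)⁻¹ * (iteratedDeriv n f t - ∑ k : Fin n, a k.succ * iteratedDeriv k f t),
    mul_mem (const_mem _ _) (sub_mem (hb n)
      (sum_mem_fun fun k => mul_mem (const_mem _ _) (hb k))), fun t => ?_⟩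
  have h := (((hf n t).fun_sub (HasDerivAt.fun_sum fun (k : Fin n) (_ : k ∈ Finset.univ) =>
    (hf k t).const_mul (a k.succ))).const_mul (a 0)⁻¹)
  refine h.congr_deriv ?_
  have ha' : a 0 ≠ 0 := ha
  have h1 := hfa t
  rw [Fin.sum_univ_succ] at h1
  simp only [Fin.val_succ, Fin.val_zero, iteratedDeriv_zero] at h1
  rw [h1]
  field_simp
  ring

end InternalModel

/-! ### Non-redundancy at frequency zero -/

section Parameterization

variable {r : Fin 3 → ℕ} {M : ∀ i, Matrix (Fin (r i)) (Fin (r i)) ℝ} {N : ∀ i, Fin (r i) → ℝ}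

/-- When 0 is a root in channel l, the first basis vector e of that channel, the constant
disturbance, lies in the kernel of Φ. The Sylvester equation reduces to MTe = -NΨe with Ψe the l-th
unit vector, so M⁻¹NΨe = -Te. The result no longer involves the frequencies. -/
theorem blockPsi_mul_inv_mulVec (hr : ∀ i, 0 < r i) (hM : ∀ i, IsHurwitz (M i))
    (hMN : ∀ i, IsControllable (M i) (N i)) {a : ∀ i, Fin (r i) → ℝ}
    {T : ∀ i, Matrix (Fin (r i)) (Fin (r i)) ℝ}
    (hT : ∀ i, T i * exoPhi (a i) - M i * T i = vecMulVec (N i) exoPsi) (l : Fin 3)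
    (ha : a l ⟨0, hr l⟩ = 0) :
    ((blockPsi : Matrix (Fin 3) (Blk r) ℝ) * (blockDiagonal' T)⁻¹) *ᵥ
      ((blockDiagonal' M)⁻¹ *ᵥ (blockCol N *ᵥ Pi.single l 1)) = -Pi.single l 1 := by
  have hMdet : IsUnit (blockDiagonal' M).det := isUnit_det_blockDiagonal' fun i =>
    (hM i).exists_isLyapunov.elim fun _ h => h.det_ne_zero
  have hTdet : IsUnit (blockDiagonal' T).det :=
    isUnit_det_blockDiagonal' fun i => det_ne_zero_of_sylvester (hMN i) (hT i)
  set e : Blk r → ℝ := Pi.single ⟨l, ⟨0, hr l⟩⟩ 1 with he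
  have hΦ : blockDiagonal' (fun i => exoPhi (a i)) *ᵥ e = 0 := by
    rw [he, mulVec_single_one]
    ext ⟨i, j⟩
    by_cases h : i = l
    · subst h
      simp [blockDiagonal'_apply, exoPhi, ha]
    · simp [blockDiagonal'_apply, h]
  have hΨ : (blockPsi : Matrix (Fin 3) (Blk r) ℝ) *ᵥ e = Pi.single l 1 := by
    rw [he, mulVec_single_one]
    ext i
    simp [blockPsi, exoPsi, Pi.single_apply, eq_comm]
  have h := congrArg (· *ᵥ e) (block_sylvester hT)
  simp only [← mulVec_mulVec, add_mulVec, hΦ, hΨ, mulVec_zero] at h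
  have h2 : blockCol N *ᵥ Pi.single l 1
      = blockDiagonal' M *ᵥ (-(blockDiagonal' T *ᵥ e)) := by
    rw [mulVec_neg]
    exact eq_neg_of_add_eq_zero_right h.symm
  rw [h2, mulVec_mulVec (-_) (blockDiagonal' M)⁻¹, Matrix.nonsing_inv_mul _ hMdet, one_mulVec,
    ← mulVec_mulVec, mulVec_neg, mulVec_mulVec, Matrix.nonsing_inv_mul _ hTdet, one_mulVec,
    mulVec_neg, hΨ]

/-- Each row of the constancy relation is a linear dependence among 1 and the Ω_j. Its coefficients
vanish wherever the row of E^j does, which is the side condition of non-redundancy. -/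
theorem NonRedundant.mulVec_eq_zero {P q : Type*} [Fintype q] {ℓ : ℕ} {S : Set P}
    {E₀ : Matrix (Fin 3) q ℝ} {E : Fin ℓ → Matrix (Fin 3) q ℝ} {Ω : P → Fin ℓ → ℝ}
    (h : NonRedundant S E Ω) {w : q → ℝ} {c : Fin 3 → ℝ}
    (hc : ∀ s ∈ S, (E₀ + ∑ j, Ω s j • E j) *ᵥ w = c) (j : Fin ℓ) : E j *ᵥ w = 0 := by
  ext i
  refine (h i ((E₀ *ᵥ w) i - c i) (fun j => (E j *ᵥ w) i) (fun j hj => ?_) (fun s hs => ?_)).2 j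
  · exact Finset.sum_eq_zero fun p _ => mul_eq_zero_of_left (hj p) _
  · have := congrFun (hc s hs) i
    rw [add_mulVec, sum_mulVec, Pi.add_apply, Finset.sum_apply] at this
    simp only [smul_mulVec, Pi.smul_apply, smul_eq_mul] at this
    rw [← this]
    simp only [mul_comm]
    ring

end Parameterization

/-! ### Bounded antiderivatives of the signals E^j θ -/

section Antiderivative

variable {nσ : ℕ} {S : Set (Fin nσ → ℝ)} {r : Fin 3 → ℕ} {a : (Fin nσ → ℝ) → ∀ i, Fin (r i) → ℝ}
  {M : ∀ i, Matrix (Fin (r i)) (Fin (r i)) ℝ} {N : ∀ i, Fin (r i) → ℝ}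
  {T : (Fin nσ → ℝ) → ∀ i, Matrix (Fin (r i)) (Fin (r i)) ℝ} {σ : Fin nσ → ℝ}

/-- Absence of redundancy removes the mean values of the signals `E^j θ`. -/
theorem exists_bounded_antideriv_mulVec (hr : ∀ i, 0 < r i)
    (ha : ∀ s ∈ S, ∀ i, HasSimpleImaginaryRoots (exoPoly (a s i)))
    (hM : ∀ i, IsHurwitz (M i)) (hMN : ∀ i, IsControllable (M i) (N i))
    (hT : ∀ s ∈ S, ∀ i, T s i * exoPhi (a s i) - M i * T s i = vecMulVec (N i) exoPsi)
    (hσ : σ ∈ S) {ℓ : ℕ} {E₀ : Matrix (Fin 3) (Blk r) ℝ} {E : Fin ℓ → Matrix (Fin 3) (Blk r) ℝ}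
    {Ω : (Fin nσ → ℝ) → Fin ℓ → ℝ}
    (hpar : ∀ s ∈ S, (blockPsi : Matrix (Fin 3) (Blk r) ℝ) * (blockDiagonal' (T s))⁻¹
      = E₀ + ∑ j, Ω s j • E j)
    (hE : NonRedundant S E Ω) {Nd : Fin 3 → ℕ} {amp₀ : Fin 3 → ℝ}
    {amp freq phase : ∀ i, Fin (Nd i) → ℝ} {d : ℝ → Fin 3 → ℝ}
    (hd : d = disturbance amp₀ amp freq phase)
    (hda : ∀ i t, iteratedDeriv (r i) (fun s => d s i) t =
      ∑ m : Fin (r i), a σ i m * iteratedDeriv (m : ℕ) (fun s => d s i) t)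
    {θ : ℝ → Blk r → ℝ} (hθb : VecIn boundedFns θ)
    (hθ : ∀ t, HasDerivAt θ (blockDiagonal' M *ᵥ θ t + blockCol N *ᵥ d t) t) (j : Fin ℓ)
    (i : Fin 3) :
    ∃ H ∈ boundedFns, ∀ t, HasDerivAt H ((E j *ᵥ θ t) i) t := by
  have hMdet : IsUnit (blockDiagonal' M).det := isUnit_det_blockDiagonal' fun i =>
    (hM i).exists_isLyapunov.elim fun _ h => h.det_ne_zero
  -- From θ' = Mθ + Nd one gets E^jθ = (E^jM⁻¹θ)' - Qd, so it suffices to integrate Qd channel by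
  -- channel.
  set Q : Matrix (Fin 3) (Fin 3) ℝ := E j * (blockDiagonal' M)⁻¹ * blockCol N with hQ
  have hchan : ∀ l, ∃ H ∈ boundedFns, ∀ t, HasDerivAt H (Q i l * d t l) t := by
    intro l
    -- Even order: 0 is not a root and d_l itself integrates to a bounded function. Odd order: d_l
    -- may have a nonzero mean, but its coefficient in Q is zero.
    rcases Nat.even_or_odd (r l) with hev | hodd
    · obtain ⟨H, hH, hHd⟩ := exists_bounded_antideriv_of_coeff_ne_zero (hr l)
        ((ha σ hσ l).coeff_ne_zero_of_even hev (hr l)) (f := fun s => d s l)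
        (by subst hd; exact bounded_iteratedDeriv_disturbance amp₀ amp freq phase l)
        (by subst hd; exact hasDerivAt_iteratedDeriv_disturbance amp₀ amp freq phase l) (hda l)
      exact ⟨fun t => Q i l * H t, mul_mem (const_mem _ _) hH, fun t => (hHd t).const_mul _⟩
    · have h0 := hE.mulVec_eq_zero (E₀ := E₀)
        (w := (blockDiagonal' M)⁻¹ *ᵥ (blockCol N *ᵥ Pi.single l 1)) (fun s hs => by
          rw [← hpar s hs]
          exact blockPsi_mul_inv_mulVec hr hM hMN (hT s hs) l
            ((ha s hs l).coeff_eq_zero_of_odd hodd)) j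
      have hQ0 : Q i l = 0 := by
        have := congrFun h0 i
        rw [mulVec_mulVec, mulVec_mulVec, ← hQ, mulVec_single_one] at this
        exact this
      exact ⟨0, zero_mem _, fun t => by
        rw [hQ0, zero_mul]
        exact hasDerivAt_const t 0⟩
  choose H hH hHd using hchan
  refine ⟨fun t => ((E j * (blockDiagonal' M)⁻¹) *ᵥ θ t) i - ∑ l, H l t,
    sub_mem (hθb.mulVec _ i) (sum_mem_fun hH), fun t => ?_⟩
  have h1 : HasDerivAt (fun t => ((E j * (blockDiagonal' M)⁻¹) *ᵥ θ t) i)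
      (((E j * (blockDiagonal' M)⁻¹) *ᵥ (blockDiagonal' M *ᵥ θ t + blockCol N *ᵥ d t)) i) t := by
    have := ((hθ t).hasDerivWithinAt (s := Set.univ)).mulVec_const (E j * (blockDiagonal' M)⁻¹)
    exact (hasDerivWithinAt_pi.1 this i).hasDerivAt Filter.univ_mem
  refine (h1.fun_sub (HasDerivAt.fun_sum fun l (_ : l ∈ Finset.univ) => hHd l t)).congr_deriv ?_
  rw [mulVec_add, Pi.add_apply, mulVec_mulVec, mulVec_mulVec, ← hQ, Matrix.mul_assoc (E j),
    Matrix.nonsing_inv_mul _ hMdet, Matrix.mul_one]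
  simp only [mulVec, dotProduct]
  ring

end Antiderivative

/-! Lyapunov functions of the closed loop -/

section LyapunovFunction

variable {n : ℕ}

theorem exists_abs_dotProduct_mulVec_le' {m n : Type*} [Fintype m] [Fintype n]
    (A : Matrix m n ℝ) {ε : ℝ} (hε : 0 < ε) :
    ∃ c : ℝ, 0 ≤ c ∧ ∀ x y, |x ⬝ᵥ A *ᵥ y| ≤ c * (x ⬝ᵥ x) + ε * (y ⬝ᵥ y) := by
  obtain ⟨c, hc, h⟩ := exists_abs_dotProduct_mulVec_le Aᵀ hε
  refine ⟨c, hc, fun x y => ?_⟩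
  have := h y x
  rw [mulVec_transpose, dotProduct_comm, ← dotProduct_mulVec] at this
  linarith

/-- A strict Lyapunov function of the modal dynamics `η' = ψ - u`, `ψ' = -C (ψ - u) - K η`. -/
noncomputable def modalEnergy (C K : Matrix (Fin n) (Fin n) ℝ) (ε : ℝ) (η ψ : Fin n → ℝ) : ℝ :=
  1 / 2 * (ψ ⬝ᵥ ψ) + 1 / 2 * (η ⬝ᵥ K *ᵥ η) + ε * (ψ ⬝ᵥ η + 1 / 2 * (η ⬝ᵥ C *ᵥ η))

/-- The derivative of `modalEnergy` along `η' = ηd`, `ψ' = ψd`. -/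
noncomputable def modalPower (C K : Matrix (Fin n) (Fin n) ℝ) (ε : ℝ) (η ψ ηd ψd : Fin n → ℝ) : ℝ :=
  ψ ⬝ᵥ ψd + η ⬝ᵥ K *ᵥ ηd + ε * (ψd ⬝ᵥ η + ψ ⬝ᵥ ηd + η ⬝ᵥ C *ᵥ ηd)

theorem hasDerivWithinAt_modalEnergy {C K : Matrix (Fin n) (Fin n) ℝ} (hC : Cᵀ = C) (hK : Kᵀ = K)
    (ε : ℝ) {η ψ : ℝ → Fin n → ℝ} {ηd ψd : Fin n → ℝ} {s : Set ℝ} {t : ℝ}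
    (hη : HasDerivWithinAt η ηd s t) (hψ : HasDerivWithinAt ψ ψd s t) :
    HasDerivWithinAt (fun t => modalEnergy C K ε (η t) (ψ t))
      (modalPower C K ε (η t) (ψ t) ηd ψd) s t := by
  refine ((((hψ.dotProduct hψ).const_mul (1 / 2)).add ((hη.quadratic hK).const_mul (1 / 2))).add
    (((hψ.dotProduct hη).add ((hη.quadratic hC).const_mul (1 / 2))).const_mul ε)).congr_deriv ?_
  rw [modalPower, dotProduct_comm ψd (ψ t)]
  ring

/-- The plain energy dissipates only through ψ; the small cross term ε ψ·η adds dissipation -ε ηᵀKη.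
The companion term ½ ηᵀCη cancels the damping contribution that the cross term would otherwise
produce. -/
theorem exists_modalPower_le {C K : Matrix (Fin n) (Fin n) ℝ} (hC : C.PosDef) (hK : K.PosDef) :
    ∃ ε κ c w : ℝ, 0 < ε ∧ 0 < κ ∧ 0 ≤ c ∧ 0 < w ∧
      (∀ η ψ, w * (ψ ⬝ᵥ ψ + η ⬝ᵥ η) ≤ modalEnergy C K ε η ψ) ∧
      ∀ η ψ u, modalPower C K ε η ψ (ψ - u) (-(C *ᵥ (ψ - u) + K *ᵥ η))
        ≤ -(κ * (ψ ⬝ᵥ ψ + η ⬝ᵥ η)) + c * (u ⬝ᵥ u) := by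
  obtain ⟨c₀, hc₀, hCl⟩ := hC.exists_lower_bound
  obtain ⟨k₀, hk₀, hKl⟩ := hK.exists_lower_bound
  -- The first two bounds keep the energy positive definite; the third lets the damping C absorb the
  -- term ε|ψ|².
  obtain ⟨ε, hε, hε1, hε2, hε3⟩ : ∃ ε : ℝ, 0 < ε ∧ ε ≤ 1 / 2 ∧ ε ≤ k₀ / 2 ∧ ε ≤ c₀ / 2 :=
    ⟨min (1 / 2) (min (k₀ / 2) (c₀ / 2)), by positivity, min_le_left _ _,
      (min_le_right _ _).trans (min_le_left _ _), (min_le_right _ _).trans (min_le_right _ _)⟩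
  obtain ⟨c₁, hc₁, h₁⟩ := exists_abs_dotProduct_mulVec_le C (show 0 < c₀ / 8 by positivity)
  obtain ⟨c₂, hc₂, h₂⟩ := exists_abs_dotProduct_mulVec_le K (show 0 < ε * k₀ / 2 by positivity)
  obtain ⟨w, hw, hw1, hw2⟩ : ∃ w : ℝ, 0 < w ∧ w ≤ 1 / 4 ∧ w ≤ k₀ / 4 :=
    ⟨min (1 / 4) (k₀ / 4), by positivity, min_le_left _ _, min_le_right _ _⟩
  obtain ⟨κ, hκ, hκ1, hκ2⟩ : ∃ κ : ℝ, 0 < κ ∧ κ ≤ c₀ / 4 ∧ κ ≤ ε * k₀ / 2 :=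
    ⟨min (c₀ / 4) (ε * k₀ / 2), by positivity, min_le_left _ _, min_le_right _ _⟩
  refine ⟨ε, κ, c₁ + c₂ + 1 / (4 * (c₀ / 8)), w, hε, hκ, by positivity, hw, fun η ψ => ?_,
    fun η ψ u => ?_⟩
  · have e1 := dotProduct_self_nonneg' η
    have e2 := dotProduct_self_nonneg' ψ
    have e3 := (abs_le.1 (abs_dotProduct_le ψ η (show (0 : ℝ) < 1 / 2 by norm_num))).1
    have e4 := hKl η
    have e5 := (mul_nonneg hc₀.le e1).trans (hCl η)
    rw [modalEnergy]
    have e6 : w * (ψ ⬝ᵥ ψ) ≤ 1 / 4 * (ψ ⬝ᵥ ψ) := mul_le_mul_of_nonneg_right hw1 e2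
    have e7 : w * (η ⬝ᵥ η) ≤ k₀ / 4 * (η ⬝ᵥ η) := mul_le_mul_of_nonneg_right hw2 e1
    have e8 : ε * (ψ ⬝ᵥ ψ) ≤ 1 / 2 * (ψ ⬝ᵥ ψ) := mul_le_mul_of_nonneg_right hε1 e2
    have e9 : ε * (η ⬝ᵥ η) ≤ k₀ / 2 * (η ⬝ᵥ η) := mul_le_mul_of_nonneg_right hε2 e1
    have e10 := mul_nonneg hε.le e5
    have e11 := mul_le_mul_of_nonneg_left e3 hε.le
    norm_num at e11
    nlinarith
  · have e1 := dotProduct_self_nonneg' η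
    have e2 := dotProduct_self_nonneg' ψ
    have e3 := (abs_le.1 (h₁ ψ u)).2
    have e4 := (abs_le.1 (h₂ η u)).1
    have e5 := abs_dotProduct_le ψ u (show 0 < c₀ / 8 by positivity)
    have e6 := hCl ψ
    have e7 := mul_le_mul_of_nonneg_left (hKl η) hε.le
    have e8 : ε * (ψ ⬝ᵥ ψ) ≤ c₀ / 2 * (ψ ⬝ᵥ ψ) := mul_le_mul_of_nonneg_right hε3 e2
    have e9 : -(ε * (ψ ⬝ᵥ u)) ≤ |ψ ⬝ᵥ u| := by
      have := mul_le_mul_of_nonneg_left (neg_le_abs (ψ ⬝ᵥ u)) hε.le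
      have h3 : ε * |ψ ⬝ᵥ u| ≤ 1 * |ψ ⬝ᵥ u| :=
        mul_le_mul_of_nonneg_right (by linarith) (abs_nonneg _)
      linarith
    have e10 : κ * (ψ ⬝ᵥ ψ) ≤ c₀ / 4 * (ψ ⬝ᵥ ψ) := mul_le_mul_of_nonneg_right hκ1 e2
    have e11 : κ * (η ⬝ᵥ η) ≤ ε * k₀ / 2 * (η ⬝ᵥ η) := mul_le_mul_of_nonneg_right hκ2 e1
    have key : modalPower C K ε η ψ (ψ - u) (-(C *ᵥ (ψ - u) + K *ᵥ η))
        = -(ψ ⬝ᵥ C *ᵥ ψ) + ε * (ψ ⬝ᵥ ψ) - ε * (η ⬝ᵥ K *ᵥ η) + ψ ⬝ᵥ C *ᵥ u - η ⬝ᵥ K *ᵥ u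
          - ε * (ψ ⬝ᵥ u) := by
      rw [modalPower, dotProduct_comm (-_) η]
      simp only [mulVec_sub, dotProduct_sub, dotProduct_add, dotProduct_neg]
      rw [dotProduct_mulVec_symm hK.transpose_eq ψ η]
      ring
    rw [key]
    linarith

/-- The order of choice matters: Young constants first, then the modal weight α, which absorbs all
|ψ|² and |η|² terms, and finally k, which absorbs what is left in |ω|². Neither the inertia nor a
controller gain enters, which makes the threshold for k₂ uniform. -/
theorem exists_gain_bound {p : Type*} [Fintype p] {M P : Matrix p p ℝ} (hP : IsLyapunov M P)
    {C K : Matrix (Fin n) (Fin n) ℝ} (hC : C.PosDef) (hK : K.PosDef)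
    (δ : Matrix (Fin 3) (Fin n) ℝ) (Γ : Matrix (Fin 3) p ℝ) (N : Matrix p (Fin 3) ℝ) :
    ∃ α ε w k : ℝ, 0 < α ∧ 0 < w ∧ 0 < k ∧
      (∀ η ψ, w * (ψ ⬝ᵥ ψ + η ⬝ᵥ η) ≤ modalEnergy C K ε η ψ) ∧
      ∀ ω η ψ z, ω ⬝ᵥ (δ *ᵥ (C *ᵥ ψ + K *ᵥ η))
          + ω ⬝ᵥ (Γ *ᵥ (z + N *ᵥ (δ *ᵥ (ψ - δᵀ *ᵥ ω))))
          + 2 * (z ⬝ᵥ P *ᵥ (M *ᵥ (z + N *ᵥ (δ *ᵥ (ψ - δᵀ *ᵥ ω)))))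
          + α * modalPower C K ε η ψ (ψ - δᵀ *ᵥ ω) (-(C *ᵥ (ψ - δᵀ *ᵥ ω) + K *ᵥ η))
        ≤ -(1 / 4 * (z ⬝ᵥ z + ψ ⬝ᵥ ψ + η ⬝ᵥ η)) + (k - 1) * (ω ⬝ᵥ ω) := by
  obtain ⟨ε, κ, c, w, hε, hκ, hc, hw, hlow, hpow⟩ := exists_modalPower_le hC hK
  obtain ⟨c₀, hc₀, h₀⟩ := mulVec_dotProduct_self_le δᵀ
  obtain ⟨c₁, hc₁, h₁⟩ := exists_abs_dotProduct_mulVec_le' (δ * C) one_pos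
  obtain ⟨c₂, hc₂, h₂⟩ := exists_abs_dotProduct_mulVec_le' (δ * K) one_pos
  obtain ⟨c₃, hc₃, h₃⟩ := exists_abs_dotProduct_mulVec_le' Γ (show (0 : ℝ) < 1 / 4 by norm_num)
  obtain ⟨c₄, hc₄, h₄⟩ := exists_abs_dotProduct_mulVec_le' (Γ * N * δ) one_pos
  obtain ⟨c₅, hc₅, h₅⟩ := exists_abs_dotProduct_mulVec_le' (Γ * N * δ * δᵀ) one_pos
  obtain ⟨c₆, hc₆, h₆⟩ := exists_abs_dotProduct_mulVec_le (P * M * N * δ)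
    (show (0 : ℝ) < 1 / 8 by norm_num)
  obtain ⟨c₇, hc₇, h₇⟩ := exists_abs_dotProduct_mulVec_le (P * M * N * δ * δᵀ)
    (show (0 : ℝ) < 1 / 8 by norm_num)
  -- The cross terms cost at most (2 + 2c₆)|ψ|² and |η|², so this weight leaves a surplus. For z the
  -- Young weights 1/4 + 2(1/8) + 2(1/8) use three quarters of the decay.
  set α := (3 + 2 * c₆) / κ with hα
  have hακ : α * κ = 3 + 2 * c₆ := by rw [hα]; field_simp
  refine ⟨α, ε, w, c₁ + c₂ + c₃ + c₄ + (c₅ + 1) + 2 * c₇ + α * (c * c₀) + 1, by positivity, hw,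
    by positivity, hlow, fun ω η ψ z => ?_⟩
  have e1 := dotProduct_self_nonneg' η
  have e2 := dotProduct_self_nonneg' ψ
  have e3 := dotProduct_self_nonneg' z
  have d1 := (abs_le.1 (h₁ ω ψ)).2
  have d2 := (abs_le.1 (h₂ ω η)).2
  have d3 := (abs_le.1 (h₃ ω z)).2
  have d4 := (abs_le.1 (h₄ ω ψ)).2
  have d5 := (abs_le.1 (h₅ ω ω)).1
  have d6 := (abs_le.1 (h₆ z ψ)).2
  have d7 := (abs_le.1 (h₇ z ω)).1
  have d8 := hP.decay z
  have d9 := mul_le_mul_of_nonneg_left (hpow η ψ (δᵀ *ᵥ ω)) (show 0 ≤ α by positivity)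
  have d10 := mul_le_mul_of_nonneg_left (h₀ ω) (mul_nonneg (show 0 ≤ α by positivity) hc)
  have d11 : α * -(κ * (ψ ⬝ᵥ ψ + η ⬝ᵥ η)) = -((3 + 2 * c₆) * (ψ ⬝ᵥ ψ + η ⬝ᵥ η)) := by
    rw [← hακ]; ring
  have d12 := mul_nonneg hc₆ e1
  simp only [← mulVec_mulVec] at d1 d2 d3 d4 d5 d6 d7
  rw [mul_add, d11] at d9
  generalize α * modalPower C K ε η ψ (ψ - δᵀ *ᵥ ω) (-(C *ᵥ (ψ - δᵀ *ᵥ ω) + K *ᵥ η)) = X at *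
  simp only [mulVec_add, mulVec_sub, dotProduct_add, dotProduct_sub]
  linarith

end LyapunovFunction

/-! Algebra of the error system -/

section ErrorAlgebra

theorem crossMat_mulVec_sq_le (w y : Fin 3 → ℝ) :
    (crossMat w *ᵥ y) ⬝ᵥ (crossMat w *ᵥ y) ≤ (w ⬝ᵥ w) * (y ⬝ᵥ y) := by
  simp [crossMat, mulVec, dotProduct, Fin.sum_univ_three]
  nlinarith [sq_nonneg (w 0 * y 0 + w 1 * y 1 + w 2 * y 2)]

/-- The symmetric matrix whose entries are listed by `c` in the order of `inertiaVec`. -/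
def inertiaMat (c : Fin 6 → ℝ) : Matrix (Fin 3) (Fin 3) ℝ :=
  !![c 0, c 5, c 4; c 5, c 1, c 3; c 4, c 3, c 2]

theorem inertiaL_mulVec (c : Fin 6 → ℝ) (w : Fin 3 → ℝ) :
    inertiaL w *ᵥ c = inertiaMat c *ᵥ w := by
  ext i
  fin_cases i <;>
    simp [inertiaL, inertiaMat, mulVec, dotProduct, Fin.sum_univ_succ] <;> ring

theorem inertiaMat_inertiaVec {J : Matrix (Fin 3) (Fin 3) ℝ} (hJ : Jᵀ = J) :
    inertiaMat (inertiaVec J) = J := by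
  have h : ∀ i j, J i j = J j i := fun i j => congrFun (congrFun hJ j) i
  ext i j
  fin_cases i <;> fin_cases j <;> simp [inertiaMat, inertiaVec, h 1 0, h 2 0, h 2 1]

variable {r : Fin 3 → ℕ} {nμ ℓ : ℕ} (D : DesignData r nμ ℓ)

theorem inertia_mulVec {J : Matrix (Fin 3) (Fin 3) ℝ} (hJ : Jᵀ = J) {μ : Fin nμ → ℝ}
    (h : inertiaVec J = D.Lbar₁ *ᵥ μ + D.Lbar₀) (w : Fin 3 → ℝ) :
    J *ᵥ w = D.L₁ w *ᵥ μ + D.L₀ w := by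
  rw [DesignData.L₁, DesignData.L₀, ← mulVec_mulVec, ← mulVec_add, ← h, inertiaL_mulVec,
    inertiaMat_inertiaVec hJ]

theorem blockMul_mulVec {p q m : Type*} [Fintype q] [Fintype m] (E : Fin ℓ → Matrix p q ℝ)
    (X : Matrix q m ℝ) (Ω : Fin ℓ → ℝ) (μ : m → ℝ) :
    blockMul E X *ᵥ (fun ja => Ω ja.1 * μ ja.2) = (∑ j, Ω j • E j) *ᵥ (X *ᵥ μ) := by
  ext i
  rw [sum_mulVec, Finset.sum_apply]
  simp only [mulVec, dotProduct, blockMul, Matrix.of_apply, Fintype.sum_prod_type]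
  refine Finset.sum_congr rfl fun j _ => ?_
  have : ∀ c : m, (E j * X) i c * (Ω j * μ c) = Ω j * ((E j * X) i c * μ c) := fun c => by ring
  simp only [this, ← Finset.mul_sum]
  have h := congrFun (mulVec_mulVec μ (E j) X) i
  have h2 := congrFun (smul_mulVec (Ω j) (E j) (X *ᵥ μ)) i
  simp only [mulVec, dotProduct, Pi.smul_apply, smul_eq_mul] at h h2
  rw [h2, h]

theorem blockMulVec_mulVec {p q : Type*} [Fintype q] (E : Fin ℓ → Matrix p q ℝ)
    (x : q → ℝ) (Ω : Fin ℓ → ℝ) :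
    blockMulVec E x *ᵥ Ω = (∑ j, Ω j • E j) *ᵥ x := by
  ext i
  rw [sum_mulVec, Finset.sum_apply]
  simp only [mulVec, blockMulVec, Matrix.of_apply]
  refine Finset.sum_congr rfl fun j _ => ?_
  have h2 := congrFun (smul_mulVec (Ω j) (E j) x) i
  simp only [mulVec, Pi.smul_apply, smul_eq_mul] at h2
  rw [h2, mul_comm]

/-- This explains the entry Ω ⊗ μ: it linearizes the product of the unknown matrix ΣΩ_jE^j with the
unknown μ. The subtracted E₀ part is known and is restored by the control law. -/
theorem rho_mulVec_trueParam (w : Fin 3 → ℝ) (ζ : Matrix (Blk r) (Fin nμ) ℝ) (v : Blk r → ℝ)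
    (μ : Fin nμ → ℝ) (Ω : Fin ℓ → ℝ) :
    D.rho w ζ v *ᵥ trueParam μ Ω = D.F₁ w *ᵥ μ
      + (D.E₀ + ∑ j, Ω j • D.E j) *ᵥ
        (D.bN *ᵥ (D.L₁ w *ᵥ μ + D.L₀ w) + ζ *ᵥ μ - v)
      - D.E₀ *ᵥ (D.bN *ᵥ D.L₀ w - v) := by
  rw [DesignData.rho, trueParam, fromCols_mulVec_sumElim, fromCols_mulVec_sumElim,
    blockMul_mulVec, blockMulVec_mulVec]
  simp only [add_mulVec, mulVec_add, mulVec_sub, ← mulVec_mulVec]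
  abel

theorem torque_eq {n : ℕ} (δ : Matrix (Fin 3) (Fin n) ℝ) (C : Matrix (Fin n) (Fin n) ℝ)
    (k₁ k₂ : ℝ) (qe w : Fin 3 → ℝ) (v : Blk r → ℝ) (R : ParIdx nμ ℓ → ℝ)
    (ζ : Matrix (Blk r) (Fin nμ) ℝ) :
    torque D δ C k₁ k₂ qe w v R ζ = -(k₁ • qe) - k₂ • w - D.rho w ζ v *ᵥ R
      - D.E₀ *ᵥ (D.bN *ᵥ D.L₀ w) + δ *ᵥ (C *ᵥ (δᵀ *ᵥ w)) + D.E₀ *ᵥ v - D.F₀ w := by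
  rw [torque]
  simp only [← mulVec_mulVec]

theorem crossMat_mulVec_inertia {J : Matrix (Fin 3) (Fin 3) ℝ} {μ : Fin nμ → ℝ}
    {w : Fin 3 → ℝ} (hJ : J *ᵥ w = D.L₁ w *ᵥ μ + D.L₀ w) :
    crossMat w *ᵥ (J *ᵥ w) = -(D.F₁ w *ᵥ μ + D.F₀ w) := by
  rw [hJ, DesignData.F₁, DesignData.F₀, neg_mulVec, ← mulVec_mulVec, mulVec_add]
  abel

variable {n : ℕ} {J : Matrix (Fin 3) (Fin 3) ℝ} {δ : Matrix (Fin 3) (Fin n) ℝ}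
  {C K : Matrix (Fin n) (Fin n) ℝ} {μ : Fin nμ → ℝ} {k₁ k₂ : ℝ} {qe w w' d : Fin 3 → ℝ}
  {η ηd ηdd : Fin n → ℝ} {v θ : Blk r → ℝ} {R : ParIdx nμ ℓ → ℝ}
  {ζ : Matrix (Blk r) (Fin nμ) ℝ}

/-- Eliminating η'' produces the reduced inertia J - δδᵀ. The feedforward δCδᵀω completes η' to the
modal momentum, and the true-parameter regressor cancels the gyroscopic term and expresses d through
z. -/
theorem body_error_dynamics {Ω : Fin ℓ → ℝ} (hJ : J *ᵥ w = D.L₁ w *ᵥ μ + D.L₀ w)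
    (h₁ : J *ᵥ w' + crossMat w *ᵥ (J *ᵥ w) + δ *ᵥ ηdd = torque D δ C k₁ k₂ qe w v R ζ + d)
    (h₂ : ηdd + C *ᵥ ηd + K *ᵥ η = -(δᵀ *ᵥ w'))
    (hd : (D.E₀ + ∑ j, Ω j • D.E j) *ᵥ θ = d) :
    (J - δ * δᵀ) *ᵥ w' = δ *ᵥ (C *ᵥ (ηd + δᵀ *ᵥ w) + K *ᵥ η) - k₁ • qe - k₂ • w
      - D.rho w ζ v *ᵥ (R - trueParam μ Ω)
      + (D.E₀ + ∑ j, Ω j • D.E j) *ᵥ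
        ((v + θ - D.bN *ᵥ (J *ᵥ w + δ *ᵥ ηd) - ζ *ᵥ μ) + D.bN *ᵥ (δ *ᵥ ηd)) := by
  have h₂' : ηdd = -(δᵀ *ᵥ w') - C *ᵥ ηd - K *ᵥ η := by
    rw [← h₂]; abel
  rw [crossMat_mulVec_inertia D hJ, torque_eq, h₂'] at h₁
  rw [mulVec_sub (D.rho w ζ v), rho_mulVec_trueParam, hJ]
  generalize D.E₀ + ∑ j, Ω j • D.E j = Γ at *
  rw [← hd] at h₁
  simp only [sub_mulVec, ← mulVec_mulVec, mulVec_add, mulVec_sub, mulVec_neg] at h₁ ⊢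
  linear_combination (norm := module) h₁

/-- Subtracting N times the momentum cancels u and d; the filter ζ cancels the μ-dependent terms
this introduces. Everything left factors through M. -/
theorem model_error_dynamics (hJ : J *ᵥ w = D.L₁ w *ᵥ μ + D.L₀ w) {u : Fin 3 → ℝ}
    (h₁ : J *ᵥ w' + crossMat w *ᵥ (J *ᵥ w) + δ *ᵥ ηdd = u + d) :
    (D.bM *ᵥ v + D.bN *ᵥ u + D.bN *ᵥ D.F₀ w - D.bM *ᵥ (D.bN *ᵥ D.L₀ w))
        + (D.bM *ᵥ θ + D.bN *ᵥ d) - D.bN *ᵥ (J *ᵥ w' + δ *ᵥ ηdd)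
        - (D.bM * ζ + (D.bM * D.bN * D.L₁ w - D.bN * D.F₁ w)) *ᵥ μ
      = D.bM *ᵥ ((v + θ - D.bN *ᵥ (J *ᵥ w + δ *ᵥ ηd) - ζ *ᵥ μ) + D.bN *ᵥ (δ *ᵥ ηd)) := by
  have h₃ := congrArg (D.bN *ᵥ ·) h₁
  rw [crossMat_mulVec_inertia D hJ] at h₃
  rw [hJ]
  simp only [add_mulVec, sub_mulVec, ← mulVec_mulVec, mulVec_add, mulVec_sub, mulVec_neg] at h₃ ⊢
  linear_combination (norm := module) -h₃

/-- Makes 1 - ⟨q_d,q⟩ a potential for the proportional torque -k₁q_ev. -/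
theorem quatErr_deriv (qdv : Fin 3 → ℝ) (qd4 : ℝ) (qv w : Fin 3 → ℝ) (q4 : ℝ) :
    qd4 * (1 / 2 * (-(qv ⬝ᵥ w)))
      + qdv ⬝ᵥ ((1 / 2 : ℝ) • ((crossMat qv + q4 • (1 : Matrix (Fin 3) (Fin 3) ℝ)) *ᵥ w))
      = -(1 / 2) * (quatErrVec qdv qd4 qv q4 ⬝ᵥ w) := by
  simp [quatErrVec, crossMat, mulVec, dotProduct, Fin.sum_univ_three, Matrix.one_apply, vecHead,
    vecTail]
  ring

theorem quat_norm_deriv (qv w : Fin 3 → ℝ) (q4 : ℝ) :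
    qv ⬝ᵥ ((1 / 2 : ℝ) • ((crossMat qv + q4 • (1 : Matrix (Fin 3) (Fin 3) ℝ)) *ᵥ w))
      + q4 * (1 / 2 * (-(qv ⬝ᵥ w))) = 0 := by
  simp [crossMat, mulVec, dotProduct, Fin.sum_univ_three, Matrix.one_apply]
  ring

/-- The input of the dynamic compensator is dominated by the angular velocity. -/
theorem exists_compensator_input_le (B : ℝ) (a : Fin nμ) :
    ∃ c : ℝ, 0 ≤ c ∧ ∀ w : Fin 3 → ℝ, w ⬝ᵥ w ≤ B →
      (fun p => (D.bM * D.bN * D.L₁ w - D.bN * D.F₁ w) p a) ⬝ᵥ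
        (fun p => (D.bM * D.bN * D.L₁ w - D.bN * D.F₁ w) p a) ≤ c * (w ⬝ᵥ w) := by
  set S := inertiaMat (fun i => D.Lbar₁ i a) with hS
  have hcol : ∀ w, D.L₁ w *ᵥ Pi.single a 1 = S *ᵥ w := by
    intro w
    rw [DesignData.L₁, ← mulVec_mulVec, mulVec_single_one, inertiaL_mulVec]
    rfl
  -- Each column of the input is a linear plus a quadratic term in w; on a bounded set of w the
  -- quadratic one is also dominated by |w|.
  have hb : ∀ w, (fun p => (D.bM * D.bN * D.L₁ w - D.bN * D.F₁ w) p a)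
      = (D.bM * D.bN * S) *ᵥ w + D.bN *ᵥ (crossMat w *ᵥ (S *ᵥ w)) := by
    intro w
    have : (fun p => (D.bM * D.bN * D.L₁ w - D.bN * D.F₁ w) p a)
        = (D.bM * D.bN * D.L₁ w - D.bN * D.F₁ w) *ᵥ Pi.single a 1 := by
      rw [mulVec_single_one]
      rfl
    rw [this, sub_mulVec, DesignData.F₁]
    simp only [← mulVec_mulVec, neg_mulVec, mulVec_neg, sub_neg_eq_add, hcol]
  obtain ⟨c₁, hc₁, h₁⟩ := mulVec_dotProduct_self_le (D.bM * D.bN * S)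
  obtain ⟨c₂, hc₂, h₂⟩ := mulVec_dotProduct_self_le D.bN
  obtain ⟨c₃, hc₃, h₃⟩ := mulVec_dotProduct_self_le S
  refine ⟨2 * c₁ + 2 * (c₂ * (|B| * c₃)), by positivity, fun w hw => ?_⟩
  rw [hb]
  have hsq : ∀ x y : Blk r → ℝ, (x + y) ⬝ᵥ (x + y) ≤ 2 * (x ⬝ᵥ x) + 2 * (y ⬝ᵥ y) := by
    intro x y
    have := dotProduct_self_nonneg' (x - y)
    simp only [add_dotProduct, dotProduct_add, sub_dotProduct, dotProduct_sub] at this ⊢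
    linarith
  refine (hsq _ _).trans ?_
  have e0 := dotProduct_self_nonneg' w
  have e1 := h₁ w
  have e2 := h₂ (crossMat w *ᵥ (S *ᵥ w))
  have e3 := mul_le_mul_of_nonneg_left (crossMat_mulVec_sq_le w (S *ᵥ w)) hc₂
  have e4 : (w ⬝ᵥ w) * ((S *ᵥ w) ⬝ᵥ (S *ᵥ w)) ≤ |B| * (c₃ * (w ⬝ᵥ w)) :=
    mul_le_mul (hw.trans (le_abs_self B)) (h₃ w) (dotProduct_self_nonneg' _) (abs_nonneg B)
  have e5 := mul_le_mul_of_nonneg_left e4 hc₂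
  linarith

end ErrorAlgebra

/-! Stability of the closed loop -/

section Stability

variable {n : ℕ} {r : Fin 3 → ℕ} {nμ ℓ : ℕ} {D : DesignData r nμ ℓ}
  {J : Matrix (Fin 3) (Fin 3) ℝ} {δ : Matrix (Fin 3) (Fin n) ℝ}
  {C K : Matrix (Fin n) (Fin n) ℝ} {d : ℝ → Fin 3 → ℝ} {qdv : Fin 3 → ℝ} {qd4 : ℝ}
  {k₁ k₂ k : ℝ} {x : Signals n r nμ ℓ} {μ : Fin nμ → ℝ} {Ω : Fin ℓ → ℝ} {θ : ℝ → Blk r → ℝ}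

theorem IsClosedLoopSolution.unit_quaternion
    (hx : IsClosedLoopSolution D J δ C K d qdv qd4 k₁ k₂ k x) {t : ℝ} (ht : 0 ≤ t) :
    x.qv t ⬝ᵥ x.qv t + x.q4 t ^ 2 = 1 := by
  have hd : ∀ t, 0 ≤ t → HasDerivWithinAt (fun t => x.qv t ⬝ᵥ x.qv t + x.q4 t ^ 2) 0
      (Set.Ici 0) t := by
    intro t ht
    refine (((hx.qv_deriv t ht).dotProduct (hx.qv_deriv t ht)).fun_add
      ((hx.q4_deriv t ht).fun_pow 2)).congr_deriv ?_
    have := quat_norm_deriv (x.qv t) (x.ω t) (x.q4 t)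
    rw [dotProduct_comm ((1 / 2 : ℝ) • _) (x.qv t)]
    push_cast
    linear_combination 2 * this
  have := abs_sub_sub_le hd (c := 0) (C := 0) (h := t) le_rfl ht (fun _ _ => by simp)
  simp only [zero_add, zero_mul, sub_zero, abs_nonpos_iff] at this
  linarith [hx.unit_init]

/-- The deviation of the internal model state from its steady state. -/
noncomputable def modelError (D : DesignData r nμ ℓ) (J : Matrix (Fin 3) (Fin 3) ℝ)
    (δ : Matrix (Fin 3) (Fin n) ℝ) (μ : Fin nμ → ℝ) (θ : ℝ → Blk r → ℝ) (x : Signals n r nμ ℓ)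
    (t : ℝ) : Blk r → ℝ :=
  x.v t + θ t - D.bN *ᵥ (J *ᵥ x.ω t + δ *ᵥ x.ηd t) - x.ζ t *ᵥ μ

/-- The modal momentum `η' + δᵀ ω`. -/
noncomputable def modalMomentum (δ : Matrix (Fin 3) (Fin n) ℝ) (x : Signals n r nμ ℓ) (t : ℝ) :
    Fin n → ℝ :=
  x.ηd t + δᵀ *ᵥ x.ω t

/-- The attitude and adaptive cross terms cancel exactly, since q_ev and ρᵀω are the gradients
paired with ω. The dissipation therefore controls neither q_ev nor the parameter error; V only keeps
the latter bounded. -/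
theorem IsClosedLoopSolution.exists_energy
    (hx : IsClosedLoopSolution D J δ C K d qdv qd4 k₁ k₂ k x)
    {P : Matrix (Blk r) (Blk r) ℝ} (hP : IsLyapunov D.bM P) (hC : Cᵀ = C) (hK : Kᵀ = K)
    (hJm : (J - δ * δᵀ).PosDef) (hJ : ∀ w, J *ᵥ w = D.L₁ w *ᵥ μ + D.L₀ w)
    (hk₁ : 0 < k₁) (hk : 0 < k)
    (hθ : ∀ t, HasDerivAt θ (D.bM *ᵥ θ t + D.bN *ᵥ d t) t)
    (hd : ∀ t, (D.E₀ + ∑ j, Ω j • D.E j) *ᵥ θ t = d t)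
    (hqd : qdv ⬝ᵥ qdv + qd4 ^ 2 = 1)
    {α ε w κ : ℝ} (hα : 0 < α) (hw : 0 < w) (hκ : κ ≤ k₂)
    (hlow : ∀ η ψ, w * (ψ ⬝ᵥ ψ + η ⬝ᵥ η) ≤ modalEnergy C K ε η ψ)
    (hgain : ∀ ω η ψ z, ω ⬝ᵥ (δ *ᵥ (C *ᵥ ψ + K *ᵥ η))
          + ω ⬝ᵥ ((D.E₀ + ∑ j, Ω j • D.E j) *ᵥ (z + D.bN *ᵥ (δ *ᵥ (ψ - δᵀ *ᵥ ω))))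
          + 2 * (z ⬝ᵥ P *ᵥ (D.bM *ᵥ (z + D.bN *ᵥ (δ *ᵥ (ψ - δᵀ *ᵥ ω)))))
          + α * modalPower C K ε η ψ (ψ - δᵀ *ᵥ ω) (-(C *ᵥ (ψ - δᵀ *ᵥ ω) + K *ᵥ η))
        ≤ -(1 / 4 * (z ⬝ᵥ z + ψ ⬝ᵥ ψ + η ⬝ᵥ η)) + (κ - 1) * (ω ⬝ᵥ ω)) :
    ∃ (V V' : ℝ → ℝ) (c : ℝ), 0 < c ∧
      (∀ t, 0 ≤ t → HasDerivWithinAt V (V' t) (Set.Ici 0) t) ∧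
      (∀ t, 0 ≤ t → V' t ≤ -(1 / 4 * (modelError D J δ μ θ x t ⬝ᵥ modelError D J δ μ θ x t
        + modalMomentum δ x t ⬝ᵥ modalMomentum δ x t + x.η t ⬝ᵥ x.η t) + x.ω t ⬝ᵥ x.ω t)) ∧
      (∀ t, 0 ≤ t → c * (x.ω t ⬝ᵥ x.ω t
        + (x.Rhat t - trueParam μ Ω) ⬝ᵥ (x.Rhat t - trueParam μ Ω)
        + modelError D J δ μ θ x t ⬝ᵥ modelError D J δ μ θ x t
        + modalMomentum δ x t ⬝ᵥ modalMomentum δ x t + x.η t ⬝ᵥ x.η t) ≤ V t) := by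
  choose! ω' η'' hω hη' hdyn hmod using hx.dynamics
  obtain ⟨p₀, hp₀, hPl⟩ := hP.lower
  obtain ⟨j₀, hj₀, hjl⟩ := hJm.exists_lower_bound
  set z := modelError D J δ μ θ x with hz
  set ψ := modalMomentum δ x with hψ
  set qe := fun t => quatErrVec qdv qd4 (x.qv t) (x.q4 t) with hqe
  set e := fun t => x.Rhat t - trueParam μ Ω with he
  have hzd : ∀ t, 0 ≤ t → HasDerivWithinAt z
      (D.bM *ᵥ (z t + D.bN *ᵥ (δ *ᵥ x.ηd t))) (Set.Ici 0) t := by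
    intro t ht
    refine ((((hx.v_deriv t ht).fun_add (hθ t).hasDerivWithinAt).fun_sub
      ((((hω t ht).mulVec_const J).fun_add ((hη' t ht).mulVec_const δ)).mulVec_const D.bN)).fun_sub
      (HasDerivWithinAt.matrix_mulVec μ (hx.ζ_deriv t ht))).congr_deriv ?_
    exact model_error_dynamics D (hJ _) (hdyn t ht)
  have hψd : ∀ t, 0 ≤ t → HasDerivWithinAt ψ (-(C *ᵥ x.ηd t + K *ᵥ x.η t)) (Set.Ici 0) t := by
    intro t ht
    refine ((hη' t ht).fun_add ((hω t ht).mulVec_const δᵀ)).congr_deriv ?_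
    have := hmod t ht
    linear_combination (norm := module) this
  have hψη : ∀ t, x.ηd t = ψ t - δᵀ *ᵥ x.ω t := fun t => by
    rw [hψ, modalMomentum, add_sub_cancel_right]
  have hed : ∀ t, 0 ≤ t → HasDerivWithinAt e
      (k • ((D.rho (x.ω t) (x.ζ t) (x.v t))ᵀ *ᵥ x.ω t)) (Set.Ici 0) t := fun t ht =>
    (hx.Rhat_deriv t ht).sub_const _
  have hqed : ∀ t, 0 ≤ t → HasDerivWithinAt (fun t => 1 - (qd4 * x.q4 t + qdv ⬝ᵥ x.qv t))
      (1 / 2 * (qe t ⬝ᵥ x.ω t)) (Set.Ici 0) t := by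
    intro t ht
    refine ((((hx.q4_deriv t ht).const_mul qd4).fun_add
      ((hasDerivWithinAt_const t _ qdv).dotProduct (hx.qv_deriv t ht))).const_sub 1).congr_deriv ?_
    rw [zero_dotProduct, zero_add, quatErr_deriv]
    ring
  refine ⟨fun t => 1 / 2 * (x.ω t ⬝ᵥ (J - δ * δᵀ) *ᵥ x.ω t)
      + 2 * k₁ * (1 - (qd4 * x.q4 t + qdv ⬝ᵥ x.qv t)) + 1 / (2 * k) * (e t ⬝ᵥ e t)
      + z t ⬝ᵥ P *ᵥ z t + α * modalEnergy C K ε (x.η t) (ψ t), fun t =>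
      1 / 2 * (2 * (x.ω t ⬝ᵥ (J - δ * δᵀ) *ᵥ ω' t)) + 2 * k₁ * (1 / 2 * (qe t ⬝ᵥ x.ω t))
      + 1 / (2 * k) * ((k • ((D.rho (x.ω t) (x.ζ t) (x.v t))ᵀ *ᵥ x.ω t)) ⬝ᵥ e t
        + e t ⬝ᵥ (k • ((D.rho (x.ω t) (x.ζ t) (x.v t))ᵀ *ᵥ x.ω t)))
      + 2 * (z t ⬝ᵥ P *ᵥ (D.bM *ᵥ (z t + D.bN *ᵥ (δ *ᵥ x.ηd t))))
      + α * modalPower C K ε (x.η t) (ψ t) (x.ηd t) (-(C *ᵥ x.ηd t + K *ᵥ x.η t)),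
    min (min (j₀ / 2) (1 / (2 * k))) (min p₀ (α * w)), by positivity, fun t ht => ?_,
    fun t ht => ?_, fun t ht => ?_⟩
  · exact (((((hω t ht).quadratic hJm.transpose_eq).const_mul _).add
      ((hqed t ht).const_mul _)).add (((hed t ht).dotProduct (hed t ht)).const_mul _)).add
      ((hzd t ht).quadratic hP.symm) |>.add
      ((hasDerivWithinAt_modalEnergy hC hK ε (hx.η_deriv t ht) (hψd t ht)).const_mul α)
  · have hg := hgain (x.ω t) (x.η t) (ψ t) (z t)
    rw [← hψη] at hg
    have hbd : (J - δ * δᵀ) *ᵥ ω' t = δ *ᵥ (C *ᵥ ψ t + K *ᵥ x.η t) - k₁ • qe t - k₂ • x.ω t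
        - D.rho (x.ω t) (x.ζ t) (x.v t) *ᵥ e t
        + (D.E₀ + ∑ j, Ω j • D.E j) *ᵥ (z t + D.bN *ᵥ (δ *ᵥ x.ηd t)) :=
      body_error_dynamics D (hJ _) (hdyn t ht) (hmod t ht) (hd t)
    have hb := congrArg (x.ω t ⬝ᵥ ·) hbd
    have hκω := mul_le_mul_of_nonneg_right hκ (dotProduct_self_nonneg' (x.ω t))
    have hρ : ((D.rho (x.ω t) (x.ζ t) (x.v t))ᵀ *ᵥ x.ω t) ⬝ᵥ e t
        = x.ω t ⬝ᵥ D.rho (x.ω t) (x.ζ t) (x.v t) *ᵥ e t := by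
      rw [mulVec_transpose, ← dotProduct_mulVec]
    simp only [dotProduct_add, dotProduct_sub, dotProduct_smul, smul_eq_mul] at hb
    beta_reduce
    rw [dotProduct_smul, smul_dotProduct, dotProduct_comm (e t), hρ, hb,
      dotProduct_comm (qe t)]
    have hcancel : 1 / (2 * k) * (k • (x.ω t ⬝ᵥ D.rho (x.ω t) (x.ζ t) (x.v t) *ᵥ e t)
        + k • (x.ω t ⬝ᵥ D.rho (x.ω t) (x.ζ t) (x.v t) *ᵥ e t))
        = x.ω t ⬝ᵥ D.rho (x.ω t) (x.ζ t) (x.v t) *ᵥ e t := by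
      rw [smul_eq_mul]
      field_simp
      ring
    rw [hcancel]
    linarith
  · have hq := hx.unit_quaternion ht
    -- Cauchy–Schwarz for two unit quaternions makes the attitude potential nonnegative.
    have h1 : qd4 * x.q4 t + qdv ⬝ᵥ x.qv t ≤ 1 := by
      have h2 := (abs_le.1 (abs_dotProduct_le qdv (x.qv t) (show (0 : ℝ) < 1 / 2 by norm_num))).2
      norm_num at h2
      nlinarith [sq_nonneg (qd4 - x.q4 t)]
    have h2 := mul_nonneg hk₁.le (sub_nonneg.2 h1)
    have h3 := hjl (x.ω t)
    have h4 := hPl (z t)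
    have h5 := mul_le_mul_of_nonneg_left (hlow (x.η t) (ψ t)) hα.le
    set c := min (min (j₀ / 2) (1 / (2 * k))) (min p₀ (α * w)) with hc
    have c1 : c ≤ j₀ / 2 := (min_le_left _ _).trans (min_le_left _ _)
    have c2 : c ≤ 1 / (2 * k) := (min_le_left _ _).trans (min_le_right _ _)
    have c3 : c ≤ p₀ := (min_le_right _ _).trans (min_le_left _ _)
    have c4 : c ≤ α * w := (min_le_right _ _).trans (min_le_right _ _)
    have d1 := mul_le_mul_of_nonneg_right c1 (dotProduct_self_nonneg' (x.ω t))
    have d2 := mul_le_mul_of_nonneg_right c2 (dotProduct_self_nonneg' (e t))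
    have d3 := mul_le_mul_of_nonneg_right c3 (dotProduct_self_nonneg' (z t))
    have d4 := mul_le_mul_of_nonneg_right c4 (dotProduct_self_nonneg' (ψ t))
    have d5 := mul_le_mul_of_nonneg_right c4 (dotProduct_self_nonneg' (x.η t))
    linarith

end Stability

/-! ### Boundedness and regulation of the closed-loop signals -/

section Regulation

variable {n : ℕ} {r : Fin 3 → ℕ} {nμ ℓ : ℕ} {D : DesignData r nμ ℓ}
  {J : Matrix (Fin 3) (Fin 3) ℝ} {δ : Matrix (Fin 3) (Fin n) ℝ}
  {C K : Matrix (Fin n) (Fin n) ℝ} {d : ℝ → Fin 3 → ℝ} {qdv : Fin 3 → ℝ} {qd4 : ℝ}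
  {k₁ k₂ k : ℝ} {x : Signals n r nμ ℓ} {μ : Fin nμ → ℝ} {Ω : Fin ℓ → ℝ} {θ : ℝ → Blk r → ℝ}

/-- The generalized force acting on the body after elimination of the modal acceleration. -/
noncomputable def bodyForce (D : DesignData r nμ ℓ) (J : Matrix (Fin 3) (Fin 3) ℝ)
    (δ : Matrix (Fin 3) (Fin n) ℝ) (C K : Matrix (Fin n) (Fin n) ℝ) (d : ℝ → Fin 3 → ℝ)
    (qdv : Fin 3 → ℝ) (qd4 k₁ k₂ : ℝ) (x : Signals n r nμ ℓ) (t : ℝ) : Fin 3 → ℝ :=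
  torque D δ C k₁ k₂ (quatErrVec qdv qd4 (x.qv t) (x.q4 t)) (x.ω t) (x.v t) (x.Rhat t) (x.ζ t)
    + d t - crossMat (x.ω t) *ᵥ (J *ᵥ x.ω t) + δ *ᵥ (C *ᵥ x.ηd t + K *ᵥ x.η t)

theorem Matrix.PosDef.inv_mulVec_mulVec {m : Type*} [Fintype m] [DecidableEq m]
    {A : Matrix m m ℝ} (hA : A.PosDef) (y : m → ℝ) : A⁻¹ *ᵥ (A *ᵥ y) = y := by
  rw [mulVec_mulVec, Matrix.nonsing_inv_mul _ ((Matrix.isUnit_iff_isUnit_det _).1 hA.isUnit),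
    one_mulVec]

/-- Invertibility of J - δδᵀ turns the implicit dynamics into explicit formulas, so bounded signals
yield bounded accelerations. -/
theorem IsClosedLoopSolution.exists_accelerations
    (hx : IsClosedLoopSolution D J δ C K d qdv qd4 k₁ k₂ k x) (hJm : (J - δ * δᵀ).PosDef)
    {t : ℝ} (ht : 0 ≤ t) : ∃ (ω' : Fin 3 → ℝ) (η'' : Fin n → ℝ),
      ω' = (J - δ * δᵀ)⁻¹ *ᵥ bodyForce D J δ C K d qdv qd4 k₁ k₂ x t ∧
      η'' = -(C *ᵥ x.ηd t) - K *ᵥ x.η t - δᵀ *ᵥ ω' ∧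
      HasDerivWithinAt x.ω ω' (Set.Ici 0) t ∧ HasDerivWithinAt x.ηd η'' (Set.Ici 0) t ∧
      J *ᵥ ω' + crossMat (x.ω t) *ᵥ (J *ᵥ x.ω t) + δ *ᵥ η'' =
        torque D δ C k₁ k₂ (quatErrVec qdv qd4 (x.qv t) (x.q4 t)) (x.ω t) (x.v t) (x.Rhat t)
          (x.ζ t) + d t ∧
      η'' + C *ᵥ x.ηd t + K *ᵥ x.η t = -(δᵀ *ᵥ ω') := by
  obtain ⟨ω', η'', h1, h2, h3, h4⟩ := hx.dynamics t ht
  have h5 : η'' = -(C *ᵥ x.ηd t) - K *ᵥ x.η t - δᵀ *ᵥ ω' := by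
    linear_combination (norm := module) h4
  refine ⟨ω', η'', ?_, h5, h1, h2, h3, h4⟩
  rw [← hJm.inv_mulVec_mulVec ω']
  congr 1
  rw [h5] at h3
  rw [bodyForce, ← h3]
  simp only [sub_mulVec, mulVec_sub, mulVec_neg, mulVec_add, ← mulVec_mulVec]
  module

/-- Boundedness and convergence of the signals of the closed loop. -/
structure IsRegulated (D : DesignData r nμ ℓ) (J : Matrix (Fin 3) (Fin 3) ℝ)
    (δ : Matrix (Fin 3) (Fin n) ℝ) (μ : Fin nμ → ℝ) (θ : ℝ → Blk r → ℝ)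
    (x : Signals n r nμ ℓ) : Prop where
  qv_mem : VecIn boundedC1Fns x.qv
  q4_mem : x.q4 ∈ boundedC1Fns
  ω_mem : VecIn boundedC1Fns x.ω
  η_mem : VecIn boundedC1Fns x.η
  ηd_mem : VecIn boundedC1Fns x.ηd
  v_mem : VecIn boundedC1Fns x.v
  Rhat_mem : VecIn boundedC1Fns x.Rhat
  ζ_mem : MatIn boundedC1Fns x.ζ
  ω_tendsto : Tendsto x.ω atTop (𝓝 0)
  η_tendsto : Tendsto x.η atTop (𝓝 0)
  ηd_tendsto : Tendsto x.ηd atTop (𝓝 0)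
  ζ_tendsto : Tendsto x.ζ atTop (𝓝 0)
  modelError_tendsto : Tendsto (modelError D J δ μ θ x) atTop (𝓝 0)

theorem tendsto_mulVec_zero {p q : Type*} [Fintype q] (A : Matrix p q ℝ) {f : ℝ → q → ℝ}
    (hf : Tendsto f atTop (𝓝 0)) : Tendsto (fun t => A *ᵥ f t) atTop (𝓝 0) := by
  have h : Continuous fun y : q → ℝ => A *ᵥ y := by fun_prop
  simpa [Function.comp_def] using (h.tendsto 0).comp hf

theorem MatIn.bounded {p q : Type*} {f : ℝ → Matrix p q ℝ} (hf : MatIn boundedC1Fns f) :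
    MatIn boundedFns f := fun i j => (hf i j).1

/-- V bounds ω, the parameter error, z, the modal momentum and η. The state v is not among them: it
is recovered from z once ζ is known to be bounded, as a stable filter whose input is dominated by ω.
All derivatives are then bounded, and Barbalat's argument applies to the dissipated quantities. -/
theorem IsClosedLoopSolution.isRegulated
    (hx : IsClosedLoopSolution D J δ C K d qdv qd4 k₁ k₂ k x)
    {P : Matrix (Blk r) (Blk r) ℝ} (hP : IsLyapunov D.bM P)
    (hJm : (J - δ * δᵀ).PosDef) (hθb : VecIn boundedC1Fns θ) (hdb : VecIn boundedC1Fns d)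
    {V V' : ℝ → ℝ} {c : ℝ} (hc : 0 < c)
    (hV : ∀ t, 0 ≤ t → HasDerivWithinAt V (V' t) (Set.Ici 0) t)
    (hV' : ∀ t, 0 ≤ t →
      V' t ≤ -(1 / 4 * (modelError D J δ μ θ x t ⬝ᵥ modelError D J δ μ θ x t
        + modalMomentum δ x t ⬝ᵥ modalMomentum δ x t + x.η t ⬝ᵥ x.η t) + x.ω t ⬝ᵥ x.ω t))
    (hVc : ∀ t, 0 ≤ t → c * (x.ω t ⬝ᵥ x.ω t
        + (x.Rhat t - trueParam μ Ω) ⬝ᵥ (x.Rhat t - trueParam μ Ω)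
        + modelError D J δ μ θ x t ⬝ᵥ modelError D J δ μ θ x t
        + modalMomentum δ x t ⬝ᵥ modalMomentum δ x t + x.η t ⬝ᵥ x.η t) ≤ V t) :
    IsRegulated D J δ μ θ x := by
  set z := modelError D J δ μ θ x with hz
  set ψ := modalMomentum δ x with hψ
  have nω := fun t => dotProduct_self_nonneg' (x.ω t)
  have ne := fun t => dotProduct_self_nonneg' (x.Rhat t - trueParam μ Ω)
  have nz := fun t => dotProduct_self_nonneg' (z t)
  have nψ := fun t => dotProduct_self_nonneg' (ψ t)
  have nη := fun t => dotProduct_self_nonneg' (x.η t)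
  have hVanti : ∀ t, 0 ≤ t → V t ≤ V 0 := fun t ht =>
    antitoneOn_of_deriv_le hV (fun s hs => (hV' s hs).trans (by
      linarith [nω s, nz s, nψ s, nη s])) (Set.mem_Ici.2 le_rfl) ht ht
  have hsum : ∀ t, 0 ≤ t → x.ω t ⬝ᵥ x.ω t
        + (x.Rhat t - trueParam μ Ω) ⬝ᵥ (x.Rhat t - trueParam μ Ω)
        + z t ⬝ᵥ z t + ψ t ⬝ᵥ ψ t + x.η t ⬝ᵥ x.η t ≤ V 0 / c := fun t ht => by
    rw [le_div_iff₀ hc, mul_comm]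
    exact (hVc t ht).trans (hVanti t ht)
  have hV0 : ∀ t, 0 ≤ t → 0 ≤ V t := fun t ht => by
    refine le_trans (mul_nonneg hc.le ?_) (hVc t ht)
    linarith [nω t, ne t, nz t, nψ t, nη t]
  have bω : VecIn boundedFns x.ω := VecIn.of_dotProduct_self_le (B := V 0 / c) fun t ht => by
    linarith [hsum t ht, nω t, ne t, nz t, nψ t, nη t]
  have be : VecIn boundedFns fun t => x.Rhat t - trueParam μ Ω :=
    VecIn.of_dotProduct_self_le (B := V 0 / c) fun t ht => by
      linarith [hsum t ht, nω t, ne t, nz t, nψ t, nη t]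
  have bz : VecIn boundedFns z := VecIn.of_dotProduct_self_le (B := V 0 / c) fun t ht => by
    linarith [hsum t ht, nω t, ne t, nz t, nψ t, nη t]
  have bψ : VecIn boundedFns ψ := VecIn.of_dotProduct_self_le (B := V 0 / c) fun t ht => by
    linarith [hsum t ht, nω t, ne t, nz t, nψ t, nη t]
  have bη : VecIn boundedFns x.η := VecIn.of_dotProduct_self_le (B := V 0 / c) fun t ht => by
    linarith [hsum t ht, nω t, ne t, nz t, nψ t, nη t]
  have bR : VecIn boundedFns x.Rhat := by
    have := be.add (VecIn.const (trueParam μ Ω))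
    simpa only [sub_add_cancel] using this
  have bηd : VecIn boundedFns x.ηd := by
    have := bψ.sub (bω.mulVec δᵀ)
    simpa only [hψ, modalMomentum, add_sub_cancel_right] using this
  have bqv : VecIn boundedFns x.qv := VecIn.of_dotProduct_self_le (B := 1) fun t ht => by
    nlinarith [hx.unit_quaternion ht, sq_nonneg (x.q4 t)]
  have bq4 : x.q4 ∈ boundedFns := ⟨1, fun t ht => abs_le_one_iff_mul_self_le_one.2 (by
    nlinarith [hx.unit_quaternion ht, dotProduct_self_nonneg' (x.qv t)])⟩
  have hζcol : ∀ a, VecIn boundedC1Fns (fun t p => x.ζ t p a) ∧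
      Tendsto (fun t p => x.ζ t p a) atTop (𝓝 0) := by
    intro a
    obtain ⟨B, hB0, hB⟩ := exists_compensator_input_le D (V 0 / c) a
    refine hP.tendsto_zero_of_input (C := B)
      (b := fun t p => (D.bM * D.bN * D.L₁ (x.ω t) - D.bN * D.F₁ (x.ω t)) p a)
      (fun t ht => ?_) hV hV0 hV' hB0 (fun t ht => ?_) ?_
    · rw [hasDerivWithinAt_pi]
      exact fun p => hx.ζ_deriv t ht p a
    · refine (hB (x.ω t) (by linarith [hsum t ht, nω t, ne t, nz t, nψ t, nη t])).trans
        (mul_le_mul_of_nonneg_left ?_ hB0)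
      linarith [nz t, nψ t, nη t]
    · intro p
      exact (((MatIn.const _).mul (bω.L₁ D)).sub ((MatIn.const _).mul (bω.F₁ D))) p a
  have cζ : MatIn boundedC1Fns x.ζ := fun p a => (hζcol a).1 p
  have bζ := cζ.bounded
  have bv : VecIn boundedFns x.v := by
    have := ((bz.sub hθb.bounded).add (((bω.mulVec J).add (bηd.mulVec δ)).mulVec D.bN)).add
      (bζ.mulVec (VecIn.const μ))
    convert this using 2 with t
    rw [hz, modelError]
    abel
  have bqe := bqv.quatErrVec bq4 qdv qd4
  have bu := VecIn.torque D δ C k₁ k₂ bqe bω bv bR bζ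
  have bF : VecIn boundedFns (bodyForce D J δ C K d qdv qd4 k₁ k₂ x) :=
    ((bu.add hdb.bounded).sub (bω.crossMat.mulVec (bω.mulVec J))).add
      (((bηd.mulVec C).add (bη.mulVec K)).mulVec δ)
  have bω' := bF.mulVec (J - δ * δᵀ)⁻¹
  have cω : VecIn boundedC1Fns x.ω := bω.boundedC1 bω' fun t ht => by
    obtain ⟨ω', η'', h1, -, h2, -⟩ := hx.exists_accelerations hJm ht
    rwa [h1] at h2
  have cηd : VecIn boundedC1Fns x.ηd := bηd.boundedC1
    (((bηd.mulVec C).neg.sub (bη.mulVec K)).sub (bω'.mulVec δᵀ)) fun t ht => by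
      obtain ⟨ω', η'', h1, h2, -, h3, -⟩ := hx.exists_accelerations hJm ht
      rwa [h2, h1] at h3
  have cη : VecIn boundedC1Fns x.η := bη.boundedC1 bηd hx.η_deriv
  have cv : VecIn boundedC1Fns x.v := bv.boundedC1
    ((((bv.mulVec _).add (bu.mulVec _)).add ((bω.F₀ D).mulVec _)).sub
      (((bω.L₀ D).mulVec _).mulVec _)) hx.v_deriv
  have cR : VecIn boundedC1Fns x.Rhat := bR.boundedC1
    (((bω.rho D bζ bv).transpose.mulVec bω).const_smul k) hx.Rhat_deriv
  have cqv : VecIn boundedC1Fns x.qv := bqv.boundedC1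
    (((bqv.crossMat.add (MatIn.smul bq4 (MatIn.const _))).mulVec bω).const_smul (1 / 2))
    hx.qv_deriv
  have cq4 : x.q4 ∈ boundedC1Fns := ⟨bq4, _, mul_mem (const_mem _ (1 / 2))
    (neg_mem (bqv.dotProduct bω)), hx.q4_deriv⟩
  have cψ : VecIn boundedC1Fns ψ := cηd.add (cω.mulVec δᵀ)
  have cz : VecIn boundedC1Fns z := ((cv.add hθb).sub
    (((cω.mulVec J).add (cηd.mulVec δ)).mulVec _)).sub (cζ.mulVec (VecIn.const μ))
  have lim : ∀ {m : Type} [Fintype m] {f : ℝ → m → ℝ}, VecIn boundedC1Fns f →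
      (∀ t, 1 / 4 * (f t ⬝ᵥ f t) ≤ 1 / 4 * (z t ⬝ᵥ z t + ψ t ⬝ᵥ ψ t + x.η t ⬝ᵥ x.η t)
        + x.ω t ⬝ᵥ x.ω t) → Tendsto f atTop (𝓝 0) := by
    intro m _ f hf hle
    have := tendsto_zero_of_deriv_le_neg hV hV0
      (fun t ht => (hV' t ht).trans (neg_le_neg (hle t)))
      (fun t _ => by have := dotProduct_self_nonneg' (f t); positivity)
      (mul_mem (const_mem _ (1 / 4)) (hf.dotProduct hf))
    exact tendsto_zero_of_dotProduct_self (by simpa using this.const_mul 4)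
  have tω : Tendsto x.ω atTop (𝓝 0) := lim cω fun t => by linarith [nω t, nz t, nψ t, nη t]
  have tψ : Tendsto ψ atTop (𝓝 0) := lim cψ fun t => by linarith [nω t, nz t, nψ t, nη t]
  exact
    { qv_mem := cqv
      q4_mem := cq4
      ω_mem := cω
      η_mem := cη
      ηd_mem := cηd
      v_mem := cv
      Rhat_mem := cR
      ζ_mem := cζ
      ω_tendsto := tω
      η_tendsto := lim cη fun t => by linarith [nω t, nz t, nψ t, nη t]
      ηd_tendsto := by
        have := tψ.sub (tendsto_mulVec_zero δᵀ tω)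
        simpa only [hψ, modalMomentum, add_sub_cancel_right, sub_zero] using this
      ζ_tendsto := tendsto_pi_nhds.2 fun p => tendsto_pi_nhds.2 fun a =>
        tendsto_pi_nhds.1 (hζcol a).2 p
      modelError_tendsto := lim cz fun t => by linarith [nω t, nz t, nψ t, nη t] }

end Regulation

/-! Limits of the regressor -/

section Regressor

variable {r : Fin 3 → ℕ} {nμ ℓ : ℕ} (D : DesignData r nμ ℓ)

theorem continuous_crossMat : Continuous crossMat := by
  refine continuous_matrix fun i j => ?_
  fin_cases i <;> fin_cases j <;> simp [crossMat] <;> fun_prop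

theorem continuous_inertiaL : Continuous inertiaL := by
  refine continuous_matrix fun i j => ?_
  fin_cases i <;> fin_cases j <;> simp [inertiaL] <;> fun_prop

theorem continuous_rho : Continuous fun p : (Fin 3 → ℝ) × Matrix (Blk r) (Fin nμ) ℝ × (Blk r → ℝ) =>
    D.rho p.1 p.2.1 p.2.2 := by
  have h0 := continuous_crossMat
  have h1 := continuous_inertiaL
  refine continuous_matrix fun i j => ?_
  rcases j with j | j | j
  · have : Continuous fun p : (Fin 3 → ℝ) × Matrix (Blk r) (Fin nμ) ℝ × (Blk r → ℝ) =>
        D.F₁ p.1 + D.E₀ * (D.bN * D.L₁ p.1 + p.2.1) := by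
      unfold DesignData.F₁ DesignData.L₁
      fun_prop
    exact this.matrix_elem i j
  · have : Continuous fun p : (Fin 3 → ℝ) × Matrix (Blk r) (Fin nμ) ℝ × (Blk r → ℝ) =>
        D.E j.1 * (p.2.1 + D.bN * D.L₁ p.1) := by
      unfold DesignData.L₁
      fun_prop
    exact this.matrix_elem i j.2
  · have : Continuous fun p : (Fin 3 → ℝ) × Matrix (Blk r) (Fin nμ) ℝ × (Blk r → ℝ) =>
        D.E j *ᵥ (D.bN *ᵥ D.L₀ p.1 - p.2.2) := by
      unfold DesignData.L₀
      fun_prop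
    exact (continuous_apply i).comp this

theorem inertiaL_zero : inertiaL 0 = 0 := by
  ext i j
  fin_cases i <;> fin_cases j <;> simp [inertiaL]

theorem rho_zero : D.rho 0 0 0 = 0 := by
  ext i (j | j | j) <;>
    simp [DesignData.rho, DesignData.F₁, DesignData.L₁, DesignData.L₀, inertiaL_zero, blockMul,
      blockMulVec]

/-- Here y = ρ(0, A, Aμ - Tϱ), and ρ is a function of ω plus a linear function of (ζ, v). The
difference is thus ρ at arguments that tend to zero, where ρ vanishes. -/
theorem rho_sub_sigY (A₀ : Matrix (Blk r) (Fin nμ) ℝ) (μ : Fin nμ → ℝ)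
    (T : Matrix (Blk r) (Blk r) ℝ) (ϱ : ℝ → Blk r → ℝ) (t : ℝ) (w : Fin 3 → ℝ)
    (ζ : Matrix (Blk r) (Fin nμ) ℝ) (v : Blk r → ℝ) :
    D.rho w ζ v - D.sigY A₀ μ T ϱ t
      = D.rho w (ζ - D.sigA A₀ t) (v + T *ᵥ ϱ t - D.sigA A₀ t *ᵥ μ) := by
  ext i (j | j | j)
  · simp only [DesignData.rho, DesignData.sigY, Matrix.sub_apply, fromCols_apply_inl, Matrix.mul_add,
      Matrix.mul_sub, Matrix.add_apply]
    ring
  · simp only [DesignData.rho, DesignData.sigY, Matrix.sub_apply, fromCols_apply_inl, fromCols_apply_inr,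
      blockMul, of_apply, Matrix.mul_add, Matrix.mul_sub, Matrix.add_apply]
    ring
  · simp only [DesignData.rho, DesignData.sigY, Matrix.sub_apply, fromCols_apply_inr,
      blockMulVec, of_apply, mulVec_add, mulVec_sub, Pi.add_apply, Pi.sub_apply]
    ring

theorem sigA_tendsto {P : Matrix (Blk r) (Blk r) ℝ} (hP : IsLyapunov D.bM P)
    (A₀ : Matrix (Blk r) (Fin nμ) ℝ) :
    MatIn boundedC1Fns (D.sigA A₀) ∧ Tendsto (D.sigA A₀) atTop (𝓝 0) := by
  have hd : ∀ (t : ℝ) (p q : Blk r), HasDerivAt (fun s : ℝ => NormedSpace.exp (s • D.bM) p q)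
      ((D.bM * NormedSpace.exp (t • D.bM)) p q) t := by
    intro t p q
    let _ := Matrix.linftyOpNormedRing (n := Blk r) (α := ℝ)
    let _ := Matrix.linftyOpNormedAlgebra (n := Blk r) (R := ℝ) (α := ℝ)
    have h := hasDerivAt_exp_smul_const' (𝕂 := ℝ) D.bM t
    exact hasDerivAt_pi.1 (hasDerivAt_pi.1 h p) q
  have hcol : ∀ a, VecIn boundedC1Fns (fun t p => D.sigA A₀ t p a) ∧
      Tendsto (fun t p => D.sigA A₀ t p a) atTop (𝓝 0) := by
    intro a
    -- Each column of A solves x' = Mx, the unforced case of the filter estimate.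
    refine hP.tendsto_zero_of_input (C := 0) (b := fun _ => 0) (V := fun _ => 0)
      (V' := fun _ => 0) (g := fun _ => 0) (fun t _ => ?_) (fun t _ => hasDerivWithinAt_const _ _ _)
      (by simp) (by simp) le_rfl (by simp) (VecIn.const 0)
    rw [hasDerivWithinAt_pi]
    intro p
    have h1 : HasDerivAt (fun t => D.sigA A₀ t p a)
        (∑ q, (D.bM * NormedSpace.exp (t • D.bM)) p q * A₀ q a) t := by
      simp only [DesignData.sigA, Matrix.mul_apply (M := NormedSpace.exp _)]
      exact HasDerivAt.fun_sum fun q _ => (hd t p q).mul_const _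
    refine h1.hasDerivWithinAt.congr_deriv ?_
    rw [← Matrix.mul_apply, Matrix.mul_assoc, add_zero]
    rfl
  exact ⟨fun p a => (hcol a).1 p, tendsto_pi_nhds.2 fun p => tendsto_pi_nhds.2 fun a =>
    tendsto_pi_nhds.1 (hcol a).2 p⟩

theorem sigY_bounded {A₀ : Matrix (Blk r) (Fin nμ) ℝ} (hA : MatIn boundedC1Fns (D.sigA A₀))
    (μ : Fin nμ → ℝ) {T : Matrix (Blk r) (Blk r) ℝ} {ϱ : ℝ → Blk r → ℝ}
    (hϱ : VecIn boundedC1Fns ϱ) : MatIn boundedFns (D.sigY A₀ μ T ϱ) :=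
  MatIn.bounded (((MatIn.const D.E₀).mul hA).fromCols ((hA.blockMul D.E).fromCols
    (((hϱ.mulVec T).sub (hA.mulVec (VecIn.const μ))).blockMulVec D.E)))

theorem tendsto_mul_zero_of_bounded {f g : ℝ → ℝ} (hf : f ∈ boundedFns)
    (hg : Tendsto g atTop (𝓝 0)) : Tendsto (fun t => f t * g t) atTop (𝓝 0) := by
  obtain ⟨B, hB⟩ := hf
  have h : Tendsto (fun t => B * |g t|) atTop (𝓝 0) := by
    simpa using hg.abs.const_mul B
  refine squeeze_zero_norm' ?_ h
  filter_upwards [eventually_ge_atTop 0] with t ht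
  rw [Real.norm_eq_abs, abs_mul]
  exact mul_le_mul_of_nonneg_right (hB t ht) (abs_nonneg _)

theorem MatIn.tendsto_mulVec_zero {p q : Type*} [Fintype q] {f : ℝ → Matrix p q ℝ}
    {g : ℝ → q → ℝ} (hf : MatIn boundedFns f) (hg : Tendsto g atTop (𝓝 0)) :
    Tendsto (fun t => f t *ᵥ g t) atTop (𝓝 0) := by
  rw [tendsto_pi_nhds] at hg ⊢
  intro i
  have := tendsto_finsetSum Finset.univ fun j (_ : j ∈ Finset.univ) =>
    tendsto_mul_zero_of_bounded (hf i j) (hg j)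
  simp only [Finset.sum_const_zero] at this
  exact this

theorem VecIn.tendsto_mulVec_zero {p q : Type*} [Fintype q] {f : ℝ → Matrix p q ℝ}
    {g : ℝ → q → ℝ} (hf : Tendsto f atTop (𝓝 0)) (hg : VecIn boundedFns g) :
    Tendsto (fun t => f t *ᵥ g t) atTop (𝓝 0) := by
  rw [tendsto_pi_nhds]
  intro i
  have := tendsto_finsetSum Finset.univ fun j (_ : j ∈ Finset.univ) =>
    tendsto_mul_zero_of_bounded (hg j) (tendsto_pi_nhds.1 (tendsto_pi_nhds.1 hf i) j)
  simp only [Finset.sum_const_zero, mul_comm (g _ _)] at this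
  exact this

end Regressor

/-! ### Convergence of the regressor and of the attitude error -/

section Convergence

variable {n : ℕ} {r : Fin 3 → ℕ} {nμ ℓ : ℕ} {D : DesignData r nμ ℓ}
  {J : Matrix (Fin 3) (Fin 3) ℝ} {δ : Matrix (Fin 3) (Fin n) ℝ}
  {C K : Matrix (Fin n) (Fin n) ℝ} {d : ℝ → Fin 3 → ℝ} {qdv : Fin 3 → ℝ} {qd4 : ℝ}
  {k₁ k₂ k : ℝ} {x : Signals n r nμ ℓ} {μ : Fin nμ → ℝ} {Ω : Fin ℓ → ℝ} {θ : ℝ → Blk r → ℝ}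

/-- The proportional and the adaptive torque balance asymptotically. -/
theorem IsRegulated.tendsto_balance (h : IsRegulated D J δ μ θ x)
    (hx : IsClosedLoopSolution D J δ C K d qdv qd4 k₁ k₂ k x)
    (hJm : (J - δ * δᵀ).PosDef) (hJ : ∀ w, J *ᵥ w = D.L₁ w *ᵥ μ + D.L₀ w)
    (hd : ∀ t, (D.E₀ + ∑ j, Ω j • D.E j) *ᵥ θ t = d t) (hdb : VecIn boundedC1Fns d) :
    Tendsto (fun t => k₁ • quatErrVec qdv qd4 (x.qv t) (x.q4 t)
      + D.rho (x.ω t) (x.ζ t) (x.v t) *ᵥ (x.Rhat t - trueParam μ Ω)) atTop (𝓝 0) := by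
  have cqe := h.qv_mem.quatErrVec h.q4_mem qdv qd4
  have cF : VecIn boundedC1Fns (bodyForce D J δ C K d qdv qd4 k₁ k₂ x) :=
    (((VecIn.torque D δ C k₁ k₂ cqe h.ω_mem h.v_mem h.Rhat_mem h.ζ_mem).add hdb).sub
      (h.ω_mem.crossMat.mulVec (h.ω_mem.mulVec J))).add
      (((h.ηd_mem.mulVec C).add (h.η_mem.mulVec K)).mulVec δ)
  have hω : ∀ t, 0 ≤ t → HasDerivWithinAt x.ω
      ((J - δ * δᵀ)⁻¹ *ᵥ bodyForce D J δ C K d qdv qd4 k₁ k₂ x t) (Set.Ici 0) t := fun t ht => by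
    obtain ⟨ω', η'', h1, -, h2, -⟩ := hx.exists_accelerations hJm ht
    rwa [h1] at h2
  -- Since ω → 0 and its derivative itself has a bounded derivative, ω' → 0 as well; the balance is
  -- what then remains of the body equation.
  have hω' : Tendsto (fun t => (J - δ * δᵀ)⁻¹ *ᵥ bodyForce D J δ C K d qdv qd4 k₁ k₂ x t) atTop
      (𝓝 0) := tendsto_pi_nhds.2 fun i =>
    deriv_tendsto_zero (fun t ht => hasDerivWithinAt_pi.1 (hω t ht) i)
      (tendsto_pi_nhds.1 h.ω_tendsto i) (cF.mulVec _ i)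
  have hF := tendsto_mulVec_zero (J - δ * δᵀ) hω'
  have h1 : Tendsto (fun t => δ *ᵥ (C *ᵥ (x.ηd t + δᵀ *ᵥ x.ω t) + K *ᵥ x.η t)) atTop (𝓝 0) := by
    refine tendsto_mulVec_zero δ ?_
    simpa using (tendsto_mulVec_zero C (f := fun t => x.ηd t + δᵀ *ᵥ x.ω t) (by
      simpa using h.ηd_tendsto.add (tendsto_mulVec_zero δᵀ h.ω_tendsto))).add
      (tendsto_mulVec_zero K h.η_tendsto)
  have h2 : Tendsto (fun t => (D.E₀ + ∑ j, Ω j • D.E j) *ᵥ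
      (modelError D J δ μ θ x t + D.bN *ᵥ (δ *ᵥ x.ηd t))) atTop (𝓝 0) := by
    refine tendsto_mulVec_zero _ ?_
    simpa using h.modelError_tendsto.add
      (tendsto_mulVec_zero D.bN (tendsto_mulVec_zero δ h.ηd_tendsto))
  have h3 := ((h1.sub (h.ω_tendsto.const_smul k₂)).add h2).sub hF
  simp only [smul_zero, sub_zero, add_zero] at h3
  refine h3.congr' ?_
  filter_upwards [eventually_ge_atTop 0] with t ht
  obtain ⟨ω', η'', e1, -, -, -, e2, e3⟩ := hx.exists_accelerations hJm ht
  have := body_error_dynamics D (hJ (x.ω t)) e2 e3 (hd t)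
  rw [← e1, this, modelError]
  module

theorem IsRegulated.tendsto_v_add (h : IsRegulated D J δ μ θ x) :
    Tendsto (fun t => x.v t + θ t) atTop (𝓝 0) := by
  have h1 : Tendsto (fun t => D.bN *ᵥ (J *ᵥ x.ω t + δ *ᵥ x.ηd t)) atTop (𝓝 0) := by
    refine tendsto_mulVec_zero _ ?_
    simpa using (tendsto_mulVec_zero J h.ω_tendsto).add (tendsto_mulVec_zero δ h.ηd_tendsto)
  have h2 := (h.modelError_tendsto.add h1).add
    (VecIn.tendsto_mulVec_zero h.ζ_tendsto (VecIn.const μ))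
  simp only [add_zero] at h2
  refine h2.congr fun t => ?_
  rw [modelError]
  abel

theorem IsRegulated.tendsto_rho_sub_sigY {T : Matrix (Blk r) (Blk r) ℝ} {ϱ : ℝ → Blk r → ℝ}
    (h : IsRegulated D J δ μ (fun t => T *ᵥ ϱ t) x) {A₀ : Matrix (Blk r) (Fin nμ) ℝ}
    (hA : Tendsto (D.sigA A₀) atTop (𝓝 0)) :
    Tendsto (fun t => D.rho (x.ω t) (x.ζ t) (x.v t) - D.sigY A₀ μ T ϱ t) atTop (𝓝 0) := by
  simp only [rho_sub_sigY]
  have h1 : Tendsto (fun t => x.ζ t - D.sigA A₀ t) atTop (𝓝 0) := by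
    simpa using h.ζ_tendsto.sub hA
  have h2 : Tendsto (fun t => x.v t + T *ᵥ ϱ t - D.sigA A₀ t *ᵥ μ) atTop (𝓝 0) := by
    simpa using h.tendsto_v_add.sub (VecIn.tendsto_mulVec_zero hA (VecIn.const μ))
  have := ((continuous_rho D).tendsto (0, 0, 0)).comp
    (h.ω_tendsto.prodMk_nhds (h1.prodMk_nhds h2))
  rwa [rho_zero] at this

theorem hasDerivWithinAt_quatErrVec (qdv : Fin 3 → ℝ) (qd4 : ℝ) {qv : ℝ → Fin 3 → ℝ} {q4 : ℝ → ℝ}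
    {qv' : Fin 3 → ℝ} {q4' : ℝ} {s : Set ℝ} {t : ℝ} (h : HasDerivWithinAt qv qv' s t)
    (h4 : HasDerivWithinAt q4 q4' s t) :
    HasDerivWithinAt (fun t => quatErrVec qdv qd4 (qv t) (q4 t)) (quatErrVec qdv qd4 qv' q4') s t :=
  ((h.fun_const_smul qd4).fun_sub (h.mulVec_const _)).fun_sub (h4.smul_const qdv)

/-- The attitude error vanishes asymptotically. -/
theorem IsRegulated.tendsto_quatErr {T : Matrix (Blk r) (Blk r) ℝ} {ϱ : ℝ → Blk r → ℝ}
    (h : IsRegulated D J δ μ (fun t => T *ᵥ ϱ t) x)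
    (hx : IsClosedLoopSolution D J δ C K d qdv qd4 k₁ k₂ k x) (hk₁ : 0 < k₁)
    (hanti : ∀ j i, ∃ H ∈ boundedFns, ∀ t, HasDerivAt H ((D.E j *ᵥ (T *ᵥ ϱ t)) i) t)
    (hbal : Tendsto (fun t => k₁ • quatErrVec qdv qd4 (x.qv t) (x.q4 t)
      + D.rho (x.ω t) (x.ζ t) (x.v t) *ᵥ (x.Rhat t - trueParam μ Ω)) atTop (𝓝 0)) :
    Tendsto (fun t => quatErrVec qdv qd4 (x.qv t) (x.q4 t)) atTop (𝓝 0) := by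
  choose H hH hHd using hanti
  set e := fun t => x.Rhat t - trueParam μ Ω with he
  set e' := fun t => k • ((D.rho (x.ω t) (x.ζ t) (x.v t))ᵀ *ᵥ x.ω t) with he'
  have ce : VecIn boundedC1Fns e := h.Rhat_mem.sub (VecIn.const _)
  have hed : ∀ t, 0 ≤ t → HasDerivWithinAt e (e' t) (Set.Ici 0) t := fun t ht =>
    (hx.Rhat_deriv t ht).sub_const _
  have he'0 : Tendsto e' atTop (𝓝 0) := by
    have := (MatIn.tendsto_mulVec_zero
      (h.ω_mem.rho D h.ζ_mem h.v_mem).bounded.transpose h.ω_tendsto).const_smul k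
    simpa using this
  -- The choice A₀ = 0 keeps only the persistent block E ∘ θ of the limiting regressor.
  have hA0 : D.sigA (0 : Matrix (Blk r) (Fin nμ) ℝ) = 0 := by
    ext1 t
    simp [DesignData.sigA]
  have hY := VecIn.tendsto_mulVec_zero (h.tendsto_rho_sub_sigY (A₀ := 0) (by
    rw [hA0]; exact tendsto_const_nhds)) ce.bounded
  have hYe : ∀ t i, (D.sigY 0 μ T ϱ t *ᵥ e t) i
      = ∑ j, e t (Sum.inr (Sum.inr j)) * (D.E j *ᵥ (T *ᵥ ϱ t)) i := by
    intro t i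
    simp [DesignData.sigY, hA0, blockMul, blockMulVec, mulVec, dotProduct, Fintype.sum_sum_type,
      mul_comm]
  have hqd : ∀ t, 0 ≤ t → HasDerivWithinAt (fun t => quatErrVec qdv qd4 (x.qv t) (x.q4 t))
      (quatErrVec qdv qd4
        ((1 / 2 : ℝ) • ((crossMat (x.qv t) + x.q4 t • (1 : Matrix (Fin 3) (Fin 3) ℝ)) *ᵥ x.ω t))
        ((1 / 2 : ℝ) * (-(x.qv t ⬝ᵥ x.ω t)))) (Set.Ici 0) t := fun t ht =>
    hasDerivWithinAt_quatErrVec qdv qd4 (hx.qv_deriv t ht) (hx.q4_deriv t ht)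
  have hqd0 : Tendsto (fun t => quatErrVec qdv qd4
        ((1 / 2 : ℝ) • ((crossMat (x.qv t) + x.q4 t • (1 : Matrix (Fin 3) (Fin 3) ℝ)) *ᵥ x.ω t))
        ((1 / 2 : ℝ) * (-(x.qv t ⬝ᵥ x.ω t)))) atTop (𝓝 0) := by
    have h1 := (MatIn.tendsto_mulVec_zero
      (h.qv_mem.crossMat.add (MatIn.smul h.q4_mem (MatIn.const 1))).bounded
      h.ω_tendsto).const_smul (1 / 2 : ℝ)
    have h2 : Tendsto (fun t => x.qv t ⬝ᵥ x.ω t) atTop (𝓝 0) := by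
      have := tendsto_finsetSum Finset.univ fun i (_ : i ∈ Finset.univ) =>
        tendsto_mul_zero_of_bounded (h.qv_mem i).1 (tendsto_pi_nhds.1 h.ω_tendsto i)
      simpa [dotProduct] using this
    have h3 := (h2.neg).const_mul (1 / 2 : ℝ)
    have hc : Continuous fun p : (Fin 3 → ℝ) × ℝ => quatErrVec qdv qd4 p.1 p.2 := by
      unfold quatErrVec
      fun_prop
    have h4 := (hc.tendsto _).comp (h1.prodMk_nhds h3)
    simpa [quatErrVec, Function.comp_def] using h4
  rw [tendsto_pi_nhds]
  intro i
  -- Z is bounded because the parameter error and the antiderivatives H are. Its derivative is the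
  -- limiting adaptive torque plus a term e'H that vanishes, so k₁q_ev + Z' → 0 by the torque
  -- balance.
  have hmain := tendsto_zero_of_add_deriv
    (p := fun t => k₁ * quatErrVec qdv qd4 (x.qv t) (x.q4 t) i)
    (Z := fun t => ∑ j, e t (Sum.inr (Sum.inr j)) * H j i t)
    (Z' := fun t => ∑ j, (e' t (Sum.inr (Sum.inr j)) * H j i t
      + e t (Sum.inr (Sum.inr j)) * (D.E j *ᵥ (T *ᵥ ϱ t)) i))
    (fun t ht => (hasDerivWithinAt_pi.1 (hqd t ht) i).const_mul k₁)
    (by simpa using (tendsto_pi_nhds.1 hqd0 i).const_mul k₁)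
    (fun t ht => HasDerivWithinAt.fun_sum fun j _ =>
      (hasDerivWithinAt_pi.1 (hed t ht) _).mul (hHd j i t).hasDerivWithinAt)
    (sum_mem_fun fun j => mul_mem (ce _).1 (hH j i)) ?_
  · have := hmain.const_mul k₁⁻¹
    simpa [hk₁.ne'] using this
  · have h1 := tendsto_finsetSum Finset.univ fun j (_ : j ∈ Finset.univ) =>
      tendsto_mul_zero_of_bounded (hH j i) (tendsto_pi_nhds.1 he'0 (Sum.inr (Sum.inr j)))
    have h2 := ((tendsto_pi_nhds.1 hbal i).sub (tendsto_pi_nhds.1 hY i)).add h1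
    simp only [Pi.zero_apply, sub_zero, Finset.sum_const_zero, add_zero] at h2
    refine h2.congr fun t => ?_
    rw [sub_mulVec, Pi.sub_apply, hYe, Finset.sum_add_distrib, Pi.add_apply, Pi.smul_apply,
      smul_eq_mul]
    simp only [mul_comm (H _ i t)]
    ring

end Convergence

/-! ### Convergence of the adaptive parameter -/

theorem theorem2
    -- coupling, damping and stiffness matrices of the flexible attachments
    {n : ℕ} (δ : Matrix (Fin 3) (Fin n) ℝ) (C K : Matrix (Fin n) (Fin n) ℝ)
    (hC : C.PosDef) (hK : K.PosDef)
    -- system generating the disturbance, for every admissible frequency vector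
    {nσ : ℕ} (S : Set (Fin nσ → ℝ)) {r : Fin 3 → ℕ} (hr : ∀ i, 0 < r i)
    (a : (Fin nσ → ℝ) → ∀ i, Fin (r i) → ℝ)
    (ha : ∀ s ∈ S, ∀ i, HasSimpleImaginaryRoots (exoPoly (a s i)))
    -- internal model pairs and the solution of the Sylvester equations
    (M : ∀ i, Matrix (Fin (r i)) (Fin (r i)) ℝ) (N : ∀ i, Fin (r i) → ℝ)
    (hM : ∀ i, IsHurwitz (M i)) (hMN : ∀ i, IsControllable (M i) (N i))
    (T : (Fin nσ → ℝ) → ∀ i, Matrix (Fin (r i)) (Fin (r i)) ℝ)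
    (hT : ∀ s ∈ S, ∀ i,
      T s i * exoPhi (a s i) - M i * T s i = Matrix.vecMulVec (N i) exoPsi)
    -- true value of the unknown frequencies
    (σ : Fin nσ → ℝ) (hσ : σ ∈ S) :
    ∃ k₂min : ℝ, 0 < k₂min ∧
      ∀ (k₁ k₂ k : ℝ), 0 < k₁ → k₂min ≤ k₂ → 0 < k →
      -- design data, with linear parameterization of `Ψ T(σ)⁻¹`
      ∀ (nμ ℓ : ℕ) (D : DesignData r nμ ℓ), D.M = M → D.N = N →
      ∀ (Ω : (Fin nσ → ℝ) → Fin ℓ → ℝ),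
        (∀ s ∈ S, blockPsi * (Matrix.blockDiagonal' (T s))⁻¹ = D.E₀ + ∑ j, Ω s j • D.E j) →
        NonRedundant S D.E Ω →
      -- inertia matrix with uncertain parameter `μ`
      ∀ (J : Matrix (Fin 3) (Fin 3) ℝ) (μ : Fin nμ → ℝ),
        J.PosDef → (J - δ * δᵀ).PosDef → inertiaVec J = D.Lbar₁ *ᵥ μ + D.Lbar₀ →
      -- disturbance
      ∀ (Nd : Fin 3 → ℕ) (amp₀ : Fin 3 → ℝ) (amp freq phase : ∀ i, Fin (Nd i) → ℝ)
        (d : ℝ → Fin 3 → ℝ), d = disturbance amp₀ amp freq phase →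
        (∀ i t, iteratedDeriv (r i) (fun s => d s i) t =
          ∑ m : Fin (r i), a σ i m * iteratedDeriv (m : ℕ) (fun s => d s i) t) →
      -- constant desired attitude
      ∀ (qdv : Fin 3 → ℝ) (qd4 : ℝ), qdv ⬝ᵥ qdv + qd4 ^ 2 = 1 →
      -- every solution of the closed-loop system, and every `A₀`
      ∀ (x : Signals n r nμ ℓ), IsClosedLoopSolution D J δ C K d qdv qd4 k₁ k₂ k x →
      ∀ (A₀ : Matrix (Blk r) (Fin nμ) ℝ) (y : ℝ → Matrix (Fin 3) (ParIdx nμ ℓ) ℝ),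
        y = D.sigY A₀ μ (Matrix.blockDiagonal' (T σ)) (exoState d) →
        Tendsto (fun t => y t *ᵥ (x.Rhat t - trueParam μ (Ω σ))) atTop (𝓝 0) ∧
        (IsPEMatrix (fun t => (y t)ᵀ) →
          Tendsto (fun t => x.Rhat t - trueParam μ (Ω σ)) atTop (𝓝 0)) := by
  have hPs := fun i => (hM i).exists_isLyapunov
  choose Pb hPb using hPs
  have hP := IsLyapunov.blockDiagonal' hPb
  -- The threshold is fixed before the inertia, the disturbance and the parameterization are
  -- introduced; it sees the latter only through ΨT(σ)⁻¹.
  obtain ⟨α, ε, w, κ, hα, hw, hκ, hlow, hgain⟩ := exists_gain_bound hP hC hK δ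
    ((blockPsi : Matrix (Fin 3) (Blk r) ℝ) * (Matrix.blockDiagonal' (T σ))⁻¹) (blockCol N)
  refine ⟨κ, hκ, ?_⟩
  intro k₁ k₂ k hk₁ hk₂ hk nμ ℓ D hDM hDN Ω hpar hE J μ hJ hJm hJμ Nd amp₀ amp freq phase d hd hda
    qdv qd4 hqd x hx A₀ y hy
  subst hDM hDN hy
  have hpar' : ∀ s ∈ S, (blockPsi : Matrix (Fin 3) (Blk r) ℝ) * (Matrix.blockDiagonal' (T s))⁻¹
      = D.E₀ + ∑ j, Ω s j • D.E j := hpar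
  have hTdet : IsUnit (Matrix.blockDiagonal' (T σ)).det :=
    isUnit_det_blockDiagonal' fun i => det_ne_zero_of_sylvester (hMN i) (hT σ hσ i)
  have hϱb : VecIn boundedC1Fns (exoState d : ℝ → Blk r → ℝ) := exoState_boundedC1 hd
  have hΨϱ : ∀ t, blockPsi *ᵥ (exoState d t : Blk r → ℝ) = d t := blockPsi_mulVec_exoState hr d
  have hdb : VecIn boundedC1Fns d := by
    have := hϱb.mulVec blockPsi
    simpa only [hΨϱ] using this
  have hθb := hϱb.mulVec (Matrix.blockDiagonal' (T σ))
  have hθ : ∀ t, HasDerivAt (fun t => Matrix.blockDiagonal' (T σ) *ᵥ (exoState d t : Blk r → ℝ))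
      (D.bM *ᵥ (Matrix.blockDiagonal' (T σ) *ᵥ exoState d t) + D.bN *ᵥ d t) t := by
    intro t
    refine ((((hasDerivAt_exoState hd hda t).hasDerivWithinAt (s := Set.univ)).mulVec_const
      (Matrix.blockDiagonal' (T σ))).hasDerivAt Filter.univ_mem).congr_deriv ?_
    rw [mulVec_mulVec, block_sylvester (hT σ hσ), add_mulVec, ← mulVec_mulVec, ← mulVec_mulVec,
      hΨϱ]
    rfl
  have hdθ : ∀ t, (D.E₀ + ∑ j, Ω σ j • D.E j) *ᵥ
      (Matrix.blockDiagonal' (T σ) *ᵥ (exoState d t : Blk r → ℝ)) = d t := by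
    intro t
    rw [← hpar' σ hσ, mulVec_mulVec, Matrix.mul_assoc, Matrix.nonsing_inv_mul _ hTdet,
      Matrix.mul_one, hΨϱ]
  rw [hpar' σ hσ] at hgain
  have hJw := inertia_mulVec D hJ.transpose_eq hJμ
  obtain ⟨V, V', c, hc, hV, hV', hVc⟩ := hx.exists_energy hP hC.transpose_eq hK.transpose_eq hJm hJw
    hk₁ hk hθ hdθ hqd hα hw hk₂ hlow hgain
  have hreg := hx.isRegulated hP hJm hθb hdb hc hV hV' hVc
  have hbal := hreg.tendsto_balance hx hJm hJw hdθ hdb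
  have hqe := hreg.tendsto_quatErr hx hk₁ (fun j i => exists_bounded_antideriv_mulVec hr ha hM hMN
    hT hσ hpar' hE hd hda hθb.bounded hθ j i) hbal
  obtain ⟨hAb, hA⟩ := sigA_tendsto D hP A₀
  have hR : VecIn boundedC1Fns fun t => x.Rhat t - trueParam μ (Ω σ) :=
    hreg.Rhat_mem.sub (VecIn.const _)
  have hy : Tendsto (fun t => D.sigY A₀ μ (Matrix.blockDiagonal' (T σ)) (exoState d) t *ᵥ
      (x.Rhat t - trueParam μ (Ω σ))) atTop (𝓝 0) := by
    -- With e the parameter error, ye = (k₁q_ev + ρe) - k₁q_ev - (ρ - y)e, and each of the three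
    -- terms tends to zero.
    have h := (hbal.sub (hqe.const_smul k₁)).sub
      (VecIn.tendsto_mulVec_zero (hreg.tendsto_rho_sub_sigY hA) hR.bounded)
    simp only [smul_zero, sub_zero] at h
    refine h.congr fun t => ?_
    rw [sub_mulVec]
    abel
  refine ⟨hy, ?_⟩
  rintro ⟨b, hb⟩
  -- The parameter error paired with yᵀb equals (ye)·b → 0, and its derivative kρᵀω vanishes with ω,
  -- so it varies slowly enough for excitation to apply.
  refine hb.tendsto_zero ((sigY_bounded D hAb μ hϱb).transpose.mulVec (VecIn.const b))
    (x' := fun t => k • ((D.rho (x.ω t) (x.ζ t) (x.v t))ᵀ *ᵥ x.ω t))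
    (fun i t ht => hasDerivWithinAt_pi.1 ((hx.Rhat_deriv t ht).sub_const _) i) ?_ ?_
  · have h := (MatIn.tendsto_mulVec_zero
      (hreg.ω_mem.rho D hreg.ζ_mem hreg.v_mem).bounded.transpose hreg.ω_tendsto).const_smul k
    rw [smul_zero] at h
    exact tendsto_pi_nhds.1 h
  · have hc : Continuous fun v : Fin 3 → ℝ => v ⬝ᵥ b := by fun_prop
    have h := (hc.tendsto 0).comp hy
    rw [zero_dotProduct] at h
    refine h.congr fun t => ?_
    rw [mulVec_transpose, dotProduct_comm (x.Rhat t - _), ← dotProduct_mulVec, dotProduct_comm b]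
    rfl
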